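/- **Conventions.** $\mathbb N=\{1,2,\dots\}$. A shift space is a closed shift-invariant set $X\subseteq\mathcal A^{\mathbb Z}$, $\mathcal A$ a finite discrete alphabet; it is an SFT if it is the set of all sequences avoiding some finite set of words. For a finite list $L\subseteq\mathcal A^*$ of words, the renewal system $\mathsf X(L)$ is the shift space of all $x\in\mathcal A^{\mathbb Z}$ all of whose finite factors are factors of concatenations of words from $L$. Flow equivalence is the equivalence relation on shift spaces generated by conjugacy and by symbol expansion (replacing a letter $a$ by $a\diamond$ with a new symbol $\diamond$). For a finite directed graph $E$ with $n$ vertices and adjacency matrix $A_E$, let $\mathsf X_E$ be its edge shift and $\mathrm{BF}(A_E)=\mathbb Z^n/\mathbb Z^n(\mathrm{Id}-A_E)$. **The class $B$.** Let $r\ge 2$ and $n_1,\dots,n_r,c_1,\dots,c_r,d,N\in\mathbb N$. The list in $B$ with these parameters consists, for pairwise distinct letters $\alpha_{i,s},\tilde\alpha_{i,s},\gamma_{k,i,s},\beta_l$, of the words - $\alpha_i=\alpha_{i,1}\cdots\alpha_{i,n_1}$ and $\tilde\alpha_i=\tilde\alpha_{i,1}\cdots\tilde\alpha_{i,n_1}$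 for $1\le i\le c_1$; - $\gamma_{k,i}=\gamma_{k,i,1}\cdots\gamma_{k,i,n_k}$ for $2\le k\le r$, $1\le i\le c_k$; - $\alpha_{i_1}\gamma_{2,i_2}\cdots\gamma_{r,i_r}\beta_l^N$ and $\beta_l^N\tilde\alpha_{i_1}\gamma_{2,i_2}\cdots\gamma_{r,i_r}$ for $1\le i_j\le c_j$, $1\le l\le d$. **The class $H$.** Let $W_1,\dots,W_m\in B$ ($m\ge 0$) have pairwise disjoint alphabets, where $W_j$ has parameters $r_j,\ n_{j,k},\ c_{j,k}\ (1\le k\le r_j),\ d_j,\ N_j$. Let $\tilde W$ be a finite set of $a\ge 0$ primitive words (nonempty and not a proper power $u^k$, $k\ge2$) that share no letters with each other or with the words of the $W_j$. Let $p\in\mathbb N$. A list $L$ is in $H$, with these data, if it is obtained from $W_1\cup\dots\cup W_m\cup\tilde W$ by replacing each occurrence of each letter $b$ by a word $b_1\cdots b_p$, where all the letters $b_i$ (for all $b$ and $i$) are pairwise distinct. **Theorem.** Let $L\in H$ with data as above. Put $\alpha_j=\tilde\alpha_j=c_{j,1}$, $\beta_j=d_j$, $\gamma_{j,k}=c_{j,k}$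 for $2\le k\le r_j$, and $$\gamma=a+\sum_{j=1}^m\Big(\alpha_j+\tilde\alpha_j+\sum_{k=2}^{r_j-1}\gamma_{j,k}\Big),\qquad b_j=\alpha_j\beta_j\gamma_{j,2}\cdots\gamma_{j,r_j},\qquad t_j=\tilde\alpha_j\gamma_{j,2}\cdots\gamma_{j,r_j-1}(b_j-\beta_j)-1 .$$ Then $\mathsf X(L)$ is an SFT, it is conjugate to the edge shift of some finite directed graph, and for every finite directed graph $E$ whose edge shift is flow equivalent to $\mathsf X(L)$ (in particular, for every $E$ with $\mathsf X_E$ conjugate to $\mathsf X(L)$) the Bowen–Franks group $\mathrm{BF}(A_E)$ is cyclic (finite, possibly trivial, or infinite) and $$\det(\mathrm{Id}-A_E)=1-\gamma+\sum_{j=1}^m\left(\gamma_{j,r_j}t_j-b_j\right).$$ -/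

import Mathlib

open SymbolicDynamics.FullShift

/-! ### Shift spaces -/

/-- The finite word `w` occurs as a factor of the biinfinite sequence `x`. -/
def OccursIn {A : Type} (w : List A) (x : ℤ → A) : Prop :=
  ∃ i : ℤ, ∀ (k : ℕ) (hk : k < w.length), x (i + k) = w[k]

/-- The biinfinite sequences that contain no word from `F`. -/
def avoiding {A : Type} (F : Set (List A)) : Set (ℤ → A) :=
  {x | ∀ w ∈ F, ¬ OccursIn w x}

theorem isClosed_avoiding {A : Type} [TopologicalSpace A] [DiscreteTopology A]
    (F : Set (List A)) : IsClosed (avoiding F) := by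
  have h : avoiding F = ⋂ w ∈ F, ⋂ i : ℤ,
      (⋂ (k : ℕ) (hk : k < w.length), {x : ℤ → A | x (i + k) = w[k]})ᶜ := by
    ext x
    simp only [avoiding, OccursIn, Set.mem_ofPred_eq, Set.mem_iInter, Set.mem_compl_iff, not_exists]
  rw [h]
  refine isClosed_biInter fun w _ => isClosed_iInter fun i => ?_
  rw [isClosed_compl_iff]
  have h2 : (⋂ (k : ℕ) (hk : k < w.length), {x : ℤ → A | x (i + k) = w[k]}) =
      ⋂ k : Fin w.length, {x : ℤ → A | x (i + (k : ℕ)) = w[k]} := by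
    ext x
    simp only [Set.mem_iInter, Set.mem_ofPred_eq]
    exact ⟨fun hx k => hx k k.2, fun hx k hk => hx ⟨k, hk⟩⟩
  rw [h2]
  refine isOpen_iInter_of_finite fun k => ?_
  have hc : Continuous fun x : ℤ → A => x (i + (k : ℕ)) := continuous_apply _
  exact (isOpen_discrete ({w[k]} : Set A)).preimage hc

theorem mapsTo_shift_avoiding {A : Type} (F : Set (List A)) (g : ℤ) :
    Set.MapsTo (shift g) (avoiding F) (avoiding F) := by
  rintro x hx w hw ⟨i, hi⟩
  refine hx w hw ⟨g + i, fun k hk => ?_⟩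
  have := hi k hk
  rw [shift_apply, ← add_assoc] at this
  exact this

/-- A shift space: a closed shift invariant set of biinfinite sequences over a finite discrete
alphabet, bundled together with its alphabet. -/
structure ShiftSpace where
  Alphabet : Type
  [finite : Finite Alphabet]
  [topology : TopologicalSpace Alphabet]
  [discrete : DiscreteTopology Alphabet]
  toSubshift : Subshift Alphabet ℤ

namespace ShiftSpace

attribute [instance] ShiftSpace.finite ShiftSpace.topology ShiftSpace.discrete

/-- The shift space `X_F` of all sequences over `A` that contain no word from `F`. -/
def ofForbidden (A : Type) [Finite A] (F : Set (List A)) : ShiftSpace :=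
  letI : TopologicalSpace A := ⊥
  haveI : DiscreteTopology A := ⟨rfl⟩
  { Alphabet := A
    toSubshift :=
      { carrier := avoiding F
        isClosed := isClosed_avoiding F
        mapsTo := mapsTo_shift_avoiding F } }

/-- The points of a shift space, as a topological space (with the product topology). -/
abbrev Points (X : ShiftSpace) : Type := X.toSubshift.carrier

/-- The shift map `σ(x)_i = x_{i+1}`. -/
def σ (X : ShiftSpace) (x : X.Points) : X.Points :=
  ⟨shift 1 x.1, X.toSubshift.mapsTo 1 x.2⟩

/-- The language of a shift space: the words that occur in at least one point. -/
def language (X : ShiftSpace) : Language X.Alphabet :=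
  {w | ∃ x ∈ X.toSubshift.carrier, OccursIn w x}

/-- `X` is a shift of finite type: `X = X_F` for a finite set `F` of forbidden words. -/
def IsSFT (X : ShiftSpace) : Prop :=
  ∃ F : Set (List X.Alphabet), F.Finite ∧ X.toSubshift.carrier = avoiding F

/-- Conjugacy: there is a continuous shift commuting bijection. -/
def Conjugate (X Y : ShiftSpace) : Prop :=
  ∃ φ : X.Points → Y.Points,
    Continuous φ ∧ Function.Bijective φ ∧ ∀ x, φ (X.σ x) = Y.σ (φ x)

open Classical in
/-- The word obtained from `w` by replacing every occurrence of the letter `a` by `a◇`, where the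
new symbol `◇` is `none`. -/
noncomputable def expandWord {A : Type} (a : A) (w : List A) : List (Option A) :=
  w.flatMap fun b => if b = a then [some b, none] else [some b]

/-- Symbol expansion of the letter `a`: the shift space whose points are the sequences all of
whose finite factors are factors of words obtained from the language of `X` by replacing
`a` by `a◇`. -/
noncomputable def symbolExpansion (X : ShiftSpace) (a : X.Alphabet) : ShiftSpace :=
  ofForbidden (Option X.Alphabet) {u | ¬ ∃ w ∈ X.language, u <:+: expandWord a w}

/-- Flow equivalence: the equivalence relation generated by conjugacy and symbol expansion. -/
def FlowEquivalent : ShiftSpace → ShiftSpace → Prop :=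
  Relation.EqvGen fun X Y => Conjugate X Y ∨ ∃ a : X.Alphabet, Y = X.symbolExpansion a

end ShiftSpace

/-- The set of factors of elements of `L*`. -/
def factorLanguage {A : Type} (L : Language A) : Language A :=
  {u | ∃ w ∈ KStar.kstar L, u <:+: w}

/-- The renewal system `X(L)`: the sequences all of whose finite factors are factors of
concatenations of words from `L`. -/
def renewalSystem {A : Type} [Finite A] (L : Language A) : ShiftSpace :=
  ShiftSpace.ofForbidden A {u | u ∉ factorLanguage L}

/-! ### Finite directed graphs, edge shifts and the Bowen–Franks invariant -/

/-- A finite directed graph `(E⁰, E¹, r, s)` (multiple edges and loops are allowed). -/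
structure FiniteDigraph where
  Vertex : Type
  Edge : Type
  [fintypeVertex : Fintype Vertex]
  [decEqVertex : DecidableEq Vertex]
  [finiteEdge : Finite Edge]
  s : Edge → Vertex
  r : Edge → Vertex

namespace FiniteDigraph

attribute [instance] FiniteDigraph.fintypeVertex FiniteDigraph.decEqVertex FiniteDigraph.finiteEdge

/-- The edge shift of `E`: the biinfinite paths of `E`. -/
def edgeShift (E : FiniteDigraph) : ShiftSpace :=
  ShiftSpace.ofForbidden E.Edge {w | ∃ e f : E.Edge, w = [e, f] ∧ E.r e ≠ E.s f}

theorem mem_edgeShift_iff (E : FiniteDigraph) (x : ℤ → E.Edge) :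
    x ∈ (edgeShift E).toSubshift.carrier ↔ ∀ i : ℤ, E.r (x i) = E.s (x (i + 1)) := by
  change (∀ w, (∃ e f : E.Edge, w = [e, f] ∧ E.r e ≠ E.s f) → ¬ OccursIn w x) ↔ _
  constructor
  · intro h i
    by_contra hne
    refine h _ ⟨x i, x (i + 1), rfl, hne⟩ ⟨i, fun k hk => ?_⟩
    have hk2 : k < 2 := by simpa using hk
    interval_cases k <;> simp
  · rintro h w ⟨e, f, rfl, hne⟩ ⟨i, hi⟩
    have h0 := hi 0 (by simp)
    have h1 := hi 1 (by simp)
    simp only [Nat.cast_zero, add_zero, Nat.cast_one, List.getElem_cons_zero,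
      List.getElem_cons_succ] at h0 h1
    exact hne (by rw [← h0, ← h1]; exact h i)

/-- The adjacency matrix: the entry at `(u, v)` is the number of edges from `u` to `v`. -/
noncomputable def adjacency (E : FiniteDigraph) : Matrix E.Vertex E.Vertex ℤ :=
  Matrix.of fun u v => (Nat.card {e : E.Edge // E.s e = u ∧ E.r e = v} : ℤ)

/-- The Bowen–Franks group `ℤⁿ / ℤⁿ (Id - A)` (row vectors), where `A` is the adjacency matrix. -/
abbrev BowenFranks (E : FiniteDigraph) : Type :=
  (E.Vertex → ℤ) ⧸ LinearMap.range (1 - E.adjacency).vecMulLinear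

end FiniteDigraph

/-! ### The generating lists in the classes `B` and `H` -/

/-- The set of letters that occur in the words of a list. -/
def lettersOf {A : Type} (L : Language A) : Set A := {x | ∃ w ∈ L, x ∈ w}

/-- The parameters `r ≥ 2`, `n₁, …, n_r, c₁, …, c_r, d, N ≥ 1` of a list in `B`. Only the values
`n k` and `c k` for `1 ≤ k ≤ r` are used. -/
structure BlockParams where
  r : ℕ
  n : ℕ → ℕ
  c : ℕ → ℕ
  d : ℕ
  N : ℕ
  two_le_r : 2 ≤ r
  n_pos : ∀ k, 1 ≤ k → k ≤ r → 0 < n k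
  c_pos : ∀ k, 1 ≤ k → k ≤ r → 0 < c k
  d_pos : 0 < d
  N_pos : 0 < N

/-- Names for the letters `α_{i,s}`, `α̃_{i,s}`, `γ_{k,i,s}` and `β_l`; the indices `i`, `s`, `l`
are counted from `0`, while `k` runs through `2, …, r`. -/
inductive BlockLetter : Type
  | alpha (i s : ℕ)
  | alphaTilde (i s : ℕ)
  | gamma (k i s : ℕ)
  | beta (l : ℕ)

namespace BlockParams

/-- `α_i = α_{i,1} ⋯ α_{i,n₁}`. -/
def alphaWord (P : BlockParams) (i : ℕ) : List BlockLetter :=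
  (List.range (P.n 1)).map (BlockLetter.alpha i)

/-- `α̃_i = α̃_{i,1} ⋯ α̃_{i,n₁}`. -/
def alphaTildeWord (P : BlockParams) (i : ℕ) : List BlockLetter :=
  (List.range (P.n 1)).map (BlockLetter.alphaTilde i)

/-- `γ_{k,i} = γ_{k,i,1} ⋯ γ_{k,i,n_k}`. -/
def gammaWord (P : BlockParams) (k i : ℕ) : List BlockLetter :=
  (List.range (P.n k)).map (BlockLetter.gamma k i)

/-- `γ_{2,i₂} γ_{3,i₃} ⋯ γ_{r,i_r}`. -/
def gammaProduct (P : BlockParams) (i : ℕ → ℕ) : List BlockLetter :=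
  (List.range' 2 (P.r - 1)).flatMap fun k => P.gammaWord k (i k)

/-- `β_l^N`. -/
def betaPower (P : BlockParams) (l : ℕ) : List BlockLetter :=
  List.replicate P.N (BlockLetter.beta l)

/-- The index vectors `(i₁, …, i_r)` with `1 ≤ i_j ≤ c_j` (here: `0 ≤ i_j < c_j`). -/
def IsIndex (P : BlockParams) (i : ℕ → ℕ) : Prop :=
  ∀ j, 1 ≤ j → j ≤ P.r → i j < P.c j

/-- The words of the list in `B` with parameters `P`. -/
def words (P : BlockParams) : Language BlockLetter :=
  {w | (∃ i < P.c 1, w = P.alphaWord i) ∨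
    (∃ i < P.c 1, w = P.alphaTildeWord i) ∨
    (∃ k, 2 ≤ k ∧ k ≤ P.r ∧ ∃ i < P.c k, w = P.gammaWord k i) ∨
    (∃ i, P.IsIndex i ∧ ∃ l < P.d,
      w = P.alphaWord (i 1) ++ P.gammaProduct i ++ P.betaPower l) ∨
    (∃ i, P.IsIndex i ∧ ∃ l < P.d,
      w = P.betaPower l ++ P.alphaTildeWord (i 1) ++ P.gammaProduct i)}

/-- `W` is a list in `B` with parameters `P`: it is obtained from the list of words above by
naming the letters by pairwise distinct symbols of the alphabet `A`. -/
def IsListInB {A : Type} (P : BlockParams) (W : Language A) : Prop :=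
  ∃ ι : BlockLetter → A, Set.InjOn ι (lettersOf P.words) ∧ W = List.map ι '' P.words

end BlockParams

/-- A word is primitive if it is nonempty and not a proper power `u^k`, `k ≥ 2`, of a word. -/
def IsPrimitiveWord {A : Type} (v : List A) : Prop :=
  v ≠ [] ∧ ∀ (u : List A) (k : ℕ), 2 ≤ k → v ≠ (List.replicate k u).flatten

/-- The parameters of a list in `H`: the number `m` of lists `W_j` from `B` and their parameters,
the number `a` of the additional words (the set `W̃`), and the length `p` of the words that are
substituted for the letters. -/
structure HParams where
  m : ℕ
  block : Fin m → BlockParams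
  a : ℕ
  p : ℕ
  p_pos : 0 < p

namespace HParams

/-- `L` is a list in `H̃` with parameters `D`: it is the union of lists `W_j` in `B` with disjoint
alphabets and a set `V` of `a` primitive words that share no letters with each other or with the
words of the lists `W_j`. -/
def IsListInHTilde {A : Type} (D : HParams) (L : Language A) : Prop :=
  ∃ (W : Fin D.m → Language A) (V : Set (List A)),
    (∀ j, (D.block j).IsListInB (W j)) ∧
    (∀ i j, i ≠ j → Disjoint (lettersOf (W i)) (lettersOf (W j))) ∧
    V.Finite ∧ V.ncard = D.a ∧
    (∀ v ∈ V, IsPrimitiveWord v) ∧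
    (∀ v ∈ V, ∀ w ∈ V, v ≠ w → v.Disjoint w) ∧
    (∀ v ∈ V, ∀ j, ∀ x ∈ v, x ∉ lettersOf (W j)) ∧
    ∀ w, w ∈ L ↔ (∃ j, w ∈ W j) ∨ w ∈ V

/-- `L` is a list in `H` with parameters `D`: it is obtained from a list `L'` in `H̃` by replacing
every letter `b` by a word `b₁ ⋯ b_p`, where all the letters `b_i` are pairwise distinct. -/
def IsListInH {A : Type} (D : HParams) (L : Language A) : Prop :=
  ∃ (B : Type) (_ : Finite B) (L' : Language B) (ι : B → Fin D.p → A),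
    D.IsListInHTilde L' ∧
    (∀ b ∈ lettersOf L', ∀ b' ∈ lettersOf L', ∀ i i', ι b i = ι b' i' → b = b' ∧ i = i') ∧
    L = (fun w : List B => w.flatMap fun b => List.ofFn (ι b)) '' L'

end HParams

/-! ### The determinant formula -/

/-- The fragmentation parameters of a sum of building blocks: the number `a` of free letters, and
for every block `j` the integers `α_j`, `α̃_j`, `β_j`, `γ_{j,2}, …, γ_{j,r_j}` that count the
letters into which the corresponding letter of the building block is fragmented. -/
structure FragParams where
  m : ℕ
  a : ℤ
  r : Fin m → ℕ
  alpha : Fin m → ℤ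
  alphaTilde : Fin m → ℤ
  beta : Fin m → ℤ
  gamma : Fin m → ℕ → ℤ

namespace FragParams

/-- `γ = a + ∑_j (α_j + α̃_j + ∑_{k=2}^{r_j-1} γ_{j,k})`. -/
def gammaSum (q : FragParams) : ℤ :=
  q.a + ∑ j, (q.alpha j + q.alphaTilde j + ∑ k ∈ Finset.Ico 2 (q.r j), q.gamma j k)

/-- `b_j = α_j β_j γ_{j,2} ⋯ γ_{j,r_j}`. -/
def b (q : FragParams) (j : Fin q.m) : ℤ :=
  q.alpha j * q.beta j * ∏ k ∈ Finset.Icc 2 (q.r j), q.gamma j k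

/-- `t_j = α̃_j γ_{j,2} ⋯ γ_{j,r_j-1} (b_j - β_j) - 1`. -/
def t (q : FragParams) (j : Fin q.m) : ℤ :=
  q.alphaTilde j * (∏ k ∈ Finset.Ico 2 (q.r j), q.gamma j k) * (q.b j - q.beta j) - 1

/-- `1 - γ + ∑_j (γ_{j,r_j} t_j - b_j)`. -/
def detValue (q : FragParams) : ℤ :=
  1 - q.gammaSum + ∑ j, (q.gamma j (q.r j) * q.t j - q.b j)

end FragParams

/-- The fragmentation parameters of a list in `H`: `α_j = α̃_j = c_{j,1}`, `β_j = d_j`,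
`γ_{j,k} = c_{j,k}`, and `a` is the number of additional words. -/
def HParams.frag (D : HParams) : FragParams where
  m := D.m
  a := D.a
  r j := (D.block j).r
  alpha j := (D.block j).c 1
  alphaTilde j := (D.block j).c 1
  beta j := (D.block j).d
  gamma j k := (D.block j).c k

/-!
The number `det (Id - A_E)` and the Bowen–Franks group of a finite graph `E` are invariants of flow
equivalence of edge shifts. It is therefore enough to find one graph whose edge shift is conjugate
to `X(L)` and to compute its invariants.

**Invariance under conjugacy.** A conjugacy of edge shifts of essential graphs, composed with a
power of the shift, maps futures to futures, and its inverse maps pasts to pasts. Counting the paths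
with a given past whose image has a given future yields a nonnegative integer matrix; composition
of conjugacies becomes multiplication of matrices, and the shift becomes the adjacency matrix
(`CausalEquiv.matrix_trans`, `CausalEquiv.matrix_shift`). Hence the adjacency matrices are shift
equivalent (`shiftEquivOfWindow`), and shift equivalence preserves both invariants
(`ShiftEquiv.sameDetCoker`). Graphs that are not essential are trimmed first.

**Invariance under symbol expansion.** A shift space is conjugate to an edge shift if and only if
membership can be tested on windows of a fixed length, and then its block graph presents it. If `X`
is such a shift space, then the expansion of a letter is presented by the block graph of `X` with
the edges that carry this letter subdivided (`ShiftSpace.IsStep.conjugate_symbolExpansion`), and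
subdivision does not change the invariants since the new vertices can be eliminated
(`FiniteDigraph.subdivide_sameInvariants`). Conversely, if the expansion is of finite type, then so
is `X`. An induction over the generated equivalence relation gives
`ShiftSpace.FlowEquivalent.invariants`.

**A graph for `X(L)`.** The words of `L` are built from the syllables `α_i`, `α̃_i`, `γ_{k,i}`,
`β_l^N` and the additional primitive words. A deterministic automaton (`HParams.step`) reads these
syllables and remembers either the longest suffix `α γ₂ ⋯ γ_k` that has just been read, or the part
that is still missing of a word `β^N α̃ γ₂ ⋯ γ_r`. After `α γ₂ ⋯ γ_r` a power `β^N` is always taken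
to complete a word, so that the reading is unambiguous. Its paths are labelled by the factors of
`L*`. Spelling out the syllables gives a graph with labels in the alphabet of `L`, and a biinfinite
path is determined by its labels (`HParams.IsCoding.labelSeq_injective`): syllables other than powers
of letters are read synchronously because they are not rotations of themselves; if two paths with
equal labels never met in the past, then they could not have read any `α`, hence could not have been
in a state of the first kind, hence could not have read any `β^N`, and so would both always be
in the initial state, which means that they meet.

**The determinant.** After one row operation all states but the initial one can be eliminated from
`Id - A` (`HParams.sameDetCoker_graph`). What remains is a `1 × 1` matrix, whose entry is the value
in the theorem and whose cokernel is cyclic.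
-/

set_option autoImplicit false

/-! ### Shift equivalent integer matrices -/

open Polynomial in
/-- The determinant of `p(A)` is the product of the values of `p` at the eigenvalues of `A`. -/
theorem det_aeval_eq_prod_roots {n : Type*} [Fintype n] [DecidableEq n] (A : Matrix n n ℂ)
    (p : ℂ[X]) : (aeval A p).det = (A.charpoly.roots.map fun x => p.eval x).prod := by
  have hcard : A.charpoly.roots.card = Fintype.card n := by
    rw [← Matrix.charpoly_natDegree_eq_dim A]
    exact (IsAlgClosed.splits A.charpoly).natDegree_eq_card_roots.symm
  have hlin : ∀ a : ℂ, (aeval A (X - C a)).det = (A.charpoly.roots.map fun x => x - a).prod := by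
    intro a
    have h1 : A.charpoly.eval a = (A.charpoly.roots.map fun x => a - x).prod := by
      conv_lhs => rw [(IsAlgClosed.splits A.charpoly).eq_prod_roots_of_monic A.charpoly_monic]
      rw [eval_multiset_prod, Multiset.map_map]
      simp
    have h2 : (aeval A (X - C a)) = -(Matrix.scalar n a - A) := by
      simp [Algebra.algebraMap_eq_smul_one, Matrix.smul_one_eq_diagonal]
    rw [h2, Matrix.det_neg, ← Matrix.eval_charpoly, h1, ← hcard]
    have h3 : (A.charpoly.roots.map fun x => x - a)
        = (A.charpoly.roots.map fun x => a - x).map Neg.neg := by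
      rw [Multiset.map_map]; simp
    rw [h3, Multiset.prod_map_neg, Multiset.card_map]
  have hprod : ∀ s : Multiset ℂ, (aeval A (s.map fun a => X - C a).prod).det
      = (A.charpoly.roots.map fun x => ((s.map fun a => X - C a).prod).eval x).prod := by
    intro s
    induction s using Multiset.induction with
    | empty => simp
    | cons a s ih =>
      rw [Multiset.map_cons, Multiset.prod_cons, map_mul, Matrix.det_mul, ih, hlin,
        ← Multiset.prod_map_mul]
      simp
  rw [(IsAlgClosed.splits p).eq_prod_roots, map_mul, Matrix.det_mul, hprod]
  simp only [eval_mul, eval_C, Multiset.prod_map_mul, Multiset.map_const', Multiset.prod_replicate,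
    hcard]
  congr 1
  rw [aeval_C, Algebra.algebraMap_eq_smul_one, Matrix.det_smul, Matrix.det_one, mul_one]

/-- Shift equivalence (of some lag) of square integer matrices. -/
structure ShiftEquiv {m n : Type*} [Fintype m] [DecidableEq m] [Fintype n] [DecidableEq n]
    (A : Matrix m m ℤ) (B : Matrix n n ℤ) where
  R : Matrix m n ℤ
  S : Matrix n m ℤ
  lag : ℕ
  intertwine_R : A * R = R * B
  intertwine_S : S * A = B * S
  mul_RS : R * S = A ^ lag
  mul_SR : S * R = B ^ lag

/-- The cokernel `ℤⁿ / ℤⁿ M` of a square integer matrix acting on row vectors. -/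
abbrev RowCoker {n : Type*} [Fintype n] [DecidableEq n] (M : Matrix n n ℤ) : Type _ :=
  (n → ℤ) ⧸ LinearMap.range M.vecMulLinear

/-- Two square integer matrices have the same determinant and isomorphic row cokernels. -/
def SameDetCoker {m n : Type*} [Fintype m] [DecidableEq m] [Fintype n] [DecidableEq n]
    (M : Matrix m m ℤ) (N : Matrix n n ℤ) : Prop :=
  M.det = N.det ∧ Nonempty (RowCoker M ≃+ RowCoker N)

theorem SameDetCoker.refl {m : Type*} [Fintype m] [DecidableEq m] (M : Matrix m m ℤ) :
    SameDetCoker M M := ⟨rfl, ⟨AddEquiv.refl _⟩⟩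

theorem SameDetCoker.symm {m n : Type*} [Fintype m] [DecidableEq m] [Fintype n] [DecidableEq n]
    {M : Matrix m m ℤ} {N : Matrix n n ℤ} (h : SameDetCoker M N) : SameDetCoker N M :=
  ⟨h.1.symm, h.2.map AddEquiv.symm⟩

theorem SameDetCoker.trans {m n k : Type*} [Fintype m] [DecidableEq m] [Fintype n] [DecidableEq n]
    [Fintype k] [DecidableEq k] {M : Matrix m m ℤ} {N : Matrix n n ℤ} {K : Matrix k k ℤ}
    (h : SameDetCoker M N) (h' : SameDetCoker N K) : SameDetCoker M K :=
  ⟨h.1.trans h'.1, h.2.elim fun e => h'.2.map fun e' => e.trans e'⟩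

section
variable {m n : Type*} [Fintype m] [DecidableEq m] [Fintype n] [DecidableEq n]

open Polynomial in
theorem aeval_intertwine {A : Matrix m m ℂ} {B : Matrix n n ℂ} {R : Matrix m n ℂ}
    (h : A * R = R * B) (f : ℂ[X]) : aeval A f * R = R * aeval B f := by
  induction f using Polynomial.induction_on' with
  | add p q hp hq => simp [Matrix.add_mul, Matrix.mul_add, hp, hq]
  | monomial k a =>
    have : ∀ k, A ^ k * R = R * B ^ k := by
      intro k
      induction k with
      | zero => simp
      | succ k ih => rw [pow_succ, pow_succ, Matrix.mul_assoc, h, ← Matrix.mul_assoc, ih,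
          Matrix.mul_assoc]
    rw [aeval_monomial, aeval_monomial, Algebra.algebraMap_eq_smul_one,
      Algebra.algebraMap_eq_smul_one]
    simp [this]

open Polynomial in
/-- There is a polynomial divisible by `X ^ l` that is the identity on a given finite set. -/
theorem exists_poly_dvd_eval_eq (l : ℕ) (s : Finset ℂ) :
    ∃ f : ℂ[X], ∀ x ∈ s, (X ^ (l + 1) * f).eval x = x := by
  classical
  refine ⟨Lagrange.interpolate s id fun x => (x ^ l)⁻¹, fun x hx => ?_⟩
  have h := Lagrange.eval_interpolate_at_node (s := s) (v := id) (fun x : ℂ => (x ^ l)⁻¹)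
    (Set.injOn_id _) hx
  simp only [id] at h
  rw [eval_mul, h, eval_pow, eval_X]
  by_cases hx0 : x = 0
  · simp [hx0]
  · rw [pow_succ]
    field_simp

open Polynomial in
/-- The determinant of `1 - A` depends on the eigenvalues of `A` only. -/
theorem det_one_sub_eq_of_eval_eq (A : Matrix m m ℂ) (q : ℂ[X])
    (hq : ∀ x ∈ A.charpoly.roots, q.eval x = x) : (1 - A).det = (1 - aeval A q).det := by
  have q1 : 1 - A = aeval A (1 - X : ℂ[X]) := by simp
  have q2 : 1 - aeval A q = aeval A (1 - q) := by simp
  rw [q1, q2, det_aeval_eq_prod_roots, det_aeval_eq_prod_roots]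
  congr 1
  refine Multiset.map_congr rfl fun x hx => ?_
  rw [eval_sub, eval_sub, hq x hx, eval_X]

open Polynomial in
/-- Shift equivalent matrices have the same determinant `det (Id - A)`.  With a polynomial
`X ^ l g` that fixes all eigenvalues of `A` and `B` one has
`det (1 - A) = det (1 - A ^ l g(A)) = det (1 - R S g(A)) = det (1 - S R g(B)) = det (1 - B)`. -/
theorem ShiftEquiv.det_eq {A : Matrix m m ℤ} {B : Matrix n n ℤ} (h : ShiftEquiv A B) :
    (1 - A).det = (1 - B).det := by
  classical
  let φ : ℤ →+* ℂ := Int.castRingHom ℂ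
  have hinj : Function.Injective φ := Int.cast_injective
  have e1 : A.map φ * h.R.map φ = h.R.map φ * B.map φ := by
    simp only [← Matrix.map_mul, h.intertwine_R]
  have e3 : h.R.map φ * h.S.map φ = A.map φ ^ h.lag := by
    have := map_pow φ.mapMatrix A h.lag
    rw [RingHom.mapMatrix_apply, RingHom.mapMatrix_apply] at this
    rw [← this, ← h.mul_RS, Matrix.map_mul]
  have e4 : h.S.map φ * h.R.map φ = B.map φ ^ h.lag := by
    have := map_pow φ.mapMatrix B h.lag
    rw [RingHom.mapMatrix_apply, RingHom.mapMatrix_apply] at this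
    rw [← this, ← h.mul_SR, Matrix.map_mul]
  obtain ⟨f, hf⟩ := exists_poly_dvd_eval_eq h.lag
    ((A.map φ).charpoly.roots.toFinset ∪ (B.map φ).charpoly.roots.toFinset)
  have key : (1 - A.map φ).det = (1 - B.map φ).det := by
    have hg : ∀ x ∈ (A.map φ).charpoly.roots + (B.map φ).charpoly.roots,
        (X ^ h.lag * (X * f)).eval x = x := fun x hx => by
      rw [← mul_assoc, ← pow_succ]
      exact hf x (by simpa only [Finset.mem_union, Multiset.mem_toFinset, Multiset.mem_add] using hx)
    generalize X * f = g at hg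
    rw [det_one_sub_eq_of_eval_eq (A.map φ) _ fun x hx => hg x (Multiset.mem_add.2 (.inl hx)),
      det_one_sub_eq_of_eval_eq (B.map φ) _ fun x hx => hg x (Multiset.mem_add.2 (.inr hx))]
    simp only [map_mul, map_pow, aeval_X]
    rw [← e3, ← e4, Matrix.mul_assoc, Matrix.det_one_sub_mul_comm, Matrix.mul_assoc,
      aeval_intertwine e1, Matrix.mul_assoc]
  apply hinj
  have c1 : φ (1 - A).det = (1 - A.map φ).det := by
    rw [RingHom.map_det, map_sub, map_one, RingHom.mapMatrix_apply]
  have c2 : φ (1 - B).det = (1 - B.map φ).det := by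
    rw [RingHom.map_det, map_sub, map_one, RingHom.mapMatrix_apply]
  rw [c1, c2, key]

/-- `A` acts as the identity on the cokernel of `1 - A`. -/
theorem pow_vecMul_sub_mem (A : Matrix m m ℤ) (l : ℕ) (x : m → ℤ) :
    x - Matrix.vecMul x (A ^ l) ∈ LinearMap.range (1 - A).vecMulLinear := by
  induction l with
  | zero => simp
  | succ l ih =>
    have : x - Matrix.vecMul x (A ^ (l + 1)) = (x - Matrix.vecMul x (A ^ l))
        + (1 - A).vecMulLinear (Matrix.vecMul x (A ^ l)) := by
      rw [Matrix.vecMulLinear_apply, Matrix.vecMul_sub, Matrix.vecMul_one, Matrix.vecMul_vecMul,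
        ← pow_succ]
      abel
    rw [this]
    exact add_mem ih ⟨_, rfl⟩

theorem range_le_comap_of_intertwine {A : Matrix m m ℤ} {B : Matrix n n ℤ} {R : Matrix m n ℤ}
    (h : A * R = R * B) : LinearMap.range (1 - A).vecMulLinear ≤
      (LinearMap.range (1 - B).vecMulLinear).comap R.vecMulLinear := by
  rintro _ ⟨x, rfl⟩
  refine ⟨Matrix.vecMul x R, ?_⟩
  simp only [Matrix.vecMulLinear_apply, Matrix.vecMul_vecMul]
  rw [Matrix.mul_sub, Matrix.sub_mul, h, Matrix.one_mul, Matrix.mul_one]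

/-- Shift equivalent matrices have isomorphic Bowen–Franks groups: `R` and `S` induce maps whose
composites are given by powers of `A` and `B`, which act as the identity. -/
theorem ShiftEquiv.nonempty_addEquiv {A : Matrix m m ℤ} {B : Matrix n n ℤ} (h : ShiftEquiv A B) :
    Nonempty (RowCoker (1 - A) ≃+ RowCoker (1 - B)) := by
  let f : RowCoker (1 - A) →ₗ[ℤ] RowCoker (1 - B) :=
    Submodule.mapQ _ _ h.R.vecMulLinear (range_le_comap_of_intertwine h.intertwine_R)
  let g : RowCoker (1 - B) →ₗ[ℤ] RowCoker (1 - A) :=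
    Submodule.mapQ _ _ h.S.vecMulLinear (range_le_comap_of_intertwine h.intertwine_S.symm)
  refine ⟨(LinearEquiv.ofLinearMap f g ?_ ?_).toAddEquiv⟩
  · refine Submodule.linearMap_qext _ (LinearMap.ext fun x => ?_)
    simp only [f, g, LinearMap.comp_apply, Submodule.mkQ_apply, Submodule.mapQ_apply,
      Matrix.vecMulLinear_apply, Matrix.vecMul_vecMul, h.mul_SR, LinearMap.id_apply]
    exact ((Submodule.Quotient.eq _).2 (pow_vecMul_sub_mem B _ x)).symm
  · refine Submodule.linearMap_qext _ (LinearMap.ext fun x => ?_)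
    simp only [f, g, LinearMap.comp_apply, Submodule.mkQ_apply, Submodule.mapQ_apply,
      Matrix.vecMulLinear_apply, Matrix.vecMul_vecMul, h.mul_RS, LinearMap.id_apply]
    exact ((Submodule.Quotient.eq _).2 (pow_vecMul_sub_mem A _ x)).symm

theorem ShiftEquiv.sameDetCoker {A : Matrix m m ℤ} {B : Matrix n n ℤ} (h : ShiftEquiv A B) :
    SameDetCoker (1 - A) (1 - B) :=
  ⟨h.det_eq, h.nonempty_addEquiv⟩

/-! ### Elimination of vertices and row operations -/

theorem sameDetCoker_mul_left (U M : Matrix m m ℤ) (hU : U.det = 1) :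
    SameDetCoker (U * M) M := by
  have hr : LinearMap.range (U * M).vecMulLinear = LinearMap.range M.vecMulLinear := by
    apply le_antisymm
    · rintro _ ⟨x, rfl⟩
      exact ⟨Matrix.vecMul x U, by simp [Matrix.vecMul_vecMul]⟩
    · rintro _ ⟨x, rfl⟩
      refine ⟨Matrix.vecMul x U⁻¹, ?_⟩
      have : U⁻¹ * U = 1 := Matrix.nonsing_inv_mul _ (by rw [hU]; exact isUnit_one)
      simp only [Matrix.vecMulLinear_apply, Matrix.vecMul_vecMul, ← Matrix.mul_assoc, this,
        Matrix.one_mul]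
  refine ⟨by rw [Matrix.det_mul, hU, one_mul], ⟨?_⟩⟩
  exact (Submodule.quotEquivOfEq _ _ hr).toAddEquiv

/-- Renaming the indices. -/
theorem sameDetCoker_reindex (M : Matrix m m ℤ) (e : m ≃ n) :
    SameDetCoker M (M.submatrix e.symm e.symm) := by
  refine ⟨(Matrix.det_submatrix_equiv_self e.symm M).symm, ⟨?_⟩⟩
  refine (Submodule.Quotient.equiv _ _ (LinearEquiv.funCongrLeft ℤ ℤ e.symm) ?_).toAddEquiv
  ext y
  simp only [Submodule.mem_map, LinearMap.mem_range, Matrix.vecMulLinear_apply]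
  constructor
  · rintro ⟨_, ⟨x, rfl⟩, rfl⟩
    refine ⟨x ∘ e.symm, ?_⟩
    rw [Matrix.submatrix_vecMul_equiv]
    simp [Function.comp_assoc]
    rfl
  · rintro ⟨x, rfl⟩
    refine ⟨_, ⟨x ∘ e, rfl⟩, ?_⟩
    rw [Matrix.submatrix_vecMul_equiv]
    rfl

/-- Elimination of the indices in `n`: if `M` maps the columns `(1, H)` to `(N, 0)` and its block
on `n` has determinant `1`, then `N` is the Schur complement of that block, and it has the
same determinant and cokernel as `M`. -/
theorem sameDetCoker_of_mulVec (M : Matrix (m ⊕ n) (m ⊕ n) ℤ) (H : Matrix n m ℤ)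
    (N : Matrix m m ℤ)
    (h : ∀ j, M.mulVec (Sum.elim (Pi.single j 1) fun i => H i j) = Sum.elim (fun i => N i j) 0)
    (hdet : M.toBlocks₂₂.det = 1) : SameDetCoker M N := by
  obtain ⟨M₁, M₂, M₃, M₄, rfl⟩ : ∃ M₁ M₂ M₃ M₄, M = Matrix.fromBlocks M₁ M₂ M₃ M₄ :=
    ⟨_, _, _, _, (Matrix.fromBlocks_toBlocks M).symm⟩
  rw [Matrix.toBlocks_fromBlocks₂₂] at hdet
  have h1 : M₁ + M₂ * H = N := by
    ext i j
    have := congrFun (h j) (Sum.inl i)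
    rw [Matrix.fromBlocks_mulVec] at this
    simpa [Matrix.mul_apply, Matrix.mulVec, dotProduct, Pi.single_apply] using this
  have h2 : M₃ + M₄ * H = 0 := by
    ext i j
    have := congrFun (h j) (Sum.inr i)
    rw [Matrix.fromBlocks_mulVec] at this
    simpa [Matrix.mul_apply, Matrix.mulVec, dotProduct, Pi.single_apply] using this
  have hinv : M₄⁻¹ * M₄ = 1 := Matrix.nonsing_inv_mul _ (by rw [hdet]; exact isUnit_one)
  have h3 : M₃ = -(M₄ * H) := eq_neg_of_add_eq_zero_left h2
  have hM : ∀ (x : m → ℤ) (z : n → ℤ),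
      Matrix.vecMul (Sum.elim x z) (Matrix.fromBlocks M₁ M₂ M₃ M₄)
        = Sum.elim (Matrix.vecMul x M₁ + Matrix.vecMul z M₃)
          (Matrix.vecMul x M₂ + Matrix.vecMul z M₄) := fun x z => by
    rw [Matrix.vecMul_fromBlocks]; simp
  refine ⟨?_, ?_⟩
  · have : Matrix.fromBlocks M₁ M₂ M₃ M₄ * Matrix.fromBlocks 1 0 H 1
        = Matrix.fromBlocks N M₂ 0 M₄ := by
      rw [Matrix.fromBlocks_multiply]; simp [h1, h2]
    have h4 := congrArg Matrix.det this
    rwa [Matrix.det_mul, Matrix.det_fromBlocks_zero₁₂, Matrix.det_fromBlocks_zero₂₁, hdet,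
      Matrix.det_one, Matrix.det_one, mul_one, mul_one, mul_one] at h4
  · obtain ⟨f, hf⟩ : ∃ f : (m ⊕ n → ℤ) →ₗ[ℤ] (m → ℤ),
        ∀ x z, f (Sum.elim x z) = x + Matrix.vecMul z H :=
      ⟨(Matrix.fromRows 1 H).vecMulLinear, fun x z => by
        rw [Matrix.vecMulLinear_apply, Matrix.vecMul_fromRows]; simp⟩
    obtain ⟨g, hg⟩ : ∃ g : (m → ℤ) →ₗ[ℤ] (m ⊕ n → ℤ), ∀ x, g x = Sum.elim x 0 :=
      ⟨(Matrix.fromCols 1 0).vecMulLinear, fun x => by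
        rw [Matrix.vecMulLinear_apply, Matrix.vecMul_fromCols]; simp⟩
    -- `(x, z) ↦ x + z H` and `x ↦ (x, 0)` induce mutually inverse maps of the cokernels
    have hsplit : ∀ x : m ⊕ n → ℤ, ∃ u z, x = Sum.elim u z := fun x =>
      ⟨x ∘ Sum.inl, x ∘ Sum.inr, (Sum.elim_comp_inl_inr x).symm⟩
    have kf : LinearMap.range (Matrix.fromBlocks M₁ M₂ M₃ M₄).vecMulLinear
        ≤ (LinearMap.range N.vecMulLinear).comap f := by
      rintro _ ⟨x, rfl⟩
      obtain ⟨u, z, rfl⟩ := hsplit x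
      refine ⟨u, ?_⟩
      rw [Matrix.vecMulLinear_apply, Matrix.vecMulLinear_apply, hM, hf, ← h1, h3]
      simp [Matrix.add_vecMul, Matrix.vecMul_add, Matrix.vecMul_neg, Matrix.vecMul_vecMul]
      abel
    have kg : LinearMap.range N.vecMulLinear
        ≤ (LinearMap.range (Matrix.fromBlocks M₁ M₂ M₃ M₄).vecMulLinear).comap g := by
      rintro _ ⟨x, rfl⟩
      refine ⟨Sum.elim x (-(Matrix.vecMul x (M₂ * M₄⁻¹))), ?_⟩
      rw [Matrix.vecMulLinear_apply, Matrix.vecMulLinear_apply, hM, hg, ← h1, h3]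
      congr 1
      · rw [Matrix.neg_vecMul, Matrix.vecMul_neg, neg_neg, Matrix.vecMul_vecMul, Matrix.vecMul_add,
          Matrix.mul_assoc, ← Matrix.mul_assoc M₄⁻¹, hinv, Matrix.one_mul]
      · rw [Matrix.neg_vecMul, Matrix.vecMul_vecMul, Matrix.mul_assoc, hinv, Matrix.mul_one]
        simp
    refine ⟨(LinearEquiv.ofLinearMap (Submodule.mapQ _ _ f kf) (Submodule.mapQ _ _ g kg)
      ?_ ?_).toAddEquiv⟩
    · refine Submodule.linearMap_qext _ (LinearMap.ext fun x => ?_)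
      simp [hf, hg]
    · refine Submodule.linearMap_qext _ (LinearMap.ext fun x => ?_)
      obtain ⟨u, z, rfl⟩ := hsplit x
      simp only [LinearMap.comp_apply, Submodule.mkQ_apply, Submodule.mapQ_apply,
        LinearMap.id_apply, hf, hg]
      refine (Submodule.Quotient.eq _).2 ⟨Sum.elim 0 (-(Matrix.vecMul z M₄⁻¹)), ?_⟩
      rw [Matrix.vecMulLinear_apply, hM, h3]
      ext (i | i)
      · simp [Matrix.neg_vecMul, Matrix.vecMul_neg, Matrix.vecMul_vecMul, ← Matrix.mul_assoc, hinv]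
      · simp [Matrix.neg_vecMul, Matrix.vecMul_vecMul, hinv]

/-- A matrix `1 - T` with `T` strictly triangular with respect to a grading has determinant
`1`. -/
theorem det_eq_one_of_grading (M : Matrix n n ℤ) (b : n → ℕ)
    (hM : ∀ i j, b j ≤ b i → M i j = (1 : Matrix n n ℤ) i j) : M.det = 1 := by
  have hbt : M.BlockTriangular b := fun i j hij => by
    rw [hM i j hij.le, Matrix.one_apply_ne]
    rintro rfl
    exact lt_irrefl _ hij
  rw [hbt.det]
  refine Finset.prod_eq_one fun a _ => ?_
  convert Matrix.det_one (n := {i // b i = a}) (R := ℤ)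
  ext i j
  rw [Matrix.toSquareBlock_def, Matrix.of_apply, hM _ _ (by rw [i.2, j.2]), Matrix.one_apply,
    Matrix.one_apply]
  simp [Subtype.ext_iff]

end

/-! ### Counting spliced orbits: a conjugacy of edge shifts gives a shift equivalence -/

/-- The type of biinfinite paths of `E`. -/
structure BiPath (E : FiniteDigraph) where
  toFun : ℤ → E.Edge
  isPath : ∀ i, E.r (toFun i) = E.s (toFun (i + 1))

instance (E : FiniteDigraph) : CoeFun (BiPath E) fun _ => ℤ → E.Edge := ⟨BiPath.toFun⟩

namespace BiPath
variable {E F G : FiniteDigraph}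

theorem ext {x y : BiPath E} (h : ∀ i, x i = y i) : x = y := by
  cases x; cases y; congr; exact funext h

/-- The biinfinite path that follows `p` up to time `0` and `x` afterwards. -/
def splice (p x : BiPath E) (h : E.s (p 0) = E.s (x 0)) : BiPath E :=
  ⟨fun i => if i < 0 then p i else x i, fun i => by
    rcases lt_trichotomy (i + 1) 0 with hi | hi | hi
    · rw [if_pos (by omega), if_pos hi]; exact p.isPath i
    · rw [if_pos (by omega), if_neg (by omega), p.isPath i, hi, h]
    · rw [if_neg (by omega), if_neg (by omega)]; exact x.isPath i⟩

theorem splice_of_neg {p x : BiPath E} (h : E.s (p 0) = E.s (x 0)) {i : ℤ} (hi : i < 0) :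
    splice p x h i = p i := if_pos hi

theorem splice_of_nonneg {p x : BiPath E} (h : E.s (p 0) = E.s (x 0)) {i : ℤ} (hi : 0 ≤ i) :
    splice p x h i = x i := if_neg (by omega)

/-- The path shifted by `k` steps. -/
def shiftBy (k : ℤ) (x : BiPath E) : BiPath E :=
  ⟨fun i => x (i + k), fun i => by rw [x.isPath (i + k), show i + k + 1 = i + 1 + k by ring]⟩

theorem shiftBy_apply (k : ℤ) (x : BiPath E) (i : ℤ) : shiftBy k x i = x (i + k) := rfl

theorem source_congr_of_neg {x y : BiPath E} (h : ∀ i < 0, x i = y i) :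
    E.s (x 0) = E.s (y 0) := by
  have h1 := x.isPath (-1)
  have h2 := y.isPath (-1)
  rw [h (-1) (by norm_num)] at h1
  exact h1.symm.trans h2

theorem source_congr_of_nonneg {x y : BiPath E} (h : ∀ i, 0 ≤ i → x i = y i) :
    E.s (x 0) = E.s (y 0) := by rw [h 0 le_rfl]

end BiPath

open BiPath

/-- A bijection of biinfinite paths such that the nonnegative part of the image depends only on the
nonnegative part of the argument, and likewise for the inverse and the negative parts; moreover, only
finitely many paths have a given past and an image with a given future. -/
structure CausalEquiv (E F : FiniteDigraph) where
  toEquiv : BiPath E ≃ BiPath F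
  nonneg_congr : ∀ x x' : BiPath E, (∀ i, 0 ≤ i → x i = x' i) →
    ∀ i, 0 ≤ i → toEquiv x i = toEquiv x' i
  neg_congr : ∀ y y' : BiPath F, (∀ i < 0, y i = y' i) →
    ∀ i < 0, toEquiv.symm y i = toEquiv.symm y' i
  finite' : ∀ (p : BiPath E) (q : BiPath F),
    {x : BiPath E | (∀ i < 0, x i = p i) ∧ ∀ i, 0 ≤ i → toEquiv x i = q i}.Finite

namespace CausalEquiv
variable {E F G : FiniteDigraph}

/-- The paths with the same past as `p` whose image has the same future as `q`. -/
def spliceSet (φ : CausalEquiv E F) (p : BiPath E) (q : BiPath F) : Set (BiPath E) :=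
  {x | (∀ i < 0, x i = p i) ∧ ∀ i, 0 ≤ i → φ.toEquiv x i = q i}

/-- The number of paths in `spliceSet p q` depends on `p` only through the vertex that `p` visits at
time `0`: one past can be exchanged for another. -/
theorem card_congr_left (φ : CausalEquiv E F) {p p' : BiPath E} (q : BiPath F)
    (h : E.s (p 0) = E.s (p' 0)) :
    Nat.card (φ.spliceSet p q) = Nat.card (φ.spliceSet p' q) := by
  have key : ∀ {p p' : BiPath E}, E.s (p 0) = E.s (p' 0) → ∀ x ∈ φ.spliceSet p q,
      E.s (p' 0) = E.s (x 0) := fun h x hx => by rw [← h, source_congr_of_neg hx.1]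
  have mem : ∀ {p p' : BiPath E} (h : E.s (p 0) = E.s (p' 0)) (x) (hx : x ∈ φ.spliceSet p q),
      splice p' x (key h x hx) ∈ φ.spliceSet p' q := fun h x hx =>
    ⟨fun i hi => splice_of_neg _ hi, fun i hi => by
      rw [← hx.2 i hi]
      exact φ.nonneg_congr _ _ (fun j hj => splice_of_nonneg _ hj) i hi⟩
  refine Nat.card_congr ⟨fun x => ⟨_, mem h x.1 x.2⟩, fun x => ⟨_, mem h.symm x.1 x.2⟩, ?_, ?_⟩
  all_goals
    rintro ⟨x, hx⟩
    refine Subtype.ext (BiPath.ext fun i => ?_)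
    rcases lt_or_ge i 0 with hi | hi
    · simp only [splice_of_neg _ hi]; exact (hx.1 i hi).symm
    · simp only [splice_of_nonneg _ hi]

/-- The number of paths in `spliceSet p q` depends on `q` only through the vertex that `q` visits at
time `0`. -/
theorem card_congr_right (φ : CausalEquiv E F) (p : BiPath E) {q q' : BiPath F}
    (h : F.s (q 0) = F.s (q' 0)) :
    Nat.card (φ.spliceSet p q) = Nat.card (φ.spliceSet p q') := by
  have key : ∀ {q q' : BiPath F}, F.s (q 0) = F.s (q' 0) → ∀ x ∈ φ.spliceSet p q,
      F.s (φ.toEquiv x 0) = F.s (q' 0) := fun h x hx => by rw [← h, source_congr_of_nonneg hx.2]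
  have mem : ∀ {q q' : BiPath F} (h : F.s (q 0) = F.s (q' 0)) (x) (hx : x ∈ φ.spliceSet p q),
      φ.toEquiv.symm (splice (φ.toEquiv x) q' (key h x hx)) ∈ φ.spliceSet p q' := fun h x hx =>
    ⟨fun i hi => by
      rw [φ.neg_congr _ (φ.toEquiv x) (fun j hj => splice_of_neg _ hj) i hi,
        Equiv.symm_apply_apply, hx.1 i hi],
    fun i hi => by rw [Equiv.apply_symm_apply, splice_of_nonneg _ hi]⟩
  refine Nat.card_congr ⟨fun x => ⟨_, mem h x.1 x.2⟩, fun x => ⟨_, mem h.symm x.1 x.2⟩, ?_, ?_⟩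
  all_goals
    rintro ⟨x, hx⟩
    refine Subtype.ext ?_
    simp only
    rw [Equiv.symm_apply_eq]
    refine BiPath.ext fun i => ?_
    rcases lt_or_ge i 0 with hi | hi
    · simp only [splice_of_neg _ hi, Equiv.apply_symm_apply]
    · simp only [splice_of_nonneg _ hi]; exact (hx.2 i hi).symm

/-- The paths counted for a composite `ψ ∘ φ` are classified by the vertex `v` of the
intermediate graph at time `0`; for each `v` the past and the future can be chosen independently. -/
noncomputable def spliceSetTransEquiv (φ : CausalEquiv E F) (ψ : CausalEquiv F G)
    (p : BiPath E) (q : BiPath G) (rep : F.Vertex → BiPath F) (hrep : ∀ v, F.s (rep v 0) = v) :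
    {x : BiPath E | (∀ i < 0, x i = p i) ∧ ∀ i, 0 ≤ i → ψ.toEquiv (φ.toEquiv x) i = q i} ≃
      Σ v : F.Vertex, φ.spliceSet p (rep v) × ψ.spliceSet (rep v) q where
  toFun x := ⟨F.s (φ.toEquiv x.1 0),
    ⟨φ.toEquiv.symm (splice (φ.toEquiv x.1) (rep _) (hrep _).symm),
      fun i hi => by
        rw [φ.neg_congr _ (φ.toEquiv x.1) (fun j hj => splice_of_neg _ hj) i hi,
          Equiv.symm_apply_apply, x.2.1 i hi],
      fun i hi => by rw [Equiv.apply_symm_apply, splice_of_nonneg _ hi]⟩,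
    ⟨splice (rep _) (φ.toEquiv x.1) (hrep _),
      fun i hi => splice_of_neg _ hi,
      fun i hi => by
        rw [← x.2.2 i hi]
        exact ψ.nonneg_congr _ _ (fun j hj => splice_of_nonneg _ hj) i hi⟩⟩
  invFun z := ⟨φ.toEquiv.symm (splice (φ.toEquiv z.2.1.1) z.2.2.1 (by
      rw [source_congr_of_nonneg z.2.1.2.2, source_congr_of_neg z.2.2.2.1])),
    fun i hi => by
      rw [φ.neg_congr _ (φ.toEquiv z.2.1.1) (fun j hj => splice_of_neg _ hj) i hi,
        Equiv.symm_apply_apply, z.2.1.2.1 i hi],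
    fun i hi => by
      rw [Equiv.apply_symm_apply, ← z.2.2.2.2 i hi]
      exact ψ.nonneg_congr _ _ (fun j hj => splice_of_nonneg _ hj) i hi⟩
  left_inv x := by
    refine Subtype.ext ?_
    simp only
    rw [Equiv.symm_apply_eq]
    refine BiPath.ext fun i => ?_
    rcases lt_or_ge i 0 with hi | hi
    · simp only [splice_of_neg _ hi, Equiv.apply_symm_apply]
    · simp only [splice_of_nonneg _ hi]
  right_inv z := by
    obtain ⟨v, ⟨x, hx⟩, ⟨y, hy⟩⟩ := z
    have hv : F.s (φ.toEquiv (φ.toEquiv.symm (splice (φ.toEquiv x) y (by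
      rw [source_congr_of_nonneg hx.2, source_congr_of_neg hy.1]))) 0) = v := by
      rw [Equiv.apply_symm_apply, splice_of_nonneg _ le_rfl, source_congr_of_neg hy.1, hrep]
    refine Sigma.ext hv ?_
    have hcongr : ∀ (w : F.Vertex) (hw : w = v) (a : φ.spliceSet p (rep w) × ψ.spliceSet (rep w) q)
        (b : φ.spliceSet p (rep v) × ψ.spliceSet (rep v) q), a.1.1 = b.1.1 → a.2.1 = b.2.1 →
        HEq a b := by
      rintro w rfl a b h1 h2
      exact heq_of_eq (Prod.ext (Subtype.ext h1) (Subtype.ext h2))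
    refine hcongr _ hv _ _ ?_ ?_
    · simp only
      rw [Equiv.symm_apply_eq]
      refine BiPath.ext fun i => ?_
      rcases lt_or_ge i 0 with hi | hi
      · simp only [splice_of_neg _ hi, Equiv.apply_symm_apply]
      · simp only [splice_of_nonneg _ hi]
        rw [hx.2 i hi]
        simp only [hv]
    · refine BiPath.ext fun i => ?_
      rcases lt_or_ge i 0 with hi | hi
      · simp only [splice_of_neg _ hi]
        rw [hy.1 i hi]
        simp only [hv]
      · simp only [splice_of_nonneg _ hi, Equiv.apply_symm_apply]

/-- The composite of two causal bijections. -/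
noncomputable def trans (φ : CausalEquiv E F) (ψ : CausalEquiv F G)
    (hF : ∀ v, ∃ y : BiPath F, F.s (y 0) = v) : CausalEquiv E G where
  toEquiv := φ.toEquiv.trans ψ.toEquiv
  nonneg_congr x x' h := ψ.nonneg_congr _ _ (φ.nonneg_congr _ _ h)
  neg_congr y y' h := φ.neg_congr _ _ (ψ.neg_congr _ _ h)
  finite' p q := by
    choose rep hrep using hF
    have : ∀ v, Finite (φ.spliceSet p (rep v) × ψ.spliceSet (rep v) q) := fun v => by
      have h1 : Finite (φ.spliceSet p (rep v)) := φ.finite' _ _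
      have h2 : Finite (ψ.spliceSet (rep v) q) := ψ.finite' _ _
      infer_instance
    exact Finite.of_equiv _ (spliceSetTransEquiv φ ψ p q rep hrep).symm

/-- The matrix that counts, for vertices `u` of `E` and `v` of `F`, the paths with a given past
ending in `u` whose image has a given future starting in `v`; the counts do not depend on the
choice of past and future. -/
noncomputable def matrix (φ : CausalEquiv E F) (hE : ∀ u, ∃ x : BiPath E, E.s (x 0) = u)
    (hF : ∀ v, ∃ y : BiPath F, F.s (y 0) = v) : Matrix E.Vertex F.Vertex ℤ :=
  Matrix.of fun u v => (Nat.card (φ.spliceSet (hE u).choose (hF v).choose) : ℤ)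

theorem matrix_apply (φ : CausalEquiv E F) (hE : ∀ u, ∃ x : BiPath E, E.s (x 0) = u)
    (hF : ∀ v, ∃ y : BiPath F, F.s (y 0) = v) (p : BiPath E) (q : BiPath F) :
    φ.matrix hE hF (E.s (p 0)) (F.s (q 0)) = Nat.card (φ.spliceSet p q) := by
  rw [matrix, Matrix.of_apply, φ.card_congr_left _ (hE (E.s (p 0))).choose_spec,
    φ.card_congr_right p (hF (F.s (q 0))).choose_spec]

theorem matrix_trans (φ : CausalEquiv E F) (ψ : CausalEquiv F G)
    (hE : ∀ u, ∃ x : BiPath E, E.s (x 0) = u) (hF : ∀ v, ∃ y : BiPath F, F.s (y 0) = v)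
    (hG : ∀ v, ∃ y : BiPath G, G.s (y 0) = v) :
    (φ.trans ψ hF).matrix hE hG = φ.matrix hE hF * ψ.matrix hF hG := by
  ext u v
  obtain ⟨p, rfl⟩ := hE u
  obtain ⟨q, rfl⟩ := hG v
  have h := fun v => hF v
  choose rep hrep using h
  have hc : Nat.card ((φ.trans ψ hF).spliceSet p q)
      = Nat.card (Σ v : F.Vertex, φ.spliceSet p (rep v) × ψ.spliceSet (rep v) q) :=
    Nat.card_congr (spliceSetTransEquiv φ ψ p q rep hrep)
  rw [matrix_apply, Matrix.mul_apply, hc]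
  have h1 : ∀ v, Finite (φ.spliceSet p (rep v)) := fun v => φ.finite' _ _
  have h2 : ∀ v, Finite (ψ.spliceSet (rep v) q) := fun v => ψ.finite' _ _
  rw [Nat.card_sigma, Nat.cast_sum]
  refine Finset.sum_congr rfl fun v _ => ?_
  rw [Nat.card_prod, Nat.cast_mul, ← matrix_apply φ hE hF p (rep v),
    ← matrix_apply ψ hF hG (rep v) q, hrep]

theorem matrix_congr {φ ψ : CausalEquiv E F} (h : φ.toEquiv = ψ.toEquiv)
    (hE : ∀ u, ∃ x : BiPath E, E.s (x 0) = u) (hF : ∀ v, ∃ y : BiPath F, F.s (y 0) = v) :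
    φ.matrix hE hF = ψ.matrix hE hF := by
  cases φ; cases ψ; cases h; rfl

end CausalEquiv

namespace BiPath
variable {E F : FiniteDigraph}

/-- The shift by `k` steps as a bijection of the biinfinite paths. -/
def shiftEquiv (E : FiniteDigraph) (k : ℤ) : BiPath E ≃ BiPath E where
  toFun := shiftBy k
  invFun := shiftBy (-k)
  left_inv x := BiPath.ext fun i => by simp [shiftBy_apply]
  right_inv x := BiPath.ext fun i => by simp [shiftBy_apply]

theorem shiftEquiv_apply (k : ℤ) (x : BiPath E) (i : ℤ) : shiftEquiv E k x i = x (i + k) := rfl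

theorem shiftEquiv_symm_apply (k : ℤ) (x : BiPath E) (i : ℤ) :
    (shiftEquiv E k).symm x i = x (i + -k) := rfl

/-- The value of `f x` at `i` depends only on `x` at the positions `i - k, …, i + k`. -/
def HasWindow (k : ℕ) (f : BiPath E → BiPath F) : Prop :=
  ∀ (x x' : BiPath E) (i : ℤ), (∀ j, i - k ≤ j → j ≤ i + k → x j = x' j) → f x i = f x' i

end BiPath

namespace CausalEquiv
variable {E F : FiniteDigraph}

/-- A bijection given by a sliding block code with window `k`, whose inverse also has window `k`,
becomes causal after composition with the `k`-th power of the shift. -/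
def ofWindow (e : BiPath E ≃ BiPath F) (k : ℕ) (he : HasWindow k e) (he' : HasWindow k e.symm) :
    CausalEquiv E F where
  toEquiv := e.trans (shiftEquiv F k)
  nonneg_congr x x' h i hi := by
    simp only [Equiv.trans_apply, shiftEquiv_apply]
    exact he _ _ _ fun j h1 h2 => h j (by omega)
  neg_congr y y' h i hi := by
    simp only [Equiv.symm_trans_apply]
    refine he' _ _ _ fun j h1 h2 => ?_
    simp only [shiftEquiv_symm_apply]
    exact h _ (by omega)
  finite' p q := by
    let f : {x : BiPath E | (∀ i < 0, x i = p i) ∧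
        ∀ i, 0 ≤ i → e.trans (shiftEquiv F k) x i = q i} → (Fin (2 * k) → E.Edge) :=
      fun x i => x.1 i
    -- past and future of `x` are determined up to the `2 k` letters at which they overlap
    refine Finite.of_injective f ?_
    rintro ⟨x, hx⟩ ⟨y, hy⟩ hxy
    refine Subtype.ext (BiPath.ext fun i => ?_)
    rcases lt_or_ge i 0 with hi | hi
    · rw [hx.1 i hi, hy.1 i hi]
    rcases lt_or_ge i (2 * k) with hi' | hi'
    · obtain ⟨n, rfl⟩ := Int.eq_ofNat_of_zero_le hi
      exact congrFun hxy ⟨n, by omega⟩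
    · have := he' (e x) (e y) i fun j h1 h2 => by
        have hx2 := hx.2 (j - k) (by omega)
        have hy2 := hy.2 (j - k) (by omega)
        simp only [Equiv.trans_apply, shiftEquiv_apply, sub_add_cancel] at hx2 hy2
        rw [hx2, hy2]
      simpa using this

/-- The shift by `k ≥ 0` steps as a causal bijection. -/
def shift (E : FiniteDigraph) (k : ℕ) : CausalEquiv E E :=
  ofWindow (Equiv.refl _) k (fun _ _ i h => h i (by omega) (by omega))
    fun _ _ i h => h i (by omega) (by omega)

theorem shift_toEquiv_apply (k : ℕ) (x : BiPath E) (i : ℤ) :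
    (shift E k).toEquiv x i = x (i + k) := rfl

/-- A path that is shifted by one step consists of a past, a future, and one edge in between. -/
theorem matrix_shift_one (hE : ∀ u, ∃ x : BiPath E, E.s (x 0) = u) :
    (shift E 1).matrix hE hE = E.adjacency := by
  ext u v
  obtain ⟨p, rfl⟩ := hE u
  obtain ⟨q, rfl⟩ := hE v
  rw [matrix_apply, FiniteDigraph.adjacency, Matrix.of_apply]
  congr 1
  have hpath : ∀ e : {e : E.Edge // E.s e = E.s (p 0) ∧ E.r e = E.s (q 0)}, ∀ i : ℤ,
      E.r (if i < 0 then p i else if i = 0 then e.1 else q (i - 1))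
        = E.s (if i + 1 < 0 then p (i + 1) else if i + 1 = 0 then e.1 else q (i + 1 - 1)) := by
    rintro ⟨e, h1, h2⟩ i
    rcases lt_trichotomy i (-1) with hi | rfl | hi
    · rw [if_pos (by omega), if_pos (by omega), p.isPath]
    · simp [h1, p.isPath]
    · rcases lt_trichotomy i 0 with hi | rfl | hi
      · omega
      · simp [h2]
      · rw [if_neg (by omega), if_neg (by omega), if_neg (by omega), if_neg (by omega), q.isPath]
        congr 2; ring
  refine Nat.card_congr
    { toFun := fun x => ⟨x.1 0, source_congr_of_neg x.2.1, ?_⟩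
      invFun := fun e => ⟨⟨fun i => if i < 0 then p i else if i = 0 then e.1 else q (i - 1),
        hpath e⟩, fun i hi => if_pos hi, fun i hi => ?_⟩
      left_inv := ?_
      right_inv := ?_ }
  · rw [x.1.isPath, ← x.2.2 0 le_rfl]; rfl
  · rw [shift_toEquiv_apply]
    simp only
    rw [if_neg (by omega), if_neg (by omega)]
    simp
  · rintro ⟨x, hx⟩
    refine Subtype.ext (BiPath.ext fun i => ?_)
    rcases lt_trichotomy i 0 with hi | rfl | hi
    · simp only [if_pos hi]; exact (hx.1 i hi).symm
    · simp
    · simp only [if_neg (show ¬ i < 0 by omega), if_neg (show ¬ i = 0 by omega)]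
      rw [← hx.2 (i - 1) (by omega), shift_toEquiv_apply]
      simp
  · rintro ⟨e, he⟩
    simp

theorem matrix_shift (hE : ∀ u, ∃ x : BiPath E, E.s (x 0) = u) (k : ℕ) :
    (shift E k).matrix hE hE = E.adjacency ^ k := by
  have hadd : ∀ k l, (shift E (k + l)).matrix hE hE
      = (shift E k).matrix hE hE * (shift E l).matrix hE hE := fun k l => by
    rw [← matrix_trans]
    refine matrix_congr (Equiv.ext fun x => BiPath.ext fun i => ?_) _ _
    change x (i + (k + l : ℕ)) = x (i + l + k)
    congr 1; push_cast; ring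
  have hzero : ∀ u v, (shift E 0).matrix hE hE u v = (1 : Matrix E.Vertex E.Vertex ℤ) u v := by
    intro u v
    obtain ⟨p, rfl⟩ := hE u
    obtain ⟨q, rfl⟩ := hE v
    rw [matrix_apply, Matrix.one_apply]
    have huniq : ∀ x ∈ (shift E 0).spliceSet p q, ∀ i, x i = if i < 0 then p i else q i := by
      intro x hx i
      split_ifs with hi
      · exact hx.1 i hi
      · rw [← hx.2 i (by omega), shift_toEquiv_apply]; simp
    split_ifs with h
    · have : Unique ((shift E 0).spliceSet p q) :=
        { default := ⟨splice p q h, fun i hi => splice_of_neg _ hi, fun i hi => by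
            rw [shift_toEquiv_apply, ← splice_of_nonneg h hi]; simp⟩
          uniq := fun x => Subtype.ext (BiPath.ext fun i => by
            rw [huniq x.1 x.2]; rfl) }
      rw [Nat.card_unique]; rfl
    · have : IsEmpty ((shift E 0).spliceSet p q) := ⟨fun x => h (by
        rw [← source_congr_of_neg x.2.1, ← source_congr_of_nonneg x.2.2]
        rw [shift_toEquiv_apply]; simp)⟩
      rw [Nat.card_of_isEmpty]; rfl
  induction k with
  | zero => rw [pow_zero]; ext u v; exact hzero u v
  | succ k ih => rw [hadd, ih, matrix_shift_one, pow_succ]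

end CausalEquiv

open CausalEquiv in
/-- Conjugate edge shifts of essential graphs have shift equivalent adjacency matrices. -/
noncomputable def shiftEquivOfWindow {E F : FiniteDigraph}
    (hE : ∀ u, ∃ x : BiPath E, E.s (x 0) = u) (hF : ∀ v, ∃ y : BiPath F, F.s (y 0) = v)
    (e : BiPath E ≃ BiPath F) (k : ℕ) (he : HasWindow k e) (he' : HasWindow k e.symm)
    (hs : ∀ (k : ℤ) x, e (shiftEquiv E k x) = shiftEquiv F k (e x)) :
    ShiftEquiv E.adjacency F.adjacency :=
  have hs' : ∀ (k : ℤ) y, e.symm (shiftEquiv F k y) = shiftEquiv E k (e.symm y) := fun k y => by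
    rw [Equiv.symm_apply_eq, hs, Equiv.apply_symm_apply]
  { R := (ofWindow e k he he').matrix hE hF
    S := (ofWindow e.symm k he' he).matrix hF hE
    lag := 2 * k
    intertwine_R := by
      rw [← matrix_shift_one hE, ← matrix_shift_one hF, ← matrix_trans, ← matrix_trans]
      refine matrix_congr (Equiv.ext fun x => ?_) _ _
      change shiftEquiv F k (e (shiftEquiv E 1 x)) = shiftEquiv F 1 (shiftEquiv F k (e x))
      rw [hs]
      exact BiPath.ext fun i => by simp only [shiftEquiv_apply]; congr 1; ring
    intertwine_S := by
      rw [← matrix_shift_one hE, ← matrix_shift_one hF, ← matrix_trans, ← matrix_trans]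
      refine matrix_congr (Equiv.ext fun x => ?_) _ _
      change shiftEquiv E 1 (shiftEquiv E k (e.symm x))
        = shiftEquiv E k (e.symm (shiftEquiv F 1 x))
      rw [hs']
      exact BiPath.ext fun i => by simp only [shiftEquiv_apply]; congr 1; ring
    mul_RS := by
      rw [← matrix_shift hE, ← matrix_trans]
      refine matrix_congr (Equiv.ext fun x => ?_) _ _
      change shiftEquiv E k (e.symm (shiftEquiv F k (e x))) = shiftEquiv E (2 * k : ℕ) x
      rw [hs', Equiv.symm_apply_apply]
      exact BiPath.ext fun i => by simp only [shiftEquiv_apply]; congr 1; push_cast; ring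
    mul_SR := by
      rw [← matrix_shift hF, ← matrix_trans]
      refine matrix_congr (Equiv.ext fun x => ?_) _ _
      change shiftEquiv F k (e (shiftEquiv E k (e.symm x))) = shiftEquiv F (2 * k : ℕ) x
      rw [hs, Equiv.apply_symm_apply]
      exact BiPath.ext fun i => by simp only [shiftEquiv_apply]; congr 1; push_cast; ring }

/-! ### Conjugacies and sliding block codes -/

namespace ShiftSpace

instance compactSpace_points (X : ShiftSpace) : CompactSpace X.Points :=
  isCompact_iff_compactSpace.1 X.toSubshift.isClosed.isCompact

variable {X Y Z : ShiftSpace}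

theorem σ_apply (x : X.Points) (i : ℤ) : (X.σ x).1 i = x.1 (i + 1) := by
  change x.1 (1 + i) = _
  rw [add_comm]

theorem Conjugate.refl (X : ShiftSpace) : Conjugate X X :=
  ⟨id, continuous_id, Function.bijective_id, fun _ => rfl⟩

theorem Conjugate.trans (h : Conjugate X Y) (h' : Conjugate Y Z) : Conjugate X Z := by
  obtain ⟨φ, hc, hb, hs⟩ := h
  obtain ⟨ψ, hc', hb', hs'⟩ := h'
  exact ⟨ψ ∘ φ, hc'.comp hc, hb'.comp hb, fun x => by simp [hs, hs']⟩

/-- By compactness, the inverse of a conjugacy is continuous. -/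
theorem Conjugate.symm (h : Conjugate X Y) : Conjugate Y X := by
  obtain ⟨φ, hc, hb, hs⟩ := h
  let e := Equiv.ofBijective φ hb
  have he : Continuous e := hc
  refine ⟨e.symm, he.continuous_symm_of_equiv_compact_to_t2, e.symm.bijective, fun y => ?_⟩
  rw [Equiv.symm_apply_eq]
  change Y.σ y = φ (X.σ (e.symm y))
  rw [hs]
  congr 1
  exact (e.apply_symm_apply y).symm

/-- The point of `X` shifted by `k` steps. -/
def shiftPoint (X : ShiftSpace) (k : ℤ) (x : X.Points) : X.Points :=
  ⟨shift k x.1, X.toSubshift.mapsTo k x.2⟩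

theorem shiftPoint_apply (k : ℤ) (x : X.Points) (i : ℤ) : (X.shiftPoint k x).1 i = x.1 (i + k) := by
  change x.1 (k + i) = _
  rw [add_comm]

theorem map_shiftPoint {φ : X.Points → Y.Points} (hs : ∀ x, φ (X.σ x) = Y.σ (φ x)) (k : ℤ)
    (x : X.Points) : φ (X.shiftPoint k x) = Y.shiftPoint k (φ x) := by
  have hsucc : ∀ {W : ShiftSpace} (k : ℤ) (w : W.Points),
      W.shiftPoint (k + 1) w = W.σ (W.shiftPoint k w) := fun k w =>
    Subtype.ext (funext fun i => by
      rw [σ_apply, shiftPoint_apply, shiftPoint_apply]; exact congrArg w.1 (by ring))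
  have hinj : Function.Injective Y.σ := fun y y' h => Subtype.ext (funext fun i => by
    have := congrFun (congrArg Subtype.val h) (i - 1)
    rwa [σ_apply, σ_apply, sub_add_cancel] at this)
  induction k using Int.induction_on with
  | zero =>
    have h0 : ∀ {W : ShiftSpace} (w : W.Points), W.shiftPoint 0 w = w := fun w =>
      Subtype.ext (funext fun i => by rw [shiftPoint_apply, add_zero])
    rw [h0, h0]
  | succ k ih => rw [hsucc, hsucc, hs, ih]
  | pred k ih =>
    apply hinj
    rw [← hs, ← hsucc, ← hsucc, sub_add_cancel, ih]

theorem continuous_of_letterwise {f : X.Points → Y.Points} (g : X.Alphabet → Y.Alphabet)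
    (hg : ∀ x i, (f x).1 i = g (x.1 i)) : Continuous f := by
  refine continuous_induced_rng.2 (continuous_pi fun i => ?_)
  have h1 : Continuous fun x : X.Points => g (x.1 i) :=
    continuous_of_discreteTopology.comp ((continuous_apply i).comp continuous_subtype_val)
  exact h1.congr fun x => (hg x i).symm

/-- The value of `φ x` at `i` depends only on `x` at the positions `i - k, …, i + k`. -/
def IsBlockCode (k : ℕ) (φ : X.Points → Y.Points) : Prop :=
  ∀ (x x' : X.Points) (i : ℤ), (∀ j, i - k ≤ j → j ≤ i + k → x.1 j = x'.1 j) →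
    (φ x).1 i = (φ x').1 i

theorem IsBlockCode.mono {φ : X.Points → Y.Points} {k l : ℕ} (h : IsBlockCode k φ) (hkl : k ≤ l) :
    IsBlockCode l φ := fun x x' i hx => h x x' i fun j h1 h2 => hx j (by omega) (by omega)

/-- A continuous map that commutes with the shift is a sliding block code: otherwise, by
compactness, there would be two equal points with different images. -/
theorem exists_isBlockCode {φ : X.Points → Y.Points} (hc : Continuous φ)
    (hs : ∀ x, φ (X.σ x) = Y.σ (φ x)) : ∃ k, IsBlockCode k φ := by
  have hev : ∀ {W : ShiftSpace} (i : ℤ), Continuous fun w : W.Points => w.1 i := fun i =>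
    (continuous_apply i).comp continuous_subtype_val
  by_contra! hcon
  let K : ℕ → Set (X.Points × X.Points) := fun k =>
    (⋂ j : ℤ, {p | -k ≤ j → j ≤ k → p.1.1 j = p.2.1 j}) ∩ {p | (φ p.1).1 0 ≠ (φ p.2).1 0}
  have hclosed : ∀ k, IsClosed (K k) := by
    intro k
    refine IsClosed.inter (isClosed_iInter fun j => ?_) ?_
    · by_cases h : -(k : ℤ) ≤ j ∧ j ≤ k
      · simp only [h.1, h.2, forall_const]
        exact isClosed_eq ((hev j).comp continuous_fst) ((hev j).comp continuous_snd)
      · convert isClosed_univ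
        ext p
        simp only [Set.mem_ofPred_eq, Set.mem_univ, iff_true]
        exact fun h1 h2 => absurd ⟨h1, h2⟩ h
    · have : {p : X.Points × X.Points | (φ p.1).1 0 ≠ (φ p.2).1 0}
          = (fun p => ((φ p.1).1 0, (φ p.2).1 0)) ⁻¹' {q | q.1 ≠ q.2} := rfl
      rw [this]
      exact (isClosed_discrete _).preimage
        (((hev 0).comp (hc.comp continuous_fst)).prodMk ((hev 0).comp (hc.comp continuous_snd)))
  have hne : (⋂ k, K k).Nonempty := by
    refine IsCompact.nonempty_iInter_of_sequence_nonempty_isCompact_isClosed K (fun k => ?_)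
      (fun k => ?_) (hclosed 0).isCompact hclosed
    · rintro p ⟨h1, h2⟩
      refine ⟨Set.mem_iInter.2 fun j hj hj' => Set.mem_iInter.1 h1 j ?_ ?_, h2⟩ <;>
        (push_cast; omega)
    · have h := hcon k
      unfold IsBlockCode at h
      push Not at h
      obtain ⟨x, x', i, h1, h2⟩ := h
      refine ⟨(X.shiftPoint i x, X.shiftPoint i x'), Set.mem_iInter.2 fun j hj hj' => ?_, ?_⟩
      · simp only [shiftPoint_apply]
        exact h1 _ (by omega) (by omega)
      · simp only [Set.mem_ofPred_eq, map_shiftPoint hs, shiftPoint_apply, zero_add]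
        exact h2
  obtain ⟨⟨x, x'⟩, hp⟩ := hne
  have hp := Set.mem_iInter.1 hp
  have hxx : x = x' := Subtype.ext (funext fun j =>
    Set.mem_iInter.1 (hp j.natAbs).1 j (by omega) (by omega))
  exact (hp 0).2 (by rw [hxx])

/-- A conjugacy together with its inverse, both given by sliding block codes. -/
theorem Conjugate.exists_blockCodes (h : Conjugate X Y) : ∃ (e : X.Points ≃ Y.Points) (k : ℕ),
    IsBlockCode k e ∧ IsBlockCode k e.symm ∧
    (∀ k x, e (X.shiftPoint k x) = Y.shiftPoint k (e x)) ∧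
    ∀ k y, e.symm (Y.shiftPoint k y) = X.shiftPoint k (e.symm y) := by
  obtain ⟨φ, hc, hb, hs⟩ := h
  let e := Equiv.ofBijective φ hb
  have he : Continuous e := hc
  obtain ⟨k, hk⟩ := exists_isBlockCode hc hs
  have hs' : ∀ k y, e.symm (Y.shiftPoint k y) = X.shiftPoint k (e.symm y) := fun k y => by
    rw [Equiv.symm_apply_eq]
    exact (congrArg _ (e.apply_symm_apply y).symm).trans (map_shiftPoint hs k _).symm
  have hσ : ∀ {W : ShiftSpace} (w : W.Points), W.shiftPoint 1 w = W.σ w := fun w => rfl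
  obtain ⟨l, hl⟩ := exists_isBlockCode he.continuous_symm_of_equiv_compact_to_t2 (hs' 1)
  exact ⟨e, max k l, hk.mono (le_max_left _ _), hl.mono (le_max_right _ _), map_shiftPoint hs, hs'⟩

end ShiftSpace

/-- In a finite alphabet, sequences that satisfy a condition on consecutive letters on arbitrarily
long intervals around `0` yield a sequence that satisfies it everywhere. -/
theorem exists_forall_of_finite {B : Type*} [Finite B] (P : ℤ → B → B → Prop)
    (h : ∀ n : ℕ, ∃ z : ℤ → B, ∀ i, -(n : ℤ) ≤ i → i < n → P i (z i) (z (i + 1))) :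
    ∃ z : ℤ → B, ∀ i, P i (z i) (z (i + 1)) := by
  let _ : TopologicalSpace B := ⊥
  have : DiscreteTopology B := ⟨rfl⟩
  let K : ℕ → Set (ℤ → B) := fun n => ⋂ i : ℤ, {z | -(n : ℤ) ≤ i → i < n → P i (z i) (z (i + 1))}
  have hclosed : ∀ n, IsClosed (K n) := fun n => isClosed_iInter fun i => by
    have : {z : ℤ → B | -(n : ℤ) ≤ i → i < n → P i (z i) (z (i + 1))}
        = (fun z => (z i, z (i + 1))) ⁻¹' {q | -(n : ℤ) ≤ i → i < n → P i q.1 q.2} := rfl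
    rw [this]
    exact (isClosed_discrete _).preimage
      ((continuous_apply i).prodMk (continuous_apply (i + 1)))
  obtain ⟨z, hz⟩ : (⋂ n, K n).Nonempty := by
    refine IsCompact.nonempty_iInter_of_sequence_nonempty_isCompact_isClosed K (fun n => ?_)
      (fun n => ?_) (hclosed 0).isCompact hclosed
    · exact fun z hz => Set.mem_iInter.2 fun i h1 h2 =>
        Set.mem_iInter.1 hz i (by push_cast; omega) (by push_cast; omega)
    · obtain ⟨z, hz⟩ := h n
      exact ⟨z, Set.mem_iInter.2 hz⟩
  refine ⟨z, fun i => ?_⟩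
  have := Set.mem_iInter.1 (Set.mem_iInter.1 hz (i.natAbs + 1)) i
  exact this (by omega) (by omega)

/-! ### The invariants of conjugate edge shifts -/

namespace FiniteDigraph

/-- Every vertex of `E` lies on a biinfinite path. -/
def IsEssential (E : FiniteDigraph) : Prop := ∀ u, ∃ x : BiPath E, E.s (x 0) = u

/-- `E` and `F` have the same determinant `det (Id - A)` and isomorphic Bowen–Franks groups. -/
def SameInvariants (E F : FiniteDigraph) : Prop := SameDetCoker (1 - E.adjacency) (1 - F.adjacency)

/-- The points of the edge shift are the biinfinite paths. -/
def pointsEquiv (E : FiniteDigraph) : E.edgeShift.Points ≃ BiPath E where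
  toFun x := ⟨x.1, (mem_edgeShift_iff E x.1).1 x.2⟩
  invFun x := ⟨x.toFun, (mem_edgeShift_iff E x.toFun).2 x.isPath⟩
  left_inv _ := rfl
  right_inv _ := rfl

theorem sameInvariants_of_conjugate_of_isEssential {E F : FiniteDigraph} (hE : E.IsEssential)
    (hF : F.IsEssential) (h : ShiftSpace.Conjugate E.edgeShift F.edgeShift) :
    E.SameInvariants F := by
  obtain ⟨e, k, he, he', hs, -⟩ := h.exists_blockCodes
  have hsh : ∀ {G : FiniteDigraph} (k : ℤ) (x : BiPath G),
      BiPath.shiftEquiv G k x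
        = G.pointsEquiv (G.edgeShift.shiftPoint k (G.pointsEquiv.symm x)) := fun {G} k x =>
    BiPath.ext fun i => (ShiftSpace.shiftPoint_apply (X := G.edgeShift) k (G.pointsEquiv.symm x) i).symm
  exact (shiftEquivOfWindow hE hF ((E.pointsEquiv.symm.trans e).trans F.pointsEquiv) k
    (fun x x' i h => he _ _ i h) (fun x x' i h => he' _ _ i h)
    fun k x => by simp [hsh, hs]).sameDetCoker

end FiniteDigraph

namespace FiniteDigraph

theorem adjacency_mulVec (E : FiniteDigraph) [Fintype E.Edge] (h : E.Vertex → ℤ) (u : E.Vertex) :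
    E.adjacency.mulVec h u = ∑ e : E.Edge, if E.s e = u then h (E.r e) else 0 := by
  classical
  have h1 : ∀ v, E.adjacency u v = ∑ e : E.Edge, if E.s e = u ∧ E.r e = v then 1 else 0 := by
    intro v
    rw [adjacency, Matrix.of_apply, Nat.card_eq_fintype_card, Fintype.card_subtype,
      Finset.sum_boole]
  simp only [Matrix.mulVec, dotProduct, h1, Finset.sum_mul]
  rw [Finset.sum_comm]
  refine Finset.sum_congr rfl fun e _ => ?_
  by_cases he : E.s e = u
  · simp [he]
  · simp [he]

/-! ### Removing sources and sinks -/

/-- The graph obtained by removing a vertex and the edges that touch it. -/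
def removeVertex (E : FiniteDigraph) (v : E.Vertex) : FiniteDigraph where
  Vertex := {u // u ≠ v}
  Edge := {e // E.s e ≠ v ∧ E.r e ≠ v}
  s e := ⟨E.s e.1, e.2.1⟩
  r e := ⟨E.r e.1, e.2.2⟩

theorem removeVertex_adjacency (E : FiniteDigraph) (v : E.Vertex) :
    (E.removeVertex v).adjacency = E.adjacency.submatrix Subtype.val Subtype.val := by
  ext u w
  change (Nat.card _ : ℤ) = Nat.card _
  congr 1
  exact Nat.card_congr
    { toFun := fun e => ⟨e.1.1, congrArg Subtype.val e.2.1, congrArg Subtype.val e.2.2⟩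
      invFun := fun e => ⟨⟨e.1, by rw [e.2.1]; exact u.2, by rw [e.2.2]; exact w.2⟩,
        Subtype.ext e.2.1, Subtype.ext e.2.2⟩
      left_inv := fun _ => rfl
      right_inv := fun _ => rfl }

/-- An index whose column or row vanishes can be removed. -/
theorem sameDetCoker_removeIndex {V : Type*} [Fintype V] [DecidableEq V] (A : Matrix V V ℤ) (v : V)
    (hv : ∀ u w, A u v * A v w = 0) :
    SameDetCoker (1 - A) (1 - A.submatrix (Subtype.val : {u // u ≠ v} → V) Subtype.val) := by
  let e : V ≃ {u // u ≠ v} ⊕ Unit :=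
    { toFun := fun u => if h : u = v then Sum.inr () else Sum.inl ⟨u, h⟩
      invFun := Sum.elim Subtype.val fun _ => v
      left_inv := fun u => by by_cases h : u = v <;> simp [h]
      right_inv := fun u => by
        rcases u with u | u
        · simp [u.2]
        · simp }
  have h1 : ∀ i, e.symm (Sum.inl i) = i.1 := fun _ => rfl
  have h2 : ∀ x, e.symm (Sum.inr x) = v := fun _ => rfl
  refine (sameDetCoker_reindex (1 - A) e).trans
    (sameDetCoker_of_mulVec _ (fun _ j => A v j.1) _ (fun j => ?_) ?_)
  · ext (i | i)
    · simp only [Matrix.mulVec, dotProduct, Fintype.sum_sum_type, Sum.elim_inl, Sum.elim_inr,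
        Matrix.submatrix_apply, Pi.single_apply, mul_ite, mul_one, mul_zero, Finset.sum_ite_eq',
        Finset.mem_univ, if_true, Finset.univ_unique, Finset.sum_singleton,
        Matrix.sub_apply, h1, h2]
      change (1 : Matrix V V ℤ) i.1 j.1 - _ + ((1 : Matrix V V ℤ) i.1 v - _) * _
        = (1 : Matrix {u // u ≠ v} {u // u ≠ v} ℤ) i j - _
      rw [Matrix.one_apply_ne i.2, zero_sub, neg_mul, hv, neg_zero, add_zero]
      congr 1
      simp [Matrix.one_apply, Subtype.ext_iff]
    · simp only [Matrix.mulVec, dotProduct, Fintype.sum_sum_type, Sum.elim_inl, Sum.elim_inr,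
        Matrix.submatrix_apply, Pi.single_apply, mul_ite, mul_one, mul_zero, Finset.sum_ite_eq',
        Finset.mem_univ, if_true, Finset.univ_unique, Finset.sum_singleton,
        Matrix.sub_apply, h1, h2]
      change (1 : Matrix V V ℤ) v j.1 - _ + ((1 : Matrix V V ℤ) v v - _) * _ = 0
      rw [Matrix.one_apply_ne j.2.symm, Matrix.one_apply_eq, sub_mul, hv]
      simp
  · have : A v v = 0 := by simpa using hv v v
    rw [Matrix.det_unique]
    simp [Matrix.toBlocks₂₂, h2, this]

theorem removeVertex_sameInvariants (E : FiniteDigraph) (v : E.Vertex)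
    (hv : ∀ u w, E.adjacency u v * E.adjacency v w = 0) :
    E.SameInvariants (E.removeVertex v) := by
  unfold SameInvariants
  rw [removeVertex_adjacency]
  exact sameDetCoker_removeIndex E.adjacency v hv

/-- No biinfinite path visits a source or a sink. -/
theorem removeVertex_conjugate (E : FiniteDigraph) (v : E.Vertex)
    (hv : (∀ e, E.r e ≠ v) ∨ ∀ e, E.s e ≠ v) :
    ShiftSpace.Conjugate (E.removeVertex v).edgeShift E.edgeShift := by
  have hmem : ∀ y : (E.removeVertex v).edgeShift.Points,
      (fun i => (y.1 i).1) ∈ E.edgeShift.toSubshift.carrier := fun y => by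
    rw [mem_edgeShift_iff]
    exact fun i => congrArg Subtype.val ((mem_edgeShift_iff _ _).1 y.2 i)
  refine ⟨fun y => ⟨fun i => (y.1 i).1, hmem y⟩, ?_, ⟨?_, ?_⟩, fun _ => rfl⟩
  · exact ShiftSpace.continuous_of_letterwise
      (X := (E.removeVertex v).edgeShift) (Y := E.edgeShift) Subtype.val fun _ _ => rfl
  · intro y y' h
    refine Subtype.ext (funext fun i => Subtype.ext ?_)
    exact congrFun (congrArg Subtype.val h) i
  · rintro ⟨x, hx⟩
    have hx' := (mem_edgeShift_iff E x).1 hx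
    have hne : ∀ i, E.s (x i) ≠ v := fun i => by
      rcases hv with hv | hv
      · rw [← sub_add_cancel i 1, ← hx']; exact hv _
      · exact hv _
    exact ⟨⟨fun i => ⟨x i, hne i, by rw [hx']; exact hne _⟩,
      (mem_edgeShift_iff _ _).2 fun i => Subtype.ext (hx' i)⟩, rfl⟩

theorem isEssential_of_forall_exists (E : FiniteDigraph) (hs : ∀ v, ∃ e, E.s e = v)
    (hr : ∀ v, ∃ e, E.r e = v) : E.IsEssential := by
  choose out hout using hs
  choose inn hinn using hr
  intro u
  refine ⟨⟨fun i => match i with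
    | Int.ofNat n => out ((fun v => E.r (out v))^[n] u)
    | Int.negSucc n => inn ((fun v => E.s (inn v))^[n] u), fun i => ?_⟩, hout u⟩
  match i with
  | Int.ofNat n =>
    change E.r (out _) = E.s (out ((fun v => E.r (out v))^[n + 1] u))
    rw [hout, Function.iterate_succ_apply']
  | Int.negSucc 0 =>
    change E.r (inn _) = E.s (out _)
    rw [hout, hinn]; rfl
  | Int.negSucc (n + 1) =>
    have h : Int.negSucc (n + 1) + 1 = Int.negSucc n := by omega
    rw [h]
    change E.r (inn ((fun v => E.s (inn v))^[n + 1] u)) = E.s (inn _)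
    rw [hinn, Function.iterate_succ_apply']

/-- Every edge shift is the edge shift of an essential graph with the same invariants. -/
theorem exists_isEssential (E : FiniteDigraph) : ∃ F : FiniteDigraph, F.IsEssential ∧
    ShiftSpace.Conjugate F.edgeShift E.edgeShift ∧ E.SameInvariants F := by
  induction hn : Fintype.card E.Vertex using Nat.strong_induction_on generalizing E with
  | _ n ih =>
    by_cases hess : (∀ v, ∃ e, E.s e = v) ∧ ∀ v, ∃ e, E.r e = v
    · exact ⟨E, E.isEssential_of_forall_exists hess.1 hess.2, .refl _, SameDetCoker.refl _⟩
    · have : ∃ v, (∀ e, E.r e ≠ v) ∨ ∀ e, E.s e ≠ v := by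
        by_contra! hcon
        exact hess ⟨fun v => (hcon v).2, fun v => (hcon v).1⟩
      obtain ⟨v, hv⟩ := this
      have hcard : Fintype.card (E.removeVertex v).Vertex < n := by
        rw [← hn]
        exact Fintype.card_subtype_lt (p := fun u => u ≠ v) (x := v) (by simp)
      obtain ⟨F, hF, hc, hi⟩ := ih _ hcard _ rfl
      refine ⟨F, hF, hc.trans (E.removeVertex_conjugate v hv),
        (E.removeVertex_sameInvariants v fun u w => ?_).trans hi⟩
      rcases hv with hv | hv
      · have : E.adjacency u v = 0 := by
          have : IsEmpty {e // E.s e = u ∧ E.r e = v} := ⟨fun e => hv e.1 e.2.2⟩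
          rw [adjacency, Matrix.of_apply, Nat.card_of_isEmpty]; rfl
        rw [this, zero_mul]
      · have : E.adjacency v w = 0 := by
          have : IsEmpty {e // E.s e = v ∧ E.r e = w} := ⟨fun e => hv e.1 e.2.1⟩
          rw [adjacency, Matrix.of_apply, Nat.card_of_isEmpty]; rfl
        rw [this, mul_zero]

/-- The determinant `det (Id - A)` and the Bowen–Franks group are conjugacy invariants. -/
theorem sameInvariants_of_conjugate {E F : FiniteDigraph}
    (h : ShiftSpace.Conjugate E.edgeShift F.edgeShift) : E.SameInvariants F := by
  obtain ⟨E', hE', hcE, hiE⟩ := E.exists_isEssential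
  obtain ⟨F', hF', hcF, hiF⟩ := F.exists_isEssential
  exact hiE.trans ((sameInvariants_of_conjugate_of_isEssential hE' hF'
    ((hcE.trans h).trans hcF.symm)).trans hiF.symm)

end FiniteDigraph

namespace ShiftSpace

/-! ### Shifts of finite type and their block graphs -/

/-- Membership in `X` can be checked on the windows of length `N + 1`. -/
def IsStep (X : ShiftSpace) (N : ℕ) : Prop :=
  ∀ x : ℤ → X.Alphabet, (∀ i : ℤ, ∃ x' : X.Points, ∀ j : ℤ, i ≤ j → j ≤ i + N → x'.1 j = x j) →
    x ∈ X.toSubshift.carrier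

theorem IsStep.isSFT {X : ShiftSpace} {N : ℕ} (h : X.IsStep N) : X.IsSFT := by
  refine ⟨{w | w.length = N + 1 ∧ w ∉ X.language},
    (List.finite_length_eq X.Alphabet (N + 1)).subset fun w hw => hw.1, ?_⟩
  ext x
  constructor
  · rintro hx w ⟨-, hw⟩ ho
    exact hw ⟨x, hx, ho⟩
  · intro hx
    refine h x fun i => ?_
    by_contra! hcon
    let w := List.ofFn fun k : Fin (N + 1) => x (i + k)
    refine hx w ⟨List.length_ofFn, ?_⟩ ⟨i, fun k hk => by simp only [w, List.getElem_ofFn]⟩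
    rintro ⟨x', hx', i', ho⟩
    obtain ⟨j, h1, h2, h3⟩ := hcon (X.shiftPoint (i' - i) ⟨x', hx'⟩)
    apply h3
    obtain ⟨k, rfl⟩ : ∃ k : ℕ, j = i + k := ⟨(j - i).toNat, by omega⟩
    rw [shiftPoint_apply]
    have := ho k (by simp [w]; omega)
    simp only [w, List.getElem_ofFn] at this
    rw [← this]
    exact congrArg x' (by ring)

/-- A shift space that is conjugate to an edge shift is of finite type. -/
theorem exists_isStep_of_conjugate {X : ShiftSpace} {E : FiniteDigraph}
    (h : Conjugate E.edgeShift X) : ∃ N, X.IsStep N := by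
  obtain ⟨e, k, he, he', hs, hs'⟩ := h.exists_blockCodes
  -- windows of radius `2 k + 1` determine pairs of consecutive edges and enough of their surroundings
  -- to recover the letter of `x` in the middle
  refine ⟨4 * k + 2, fun x hx => ?_⟩
  have hx2 : ∀ i : ℤ, ∃ x' : X.Points, ∀ j : ℤ,
      i - (2 * k + 1) ≤ j → j ≤ i + (2 * k + 1) → x'.1 j = x j :=
    fun i => by
      obtain ⟨x', hx'⟩ := hx (i - (2 * k + 1))
      exact ⟨x', fun j h1 h2 => hx' j h1 (by push_cast; omega)⟩
  choose w hw using hx2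
  have key : ∀ i j : ℤ, i - (k + 1) ≤ j → j ≤ i + (k + 1) →
      (e.symm (w j)).1 j = (e.symm (w i)).1 j := fun i j h1 h2 =>
    he' _ _ _ fun l h3 h4 => by rw [hw j l (by omega) (by omega), hw i l (by omega) (by omega)]
  have hy : (fun i => (e.symm (w i)).1 i) ∈ E.edgeShift.toSubshift.carrier := by
    refine (E.mem_edgeShift_iff _).2 fun i => ?_
    have := (E.mem_edgeShift_iff _).1 (e.symm (w i)).2 i
    exact this.trans (congrArg E.s (key i (i + 1) (by omega) (by omega)).symm)
  have : x = (e ⟨_, hy⟩).1 := by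
    funext i
    rw [he ⟨_, hy⟩ (e.symm (w i)) i fun j h1 h2 => key i j (by omega) (by omega),
      Equiv.apply_symm_apply, hw i i (by omega) (by omega)]
  rw [this]
  exact (e ⟨_, hy⟩).2

/-- The graph whose vertices and edges are the words of length `N` and `N + 1` that occur in `X`;
an edge leads from its prefix to its suffix of length `N`. -/
noncomputable def blockGraph (X : ShiftSpace) (N : ℕ) : FiniteDigraph where
  Vertex := {v : Fin N → X.Alphabet // ∃ x : X.Points, ∀ k : Fin N, x.1 (k : ℕ) = v k}
  Edge := {v : Fin (N + 1) → X.Alphabet // ∃ x : X.Points, ∀ k : Fin (N + 1), x.1 (k : ℕ) = v k}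
  fintypeVertex := Fintype.ofFinite _
  decEqVertex := Classical.decEq _
  s e := ⟨fun k => e.1 k.castSucc, e.2.imp fun x hx k => hx k.castSucc⟩
  r e := ⟨fun k => e.1 k.succ, e.2.elim fun x hx => ⟨X.shiftPoint 1 x, fun k => by
    rw [shiftPoint_apply]; exact_mod_cast hx k.succ⟩⟩

/-- The letter `e₀` that labels the edge `e = e₀ ⋯ e_N`. -/
def blockLabel (X : ShiftSpace) (N : ℕ) (e : (X.blockGraph N).Edge) : X.Alphabet := e.1 0

theorem blockGraph_succ {X : ShiftSpace} {N : ℕ} {e f : (X.blockGraph N).Edge}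
    (h : (X.blockGraph N).r e = (X.blockGraph N).s f) (k : Fin N) :
    e.1 k.succ = f.1 k.castSucc :=
  congrFun (congrArg Subtype.val h) k

theorem blockGraph_apply {X : ShiftSpace} {N : ℕ} {z : ℤ → (X.blockGraph N).Edge}
    (hz : ∀ i, (X.blockGraph N).r (z i) = (X.blockGraph N).s (z (i + 1)))
    (i : ℤ) (k : ℕ) (hk : k < N + 1) : (z i).1 ⟨k, hk⟩ = X.blockLabel N (z (i + k)) := by
  induction k generalizing i with
  | zero => simp [blockLabel]
  | succ k ih =>
    have h1 := blockGraph_succ (hz i) ⟨k, by omega⟩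
    have h2 := ih (i + 1) (by omega)
    rw [show i + ((k + 1 : ℕ) : ℤ) = i + 1 + k by push_cast; ring, ← h2]
    exact h1

/-- The edge path of the consecutive words of length `N + 1` in a point of `X`. -/
def blockPath {X : ShiftSpace} (N : ℕ) (x : X.Points) (i : ℤ) : (X.blockGraph N).Edge :=
  ⟨fun k => x.1 (i + (k : ℕ)), X.shiftPoint i x, fun k => by
    rw [shiftPoint_apply, add_comm]⟩

theorem blockPath_isPath {X : ShiftSpace} (N : ℕ) (x : X.Points) (i : ℤ) :
    (X.blockGraph N).r (blockPath N x i) = (X.blockGraph N).s (blockPath N x (i + 1)) := by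
  refine Subtype.ext (funext fun k => ?_)
  change x.1 (i + ((k.succ : Fin (N + 1)) : ℕ)) = x.1 (i + 1 + ((k.castSucc : Fin (N + 1)) : ℕ))
  simp only [Fin.val_succ, Fin.val_castSucc]
  exact congrArg x.1 (by push_cast; ring)

theorem blockLabel_blockPath {X : ShiftSpace} (N : ℕ) (x : X.Points) (i : ℤ) :
    X.blockLabel N (blockPath N x i) = x.1 i := by
  simp [blockLabel, blockPath]

theorem IsStep.blockLabel_mem {X : ShiftSpace} {N : ℕ} (h : X.IsStep N)
    {z : ℤ → (X.blockGraph N).Edge}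
    (hz : ∀ i, (X.blockGraph N).r (z i) = (X.blockGraph N).s (z (i + 1))) :
    (fun i => X.blockLabel N (z i)) ∈ X.toSubshift.carrier := by
  refine h _ fun i => ?_
  obtain ⟨x, hx⟩ := (z i).2
  refine ⟨X.shiftPoint (-i) x, fun j h1 h2 => ?_⟩
  obtain ⟨k, rfl⟩ : ∃ k : ℕ, j = i + k := ⟨(j - i).toNat, by omega⟩
  have := hx ⟨k, by omega⟩
  rw [blockGraph_apply hz] at this
  rw [shiftPoint_apply, ← this]
  exact congrArg x.1 (by simp)

theorem IsStep.conjugate_blockGraph {X : ShiftSpace} {N : ℕ} (h : X.IsStep N) :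
    Conjugate (X.blockGraph N).edgeShift X := by
  refine ⟨fun z => ⟨fun i => X.blockLabel N (z.1 i),
    h.blockLabel_mem ((FiniteDigraph.mem_edgeShift_iff _ _).1 z.2)⟩,
    continuous_of_letterwise (X := (X.blockGraph N).edgeShift) (X.blockLabel N) fun _ _ => rfl,
    ⟨?_, ?_⟩, fun _ => rfl⟩
  · intro z z' hzz
    have hz := (FiniteDigraph.mem_edgeShift_iff _ _).1 z.2
    have hz' := (FiniteDigraph.mem_edgeShift_iff _ _).1 z'.2
    refine Subtype.ext (funext fun i => Subtype.ext (funext fun k => ?_))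
    rw [blockGraph_apply hz i k k.2, blockGraph_apply hz' i k k.2]
    exact congrFun (congrArg Subtype.val hzz) _
  · intro x
    exact ⟨⟨blockPath N x, (FiniteDigraph.mem_edgeShift_iff _ _).2 (blockPath_isPath N x)⟩,
      Subtype.ext (funext fun i => blockLabel_blockPath N x i)⟩

end ShiftSpace

/-! ### Words read in a biinfinite sequence -/

/-- The word that is read in `x` at the positions `i, …, i + n - 1`. -/
def window {A : Type} (x : ℤ → A) (i : ℤ) (n : ℕ) : List A := (List.range n).map fun k : ℕ => x (i + k)

@[simp] theorem length_window {A : Type} (x : ℤ → A) (i : ℤ) (n : ℕ) : (window x i n).length = n := by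
  simp [window]

theorem window_add {A : Type} (x : ℤ → A) (i : ℤ) (m n : ℕ) :
    window x i (m + n) = window x i m ++ window x (i + m) n := by
  simp only [window, List.range_add, List.map_append, List.map_map, List.append_cancel_left_eq]
  refine List.map_congr_left fun k _ => ?_
  simp only [Function.comp_apply]
  exact congrArg x (by push_cast; ring)

theorem occursIn_iff_window {A : Type} {w : List A} {x : ℤ → A} :
    OccursIn w x ↔ ∃ i, window x i w.length = w := by
  refine exists_congr fun i => ⟨fun h => List.ext_getElem (by simp) fun k h1 h2 => ?_,
    fun h k hk => ?_⟩
  · simp [window, h k h2]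
  · have h1 : k < (window x i w.length).length := by simpa using hk
    have h2 : (window x i w.length)[k] = x (i + k) := by simp [window]
    rw [← h2]
    simp only [h]

theorem window_infix {A : Type} {x y : ℤ → A} {i j : ℤ} {m n : ℕ}
    (h : window x i m <:+: window y j n) : ∃ k : ℤ, window x i m = window y k m := by
  obtain ⟨a, b, h⟩ := h
  have hlen := congrArg List.length h
  simp only [List.length_append, length_window] at hlen
  obtain rfl : n = a.length + (m + b.length) := by omega
  rw [window_add, window_add, List.append_assoc] at h
  have h1 := (List.append_inj h (by simp)).2
  exact ⟨_, (List.append_inj h1 (by simp)).1⟩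

theorem window_eq_iff {A : Type} {x y : ℤ → A} {i j : ℤ} {n : ℕ} :
    window x i n = window y j n ↔ ∀ k : ℕ, k < n → x (i + k) = y (j + k) := by
  rw [window, window, List.map_inj_left]
  simp

/-! ### Subdivided graphs -/

namespace FiniteDigraph
variable {A : Type}

open Classical in
/-- The graph obtained from `G` by replacing every edge `e` by a path whose length is that of the
word `u e`. The interior vertex `inr ⟨e, k⟩` is the one reached after `k + 1` steps. -/
noncomputable abbrev subdivide (G : FiniteDigraph) (u : G.Edge → List A) : FiniteDigraph where
  Vertex := G.Vertex ⊕ Σ e : G.Edge, Fin ((u e).length - 1)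
  Edge := Σ e : G.Edge, Fin (u e).length
  fintypeVertex := letI := Fintype.ofFinite G.Edge; inferInstance
  decEqVertex := inferInstance
  s e := if h : (e.2 : ℕ) = 0 then Sum.inl (G.s e.1) else Sum.inr ⟨e.1, e.2 - 1, by omega⟩
  r e := if h : (e.2 : ℕ) + 1 < (u e.1).length then Sum.inr ⟨e.1, e.2, by omega⟩
    else Sum.inl (G.r e.1)

variable {G : FiniteDigraph} {u : G.Edge → List A}

/-- The letter that labels an edge of the subdivided graph. -/
def subLabel (u : G.Edge → List A) (e : (G.subdivide u).Edge) : A := (u e.1)[(e.2 : ℕ)]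

theorem subdivide_s_eq_inl {e : (G.subdivide u).Edge} {v : G.Vertex} :
    (G.subdivide u).s e = Sum.inl v ↔ (e.2 : ℕ) = 0 ∧ G.s e.1 = v := by
  simp only [subdivide]
  split_ifs with h <;> simp [h]

theorem subdivide_s_eq_inr {e : (G.subdivide u).Edge} {f : G.Edge} {k} :
    (G.subdivide u).s e = Sum.inr ⟨f, k⟩ ↔ e.1 = f ∧ (e.2 : ℕ) = k + 1 := by
  obtain ⟨e, l⟩ := e
  simp only [subdivide]
  split_ifs with h
  · simp; omega
  · simp only [Sum.inr.injEq, Sigma.mk.injEq]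
    constructor
    · rintro ⟨rfl, h2⟩
      rw [heq_iff_eq, Fin.ext_iff] at h2
      simp only at h2
      exact ⟨rfl, by omega⟩
    · rintro ⟨rfl, h2⟩
      exact ⟨rfl, heq_of_eq (Fin.ext (by simp [h2]))⟩

theorem subdivide_ext {e f : (G.subdivide u).Edge} (h1 : e.1 = f.1) (h2 : (e.2 : ℕ) = f.2) :
    e = f := by
  obtain ⟨e, k⟩ := e
  obtain ⟨f, l⟩ := f
  cases h1
  cases Fin.ext h2
  rfl

/-- Two edges of the subdivided graph are consecutive if they are consecutive in the path that
replaces an edge of `G`, or if they are the last and first edge of two such paths. -/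
theorem subdivide_r_eq_s_iff {e f : (G.subdivide u).Edge} :
    (G.subdivide u).r e = (G.subdivide u).s f ↔
      ((e.2 : ℕ) + 1 < (u e.1).length ∧ f.1 = e.1 ∧ (f.2 : ℕ) = e.2 + 1) ∨
      ((e.2 : ℕ) + 1 = (u e.1).length ∧ (f.2 : ℕ) = 0 ∧ G.r e.1 = G.s f.1) := by
  have he := e.2.2
  by_cases h : (e.2 : ℕ) + 1 < (u e.1).length
  · have h1 : (G.subdivide u).r e = Sum.inr ⟨e.1, e.2, by omega⟩ := dif_pos h
    rw [h1, eq_comm, subdivide_s_eq_inr]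
    simp only [h, true_and]
    constructor
    · exact Or.inl
    · rintro (h2 | h2)
      · exact h2
      · omega
  · have h1 : (G.subdivide u).r e = Sum.inl (G.r e.1) := dif_neg h
    rw [h1, eq_comm, subdivide_s_eq_inl]
    constructor
    · rintro ⟨h2, h3⟩
      exact Or.inr ⟨by omega, h2, h3.symm⟩
    · rintro (h2 | h2)
      · omega
      · exact ⟨h2.2.1, h2.2.2.symm⟩

/-- Subdividing edges changes neither the determinant nor the Bowen–Franks group: the new vertices
can be eliminated. -/
theorem subdivide_sameInvariants (hu : ∀ e, u e ≠ []) :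
    (G.subdivide u).SameInvariants G := by
  classical
  let _ := Fintype.ofFinite G.Edge
  let instE : Fintype (G.subdivide u).Edge :=
    inferInstanceAs (Fintype (Σ e : G.Edge, Fin (u e).length))
  have hr : ∀ (j : G.Vertex) (e : (G.subdivide u).Edge),
      (Sum.elim (Pi.single j 1) fun i => if G.r i.1 = j then 1 else 0 :
        G.Vertex ⊕ (Σ e : G.Edge, Fin ((u e).length - 1)) → ℤ) ((G.subdivide u).r e)
        = if G.r e.1 = j then 1 else 0 := by
    intro j e
    simp only
    split_ifs with h <;> simp_all
  refine sameDetCoker_of_mulVec (m := G.Vertex) (n := Σ e : G.Edge, Fin ((u e).length - 1))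
    (1 - (G.subdivide u).adjacency) (fun i j => if G.r i.1 = j then 1 else 0)
    (1 - G.adjacency) (fun j => ?_) ?_
  · have hsum := (G.subdivide u).adjacency_mulVec
      (Sum.elim (Pi.single j 1) fun i => if G.r i.1 = j then 1 else 0)
    simp only [hr] at hsum
    rw [Matrix.sub_mulVec, Matrix.one_mulVec]
    ext (v | ⟨e, k⟩)
    · have h1 : (G.subdivide u).adjacency.mulVec
          (Sum.elim (Pi.single j 1) fun i => if G.r i.1 = j then 1 else 0) (Sum.inl v)
          = G.adjacency v j := by
        rw [hsum]
        have h2 := G.adjacency_mulVec (Pi.single j 1) v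
        rw [Matrix.mulVec_single_one] at h2
        change G.adjacency v j = _ at h2
        rw [h2, Fintype.sum_sigma]
        refine Finset.sum_congr rfl fun e _ => ?_
        rw [Finset.sum_eq_single ⟨0, List.length_pos_iff.2 (hu e)⟩]
        · simp [Pi.single_apply]
        · intro k _ hk
          rw [if_neg]
          rw [subdivide_s_eq_inl]
          exact fun h => hk (Fin.ext h.1)
        · simp
      simp only [Pi.sub_apply, h1, Sum.elim_inl, Matrix.sub_apply, Pi.single_apply]
      rw [Matrix.one_apply]
    · have h1 : (G.subdivide u).adjacency.mulVec
          (Sum.elim (Pi.single j 1) fun i => if G.r i.1 = j then 1 else 0) (Sum.inr ⟨e, k⟩)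
          = if G.r e = j then 1 else 0 := by
        rw [hsum, Fintype.sum_eq_single (⟨e, ⟨k + 1, by omega⟩⟩ : Σ e : G.Edge, Fin (u e).length)]
        · rw [if_pos (subdivide_s_eq_inr.2 ⟨rfl, rfl⟩)]
        · intro f hf
          rw [if_neg]
          rw [subdivide_s_eq_inr]
          exact fun h => hf (subdivide_ext h.1 h.2)
      simp only [Pi.sub_apply, h1, Sum.elim_inr, sub_self, Pi.zero_apply]
  · refine det_eq_one_of_grading _ (fun i => (i.2 : ℕ)) ?_
    rintro ⟨e, k⟩ ⟨f, l⟩ hlk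
    have h1 : (G.subdivide u).adjacency (Sum.inr ⟨e, k⟩) (Sum.inr ⟨f, l⟩) = 0 := by
      have : IsEmpty {g // (G.subdivide u).s g = Sum.inr ⟨e, k⟩ ∧
          (G.subdivide u).r g = Sum.inr ⟨f, l⟩} := by
        refine ⟨fun ⟨g, h1, h2⟩ => ?_⟩
        rw [subdivide_s_eq_inr] at h1
        simp only at h2
        split_ifs at h2
        simp only [Sum.inr.injEq] at h2
        have h3 : (g.2 : ℕ) = l := by
          have := congrArg (fun x : Σ e : G.Edge, Fin ((u e).length - 1) => (x.2 : ℕ)) h2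
          simpa using this
        simp only at hlk
        omega
      rw [adjacency, Matrix.of_apply, Nat.card_of_isEmpty]; rfl
    change (1 : Matrix _ _ ℤ) (Sum.inr _) (Sum.inr _)
      - (G.subdivide u).adjacency (Sum.inr ⟨e, k⟩) (Sum.inr ⟨f, l⟩) = _
    rw [h1, sub_zero]
    simp only [Matrix.one_apply, Sum.inr.injEq]

/-! ### Coding by the labels of a subdivided graph -/

/-- The edge of `G` that is being traversed at time `i`. -/
def edgeAt (z : BiPath (G.subdivide u)) (i : ℤ) : G.Edge := (z i).1

/-- The position reached at time `i` inside the path that replaces an edge of `G`. -/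
def posAt (z : BiPath (G.subdivide u)) (i : ℤ) : ℕ := (z i).2

theorem posAt_lt (z : BiPath (G.subdivide u)) (i : ℤ) : posAt z i < (u (edgeAt z i)).length :=
  (z i).2.2

theorem subdivide_step (z : BiPath (G.subdivide u)) (i : ℤ) :
    (posAt z i + 1 < (u (edgeAt z i)).length ∧ edgeAt z (i + 1) = edgeAt z i ∧
        posAt z (i + 1) = posAt z i + 1) ∨
      (posAt z i + 1 = (u (edgeAt z i)).length ∧ posAt z (i + 1) = 0 ∧
        G.r (edgeAt z i) = G.s (edgeAt z (i + 1))) :=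
  subdivide_r_eq_s_iff.1 (z.isPath i)

theorem biPath_subdivide_ext {z z' : BiPath (G.subdivide u)}
    (h1 : ∀ i, edgeAt z i = edgeAt z' i) (h2 : ∀ i, posAt z i = posAt z' i) : z = z' :=
  BiPath.ext fun i => subdivide_ext (h1 i) (h2 i)

/-- Inside the path that replaces an edge of `G`, the positions can be read off forwards. -/
theorem subdivide_add (z : BiPath (G.subdivide u)) (i : ℤ) (k : ℕ)
    (hk : posAt z i + k < (u (edgeAt z i)).length) :
    edgeAt z (i + k) = edgeAt z i ∧ posAt z (i + k) = posAt z i + k := by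
  induction k with
  | zero => simp
  | succ k ih =>
    obtain ⟨h1, h2⟩ := ih (by omega)
    rw [show i + ((k + 1 : ℕ) : ℤ) = i + k + 1 by push_cast; ring]
    rcases subdivide_step z (i + k) with ⟨h3, h4, h5⟩ | ⟨h3, h4, h5⟩
    · exact ⟨h4.trans h1, by omega⟩
    · rw [h1] at h3; omega

/-- Inside the path that replaces an edge of `G`, the positions can be read off backwards. -/
theorem subdivide_sub (z : BiPath (G.subdivide u)) (i : ℤ) (k : ℕ) (hk : k ≤ posAt z i) :
    edgeAt z (i - k) = edgeAt z i ∧ posAt z (i - k) = posAt z i - k := by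
  induction k with
  | zero => simp
  | succ k ih =>
    obtain ⟨h1, h2⟩ := ih (by omega)
    have h0 : i - ((k + 1 : ℕ) : ℤ) + 1 = i - k := by push_cast; ring
    rcases subdivide_step z (i - (k + 1 : ℕ)) with ⟨h3, h4, h5⟩ | ⟨h3, h4, h5⟩
    · rw [h0] at h4 h5
      exact ⟨h4.symm.trans h1, by omega⟩
    · rw [h0] at h4; omega

/-- The path that replaces an edge of `G` ends with a transition to a consecutive edge. -/
theorem subdivide_next (z : BiPath (G.subdivide u)) (i : ℤ) (hi : posAt z i = 0) :
    posAt z (i + (u (edgeAt z i)).length) = 0 ∧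
      G.r (edgeAt z i) = G.s (edgeAt z (i + (u (edgeAt z i)).length)) := by
  have hlt := posAt_lt z i
  obtain ⟨h1, h2⟩ := subdivide_add z i ((u (edgeAt z i)).length - 1) (by omega)
  have h0 : i + ((((u (edgeAt z i)).length - 1 : ℕ)) : ℤ) + 1 = i + (u (edgeAt z i)).length := by
    push_cast [show 1 ≤ (u (edgeAt z i)).length by omega]; ring
  rcases subdivide_step z (i + ((u (edgeAt z i)).length - 1 : ℕ)) with ⟨h3, h4, h5⟩ | ⟨h3, h4, h5⟩
  · rw [h1] at h3; omega
  · rw [h0] at h4 h5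
    exact ⟨h4, by rw [← h5, h1]⟩

/-- The label sequence of a biinfinite path of the subdivided graph. -/
def labelSeq (z : BiPath (G.subdivide u)) (i : ℤ) : A := subLabel u (z i)

theorem getElem?_posAt (z : BiPath (G.subdivide u)) (i : ℤ) :
    (u (edgeAt z i))[posAt z i]? = some (labelSeq z i) :=
  List.getElem?_eq_getElem (posAt_lt z i)

theorem labelSeq_mem (z : BiPath (G.subdivide u)) (i : ℤ) : labelSeq z i ∈ u (edgeAt z i) :=
  List.mem_of_getElem? (getElem?_posAt z i)

theorem getElem?_posAt_add (z : BiPath (G.subdivide u)) (i : ℤ) (k : ℕ)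
    (hk : posAt z i + k < (u (edgeAt z i)).length) :
    (u (edgeAt z i))[posAt z i + k]? = some (labelSeq z (i + k)) := by
  obtain ⟨h1, h2⟩ := subdivide_add z i k hk
  rw [← h1, ← h2, getElem?_posAt]

theorem window_labelSeq (z : BiPath (G.subdivide u)) (i : ℤ) (hi : posAt z i = 0) :
    window (labelSeq z) i (u (edgeAt z i)).length = u (edgeAt z i) := by
  refine List.ext_getElem (by simp) fun k h1 h2 => ?_
  have := getElem?_posAt_add z i k (by omega)
  rw [hi, zero_add, List.getElem?_eq_getElem h2, Option.some_inj] at this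
  simp only [window, List.getElem_map, List.getElem_range, this]

/-- Every window of the label sequence that starts with an edge of `G` is a prefix of the label of
a path of `G`. -/
theorem exists_isChain_window (z : BiPath (G.subdivide u)) (n : ℕ) (i : ℤ)
    (hi : posAt z i = 0) : ∃ es : List G.Edge,
      List.IsChain (fun e f => G.r e = G.s f) (edgeAt z i :: es) ∧
      ∃ m ≥ n, window (labelSeq z) i m = (edgeAt z i :: es).flatMap u := by
  induction n generalizing i with
  | zero =>
    exact ⟨[], List.isChain_singleton _, _, Nat.zero_le _, by
      rw [window_labelSeq z i hi]; simp⟩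
  | succ n ih =>
    have hlt := posAt_lt z i
    obtain ⟨h1, h2⟩ := subdivide_next z i hi
    obtain ⟨es, h3, m, hm, h4⟩ := ih _ h1
    refine ⟨_ :: es, List.isChain_cons_cons.2 ⟨h2, h3⟩, (u (edgeAt z i)).length + m, by omega, ?_⟩
    rw [window_add, window_labelSeq z i hi, h4]
    rfl

theorem exists_isChain_infix (z : BiPath (G.subdivide u)) (n : ℕ) (i : ℤ) :
    ∃ es : List G.Edge, es ≠ [] ∧ List.IsChain (fun e f => G.r e = G.s f) es ∧
      window (labelSeq z) i n <:+: es.flatMap u := by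
  have h := subdivide_sub z i (posAt z i) le_rfl
  obtain ⟨es, h1, m, hm, h2⟩ := exists_isChain_window z (posAt z i + n) (i - (posAt z i : ℕ))
    (by rw [h.2]; omega)
  refine ⟨_, List.cons_ne_nil _ _, h1, ?_⟩
  rw [← h2]
  obtain ⟨l, rfl⟩ := Nat.exists_eq_add_of_le hm
  rw [window_add, window_add, sub_add_cancel]
  exact ⟨_, _, rfl⟩

/-- The path of the subdivided graph that corresponds to a path of `G`. -/
def subPath (u : G.Edge → List A) (es : List G.Edge) : List (G.subdivide u).Edge :=
  es.flatMap fun e => (List.finRange (u e).length).map fun k => ⟨e, k⟩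

theorem map_subLabel_subPath (es : List G.Edge) :
    (subPath u es).map (subLabel u) = es.flatMap u := by
  rw [subPath, List.map_flatMap]
  congr 1
  funext e
  rw [List.map_map]
  refine List.ext_getElem (by simp) fun k h1 h2 => ?_
  simp [subLabel]

theorem isChain_subPath (hu : ∀ e, u e ≠ []) (es : List G.Edge)
    (hes : List.IsChain (fun e f => G.r e = G.s f) es) :
    List.IsChain (fun e f => (G.subdivide u).r e = (G.subdivide u).s f) (subPath u es) := by
  have h1 : ∀ e, List.IsChain (fun e f => (G.subdivide u).r e = (G.subdivide u).s f)
      ((List.finRange (u e).length).map fun k => (⟨e, k⟩ : (G.subdivide u).Edge)) := fun e => by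
    rw [List.isChain_iff_getElem]
    intro k hk
    simp only [List.length_map, List.length_finRange] at hk
    rw [subdivide_r_eq_s_iff]
    left
    have hget : ∀ l (hl : l < (u e).length), ((List.finRange (u e).length).map
        fun k => (⟨e, k⟩ : (G.subdivide u).Edge))[l]'(by simpa using hl) = ⟨e, ⟨l, hl⟩⟩ := by
      simp
    rw [hget k (by omega), hget (k + 1) hk]
    exact ⟨hk, rfl, rfl⟩
  induction es with
  | nil => simp [subPath]
  | cons e es ih =>
    rw [subPath, List.flatMap_cons, List.isChain_append]
    refine ⟨h1 e, ih hes.tail, fun a ha b hb => ?_⟩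
    rw [subdivide_r_eq_s_iff]
    right
    have hpos := List.length_pos_iff.2 (hu e)
    have ha' : a = ⟨e, ⟨(u e).length - 1, by omega⟩⟩ := by
      rw [List.getLast?_eq_getElem?] at ha
      simp only [List.length_map, List.length_finRange] at ha
      rw [List.getElem?_eq_getElem (by simp; omega)] at ha
      simp at ha
      exact ha.symm
    cases es with
    | nil => simp at hb
    | cons f es =>
      have hpos' := List.length_pos_iff.2 (hu f)
      have hb' : b = ⟨f, ⟨0, hpos'⟩⟩ := by
        rw [List.flatMap_cons, List.head?_append_of_ne_nil _ (by simp; exact hu f),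
          List.head?_eq_getElem?, List.getElem?_eq_getElem (by simpa using hpos')] at hb
        simp at hb
        exact hb.symm
      subst ha' hb'
      exact ⟨by simp; omega, rfl, (List.isChain_cons_cons.1 hes).1⟩

/-- A labelled graph presents the shift space with language `𝓛` if the labels of its paths and their
factors are exactly the words in `𝓛` and a biinfinite path is determined by its label. -/
theorem conjugate_subdivide [Finite A] (hu : ∀ e, u e ≠ []) (𝓛 : Set (List A))
    (hfac : ∀ w ∈ 𝓛, ∀ v, v <:+: w → v ∈ 𝓛)
    (hpath : ∀ es ≠ [], List.IsChain (fun e f => G.r e = G.s f) es → es.flatMap u ∈ 𝓛)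
    (hword : ∀ w ∈ 𝓛, ∃ es, List.IsChain (fun e f => G.r e = G.s f) es ∧ w <:+: es.flatMap u)
    (hinj : ∀ z z' : BiPath (G.subdivide u), (∀ i, labelSeq z i = labelSeq z' i) → z = z') :
    ShiftSpace.Conjugate (G.subdivide u).edgeShift
      (ShiftSpace.ofForbidden A {w | w ∉ 𝓛}) := by
  have hmem : ∀ z : BiPath (G.subdivide u), labelSeq z ∈ avoiding {w | w ∉ 𝓛} := by
    rintro z w hw ho
    obtain ⟨i, hi⟩ := occursIn_iff_window.1 ho
    obtain ⟨es, h0, h1, h2⟩ := exists_isChain_infix z w.length i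
    rw [hi] at h2
    exact hw (hfac _ (hpath es h0 h1) _ h2)
  refine ⟨fun z => ⟨labelSeq ((G.subdivide u).pointsEquiv z), hmem _⟩,
    ShiftSpace.continuous_of_letterwise (X := (G.subdivide u).edgeShift)
      (Y := ShiftSpace.ofForbidden A {w | w ∉ 𝓛}) (subLabel u) fun _ _ => rfl,
    ⟨?_, ?_⟩, fun _ => rfl⟩
  · intro z z' h
    exact (G.subdivide u).pointsEquiv.injective
      (hinj _ _ fun i => congrFun (congrArg Subtype.val h) i)
  · rintro ⟨x : ℤ → A, hx⟩
    have hxw : ∀ i n, window x i n ∈ 𝓛 := fun i n => by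
      by_contra hcon
      exact hx _ hcon (occursIn_iff_window.2 ⟨i, by rw [length_window]⟩)
    -- long windows of `x` are read along finite paths, and compactness yields a biinfinite one
    obtain ⟨z, hz⟩ := exists_forall_of_finite (B := (G.subdivide u).Edge)
      (fun i e f => (G.subdivide u).r e = (G.subdivide u).s f ∧ subLabel u e = x i) fun n => by
        obtain ⟨es, h1, a, b, h2⟩ := hword _ (hxw (-n) (2 * n + 1))
        have hch := isChain_subPath hu es h1
        have hlen := congrArg List.length (map_subLabel_subPath (u := u) es)
        rw [← h2] at hlen
        simp only [List.length_map, List.length_append, length_window] at hlen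
        obtain ⟨f, hf⟩ : ∃ f : ℤ → (G.subdivide u).Edge, ∀ (k : ℕ) (hk : k ≤ 2 * n),
            f (k - n) = (subPath u es)[a.length + k]'(by omega) :=
          ⟨fun i => (subPath u es)[min (a.length + (i + n).toNat) (a.length + 2 * n)]'(by omega),
            fun k hk => by simp [hk]⟩
        refine ⟨f, fun i hi hi' => ?_⟩
        obtain ⟨k, rfl⟩ : ∃ k : ℕ, i = k - n := ⟨(i + n).toNat, by omega⟩
        have hk1 := hf (k + 1) (by omega)
        rw [show ((k + 1 : ℕ) : ℤ) - n = k - n + 1 by push_cast; ring] at hk1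
        rw [hf k (by omega), hk1]
        refine ⟨hch.getElem _ _, ?_⟩
        have h3 := map_subLabel_subPath (u := u) es
        have h4 : ((subPath u es).map (subLabel u))[a.length + k]'(by
            rw [List.length_map]; omega) = x (k - n) := by
          simp only [h3, ← h2]
          rw [List.getElem_append_left (by simp; omega), List.getElem_append_right (by omega)]
          simp only [window, List.getElem_map, List.getElem_range, add_tsub_cancel_left]
          exact congrArg x (by ring)
        simpa using h4
    exact ⟨(G.subdivide u).pointsEquiv.symm ⟨z, fun i => (hz i).1⟩,
      Subtype.ext (funext fun i => (hz i).2)⟩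

end FiniteDigraph

/-! ### Biinfinite concatenations -/

/-- Replacing every letter `b` of a biinfinite sequence `x` by the nonempty word `u b` yields a
biinfinite sequence `y`. -/
theorem exists_biinfinite_flatMap {B C : Type} (x : ℤ → B) (u : B → List C) (hu : ∀ b, u b ≠ []) :
    ∃ y : ℤ → C, (∀ i n, ∃ t m, window y t m = (window x i n).flatMap u) ∧
      ∀ t n, ∃ i, window y t n <:+: (window x i n).flatMap u := by
  have hpos : ∀ b, 1 ≤ (u b).length := fun b => List.length_pos_iff.2 (hu b)
  -- `pos i` is the position at which the word `u (x i)` begins in `y`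
  obtain ⟨pos, hpos0, hsucc⟩ : ∃ pos : ℤ → ℤ, pos 0 = 0 ∧
      ∀ i, pos (i + 1) = pos i + (u (x i)).length := by
    refine ⟨fun i => match i with
      | Int.ofNat n => ∑ k ∈ Finset.range n, ((u (x k)).length : ℤ)
      | Int.negSucc n => -∑ k ∈ Finset.range (n + 1), ((u (x (Int.negSucc k))).length : ℤ),
      by exact Finset.sum_range_zero _, fun i => ?_⟩
    match i with
    | Int.ofNat n => exact Finset.sum_range_succ _ _
    | Int.negSucc 0 => simp
    | Int.negSucc (n + 1) =>
      have h : Int.negSucc (n + 1) + 1 = Int.negSucc n := by omega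
      rw [h]
      simp only [Finset.sum_range_succ _ (n + 1)]
      ring
  have hmono : ∀ (i : ℤ) (n : ℕ), pos i + n ≤ pos (i + n) := fun i n => by
    induction n with
    | zero => simp
    | succ n ih =>
      have h1 := hsucc (i + n)
      have h2 := hpos (x (i + n))
      rw [show i + ((n + 1 : ℕ) : ℤ) = i + n + 1 by push_cast; ring, h1]
      push_cast
      omega
  have hex : ∀ t : ℤ, ∃ i, pos i ≤ t ∧ t < pos (i + 1) := fun t => by
    obtain ⟨i, hi, hmax⟩ := Int.exists_greatest_of_bdd (P := fun i => pos i ≤ t)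
      ⟨t.natAbs, fun i hi => by
        by_contra! hcon
        obtain ⟨k, rfl⟩ : ∃ k : ℕ, i = 0 + k := ⟨i.toNat, by omega⟩
        have := hmono 0 k
        omega⟩ ⟨-t.natAbs, by
        have := hmono (-t.natAbs) t.natAbs
        rw [neg_add_cancel, hpos0] at this
        omega⟩
    refine ⟨i, hi, ?_⟩
    by_contra! hcon
    have := hmax (i + 1) hcon
    omega
  choose idx hidx using hex
  have huniq : ∀ t i, pos i ≤ t → t < pos (i + 1) → idx t = i := fun t i h1 h2 => by
    obtain ⟨h3, h4⟩ := hidx t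
    rcases lt_trichotomy (idx t) i with h | h | h
    · obtain ⟨k, hk⟩ : ∃ k : ℕ, i = idx t + 1 + k := ⟨(i - idx t - 1).toNat, by omega⟩
      have := hmono (idx t + 1) k
      rw [← hk] at this
      omega
    · exact h
    · obtain ⟨k, hk⟩ : ∃ k : ℕ, idx t = i + 1 + k := ⟨(idx t - i - 1).toNat, by omega⟩
      have := hmono (i + 1) k
      rw [← hk] at this
      omega
  have hlt : ∀ t, (t - pos (idx t)).toNat < (u (x (idx t))).length := fun t => by
    have h1 := hidx t
    have h2 := hsucc (idx t)
    omega
  let y : ℤ → C := fun t => (u (x (idx t)))[(t - pos (idx t)).toNat]'(hlt t)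
  have hy : ∀ t, (u (x (idx t)))[(t - pos (idx t)).toNat]? = some (y t) := fun t =>
    List.getElem?_eq_getElem (hlt t)
  have hone : ∀ i, window y (pos i) (u (x i)).length = u (x i) := fun i => by
    refine List.ext_getElem (by simp) fun k h1 h2 => ?_
    have h3 := hy (pos i + k)
    have h4 := hsucc i
    rw [huniq (pos i + k) i (by omega) (by omega)] at h3
    rw [show (pos i + k - pos i).toNat = k by omega, List.getElem?_eq_getElem h2,
      Option.some_inj] at h3
    simp only [window, List.getElem_map, List.getElem_range, h3]
  have hflat : ∀ i (n : ℕ), ∃ m : ℕ, pos (i + n) = pos i + m ∧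
      window y (pos i) m = (window x i n).flatMap u := fun i n => by
    induction n with
    | zero => exact ⟨0, by simp, by simp [window]⟩
    | succ n ih =>
      obtain ⟨m, h1, h2⟩ := ih
      refine ⟨m + (u (x (i + n))).length, ?_, ?_⟩
      · rw [show i + ((n + 1 : ℕ) : ℤ) = i + n + 1 by push_cast; ring, hsucc, h1]
        push_cast; ring
      · rw [window_add, h2, ← h1, hone, window_add, List.flatMap_append]
        simp [window]
  refine ⟨y, fun i n => ⟨pos i, (hflat i n).imp fun m h => h.2⟩, fun t n => ⟨idx t, ?_⟩⟩
  obtain ⟨m, h1, h2⟩ := hflat (idx t) n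
  obtain ⟨h3, h4⟩ := hidx t
  rcases n with - | n
  · simp [window]
  have h5 := hmono (idx t + 1) n
  rw [show idx t + 1 + (n : ℤ) = idx t + ((n + 1 : ℕ) : ℤ) by push_cast; ring, h1] at h5
  obtain ⟨a, ha⟩ : ∃ a : ℕ, t = pos (idx t) + a := ⟨(t - pos (idx t)).toNat, by omega⟩
  obtain ⟨b, rfl⟩ : ∃ b : ℕ, m = a + ((n + 1) + b) := ⟨m - a - (n + 1), by omega⟩
  rw [← h2, window_add y _ a, ← ha, window_add y t (n + 1) b]
  exact ⟨_, _, by rw [List.append_assoc]⟩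

/-! ### Symbol expansion of edge shifts -/

namespace FiniteDigraph

theorem SameInvariants.symm {E F : FiniteDigraph} (h : E.SameInvariants F) :
    F.SameInvariants E := SameDetCoker.symm h

theorem SameInvariants.trans {E F G : FiniteDigraph} (h : E.SameInvariants F)
    (h' : F.SameInvariants G) : E.SameInvariants G := SameDetCoker.trans h h'

end FiniteDigraph

namespace ShiftSpace

theorem mem_language_of_infix {X : ShiftSpace} {v w : List X.Alphabet} (hw : w ∈ X.language)
    (h : v <:+: w) : v ∈ X.language := by
  obtain ⟨x, hx, ho⟩ := hw
  obtain ⟨i, hi⟩ := occursIn_iff_window.1 ho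
  obtain ⟨a, b, rfl⟩ := h
  refine ⟨x, hx, occursIn_iff_window.2 ⟨i + a.length, ?_⟩⟩
  rw [List.length_append, List.length_append, window_add, window_add] at hi
  exact (List.append_inj (List.append_inj hi (by simp)).1 (by simp)).2

theorem window_mem_language {X : ShiftSpace} {x : ℤ → X.Alphabet}
    (hx : x ∈ X.toSubshift.carrier) (i : ℤ) (n : ℕ) : window x i n ∈ X.language :=
  ⟨x, hx, occursIn_iff_window.2 ⟨i, by rw [length_window]⟩⟩

/-- As `X` is closed, it contains all sequences whose windows belong to its language. -/
theorem mem_carrier_of_window {X : ShiftSpace} {x : ℤ → X.Alphabet}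
    (h : ∀ i n, window x i n ∈ X.language) : x ∈ X.toSubshift.carrier := by
  have h1 : ∀ n : ℕ, ∃ x' : X.Points, ∀ j : ℤ, -n ≤ j → j ≤ n → x'.1 j = x j := fun n => by
    obtain ⟨x', hx', ho⟩ := h (-n) (2 * n + 1)
    obtain ⟨i, hi⟩ := occursIn_iff_window.1 ho
    rw [length_window, window_eq_iff] at hi
    refine ⟨X.shiftPoint (i + n) ⟨x', hx'⟩, fun j h1 h2 => ?_⟩
    have h3 := hi (j + n).toNat (by omega)
    rw [show -(n : ℤ) + ((j + n).toNat : ℤ) = j by omega] at h3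
    rw [shiftPoint_apply, ← h3]
    exact congrArg x' (by omega)
  choose w hw using h1
  refine X.toSubshift.isClosed.mem_of_tendsto (b := Filter.atTop) (f := fun n => (w n).1) ?_
    (Filter.Eventually.of_forall fun n => (w n).2)
  refine tendsto_pi_nhds.2 fun j => ?_
  refine tendsto_const_nhds.congr' ?_
  filter_upwards [Filter.eventually_ge_atTop j.natAbs] with n hn
  exact (hw n j (by omega) (by omega)).symm

/-- The word that replaces a single letter `b` in the expansion of the letter `a`. -/
noncomputable def expandLetter {A : Type} (a b : A) : List (Option A) := expandWord a [b]

theorem expandWord_eq_flatMap {A : Type} (a : A) (w : List A) :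
    expandWord a w = w.flatMap (expandLetter a) := by
  unfold expandLetter expandWord
  simp

theorem expandLetter_eq {A : Type} (a b : A) :
    (b = a ∧ expandLetter a b = [some b, none]) ∨ (b ≠ a ∧ expandLetter a b = [some b]) := by
  unfold expandLetter expandWord
  by_cases h : b = a <;> simp [h]

theorem expandLetter_ne_nil {A : Type} (a b : A) : expandLetter a b ≠ [] := by
  rcases expandLetter_eq a b with ⟨-, h⟩ | ⟨-, h⟩ <;> simp [h]

theorem filterMap_expandWord {A : Type} (a : A) (w : List A) :
    (expandWord a w).filterMap id = w := by
  induction w with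
  | nil => rfl
  | cons b w ih =>
    rw [expandWord_eq_flatMap] at ih ⊢
    rw [List.flatMap_cons, List.filterMap_append, ih]
    rcases expandLetter_eq a b with ⟨-, h⟩ | ⟨-, h⟩ <;> simp [h]

/-- If the expansion of a letter of `X` is a shift of finite type, then so is `X`. -/
theorem isStep_of_symbolExpansion {X : ShiftSpace} {a : X.Alphabet} {N : ℕ}
    (h : (X.symbolExpansion a).IsStep N) : X.IsStep N := by
  intro x hx
  have hmem : ∀ x' ∈ X.toSubshift.carrier, ∀ y' : ℤ → Option X.Alphabet,
      (∀ t n, ∃ i, window y' t n <:+: (window x' i n).flatMap (expandLetter a)) →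
      y' ∈ (X.symbolExpansion a).toSubshift.carrier := by
    rintro x' hx' y' hy' w hw ho
    obtain ⟨t, ht⟩ := occursIn_iff_window.1 ho
    obtain ⟨i, hi⟩ := hy' t w.length
    rw [ht] at hi
    exact hw ⟨_, window_mem_language hx' i w.length, by rwa [expandWord_eq_flatMap]⟩
  obtain ⟨y, hy1, hy2⟩ := exists_biinfinite_flatMap x _ (expandLetter_ne_nil a)
  have hy : y ∈ (X.symbolExpansion a).toSubshift.carrier := by
    refine h y fun t => ?_
    obtain ⟨i, hi⟩ := hy2 t (N + 1)
    obtain ⟨x', hx'⟩ := hx i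
    obtain ⟨y', hy1', hy2'⟩ := exists_biinfinite_flatMap x'.1 _ (expandLetter_ne_nil a)
    have hwin : window x i (N + 1) = window x'.1 i (N + 1) :=
      window_eq_iff.2 fun k hk => (hx' _ (by omega) (by omega)).symm
    obtain ⟨t', m, htm⟩ := hy1' i (N + 1)
    rw [hwin, ← htm] at hi
    obtain ⟨s, hs⟩ := window_infix hi
    rw [window_eq_iff] at hs
    refine ⟨(X.symbolExpansion a).shiftPoint (s - t) ⟨y', hmem _ x'.2 _ hy2'⟩, fun j h1 h2 => ?_⟩
    obtain ⟨k, rfl⟩ : ∃ k : ℕ, j = t + k := ⟨(j - t).toNat, by omega⟩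
    rw [hs k (by omega), shiftPoint_apply]
    exact congrArg y' (by ring)
  refine mem_carrier_of_window fun i n => ?_
  obtain ⟨t, m, htm⟩ := hy1 i n
  by_contra hcon
  refine hy (window y t m) (fun ⟨w, hw, hinf⟩ => hcon ?_) (occursIn_iff_window.2
    ⟨t, by rw [length_window]⟩)
  rw [htm, ← expandWord_eq_flatMap] at hinf
  have := hinf.filterMap id
  rw [filterMap_expandWord, filterMap_expandWord] at this
  exact mem_language_of_infix hw this

/-- The labels of finite paths of the block graph belong to the language: the paths extend to
biinfinite paths. -/
theorem IsStep.map_blockLabel_mem {X : ShiftSpace} {N : ℕ} (h : X.IsStep N)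
    (es : List (X.blockGraph N).Edge)
    (hes : es.IsChain fun e f => (X.blockGraph N).r e = (X.blockGraph N).s f) (hne : es ≠ []) :
    es.map (X.blockLabel N) ∈ X.language := by
  have hpos := List.length_pos_iff.2 hne
  have hext : ∀ e : (X.blockGraph N).Edge, ∃ x : X.Points, blockPath N x 0 = e := fun e => by
    obtain ⟨x, hx⟩ := e.2
    exact ⟨x, Subtype.ext (funext fun k => by rw [← hx k]; exact congrArg x.1 (by simp))⟩
  obtain ⟨x, hx⟩ := hext es[0]
  obtain ⟨x', hx'⟩ := hext (es[es.length - 1])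
  let z : ℤ → (X.blockGraph N).Edge := fun i =>
    if i < 0 then blockPath N x i else
      if hi : i.toNat < es.length then es[i.toNat] else blockPath N x' (i - (es.length - 1 : ℕ))
  have hz0 : ∀ i ≤ 0, z i = blockPath N x i := fun i hi => by
    rcases hi.lt_or_eq with hi | rfl
    · exact if_pos hi
    · simp only [z, lt_irrefl, if_false, Int.toNat_zero, hpos, dif_pos, hx]
  have hz1 : ∀ (k : ℕ) (hk : k < es.length), z k = es[k] := fun k hk => by
    have h1 : ¬ (k : ℤ) < 0 := by omega
    simp only [z, h1, if_false, Int.toNat_natCast, hk, dif_pos]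
  have hz2 : ∀ i : ℤ, (es.length - 1 : ℕ) ≤ i → z i = blockPath N x' (i - (es.length - 1 : ℕ)) :=
    fun i hi => by
      rcases hi.lt_or_eq with hi | rfl
      · have h1 : ¬ i < 0 := by omega
        have h2 : ¬ i.toNat < es.length := by omega
        simp only [z, h1, h2, if_false, dif_neg, not_false_eq_true]
      · rw [sub_self, hx', hz1 _ (by omega)]
  have hz : ∀ i, (X.blockGraph N).r (z i) = (X.blockGraph N).s (z (i + 1)) := fun i => by
    rcases lt_or_ge i 0 with hi | hi
    · rw [hz0 i hi.le, hz0 (i + 1) (by omega)]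
      exact blockPath_isPath N x i
    · obtain ⟨k, rfl⟩ := Int.eq_ofNat_of_zero_le hi
      rcases lt_or_ge (k + 1) es.length with hk | hk
      · have h2 := hz1 (k + 1) hk
        push_cast at h2
        rw [hz1 k (by omega), h2]
        exact hes.getElem k hk
      · rw [hz2 _ (by omega), hz2 (k + 1) (by omega), blockPath_isPath, add_sub_right_comm]
  refine ⟨_, h.blockLabel_mem hz, 0, fun k hk => ?_⟩
  rw [List.length_map] at hk
  simp only [zero_add, hz1 k hk, List.getElem_map]

open FiniteDigraph in
/-- The expansion of a letter in a shift of finite type is presented by the block graph in which the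
edges that carry this letter are subdivided. -/
theorem IsStep.conjugate_symbolExpansion {X : ShiftSpace} {N : ℕ} (h : X.IsStep N)
    (a : X.Alphabet) : Conjugate
      ((X.blockGraph N).subdivide fun e => expandLetter a (X.blockLabel N e)).edgeShift
      (X.symbolExpansion a) := by
  refine FiniteDigraph.conjugate_subdivide (fun e => expandLetter_ne_nil _ _)
    {u | ∃ w ∈ X.language, u <:+: expandWord a w} ?_ ?_ ?_ ?_
  · rintro w ⟨w', hw', h1⟩ v hv
    exact ⟨w', hw', hv.trans h1⟩
  · intro es hne hes
    exact ⟨_, h.map_blockLabel_mem es hes hne, by rw [expandWord_eq_flatMap, List.flatMap_map]⟩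
  · rintro w ⟨w', ⟨x, hx, ho⟩, hw⟩
    obtain ⟨i, hi⟩ := occursIn_iff_window.1 ho
    refine ⟨(List.range w'.length).map fun k : ℕ => blockPath N ⟨x, hx⟩ (i + k), ?_, ?_⟩
    · rw [List.isChain_iff_getElem]
      intro k hk
      simp only [List.getElem_map, List.getElem_range]
      rw [blockPath_isPath, add_assoc]
      push_cast
      rfl
    · rw [List.flatMap_map]
      simp only [blockLabel_blockPath]
      rw [expandWord_eq_flatMap] at hw
      rwa [← List.flatMap_map (f := fun k : ℕ => x (i + k)), ← window, hi]
  · intro z z' hzz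
    have hlen : ∀ b, (expandLetter a b).length ≤ 2 := fun b => by
      rcases expandLetter_eq a b with ⟨-, h⟩ | ⟨-, h⟩ <;> simp [h]
    have hget : ∀ b, (expandLetter a b)[0]? = some (some b) ∧
        ∀ c, (expandLetter a b)[1]? = some c → c = none := fun b => by
      rcases expandLetter_eq a b with ⟨-, h⟩ | ⟨-, h⟩ <;> simp [h]
    -- the first letter of an expanded letter is never the new symbol, the second one always is
    have hlab : ∀ (w : BiPath ((X.blockGraph N).subdivide
        fun e => expandLetter a (X.blockLabel N e))) (i : ℤ),
        (posAt w i = 0 ∧ labelSeq w i = some (X.blockLabel N (edgeAt w i))) ∨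
        (posAt w i = 1 ∧ labelSeq w i = none) := fun w i => by
      have h1 := getElem?_posAt w i
      have h2 := posAt_lt w i
      have h3 := hlen (X.blockLabel N (edgeAt w i))
      obtain h4 | h4 : posAt w i = 0 ∨ posAt w i = 1 := by omega
      · rw [h4, (hget _).1, Option.some_inj] at h1
        exact Or.inl ⟨h4, h1.symm⟩
      · rw [h4] at h1
        exact Or.inr ⟨h4, (hget _).2 _ h1⟩
    have hpos : ∀ i, posAt z i = posAt z' i := fun i => by
      have h0 := hzz i
      rcases hlab z i with ⟨h1, h2⟩ | ⟨h1, h2⟩ <;> rcases hlab z' i with ⟨h3, h4⟩ | ⟨h3, h4⟩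
      · rw [h1, h3]
      · rw [h2, h4] at h0; cases h0
      · rw [h2, h4] at h0; cases h0
      · rw [h1, h3]
    have hlet : ∀ i, posAt z i = 0 →
        X.blockLabel N (edgeAt z i) = X.blockLabel N (edgeAt z' i) := fun i hi => by
      have h0 := hzz i
      rcases hlab z i with ⟨h1, h2⟩ | ⟨h1, h2⟩ <;> rcases hlab z' i with ⟨h3, h4⟩ | ⟨h3, h4⟩
      · rw [h2, h4] at h0
        exact Option.some_inj.1 h0
      · rw [h2, h4] at h0; cases h0
      · omega
      · omega
    -- the `k`-th letter of an edge is the label of the `k`-th edge that follows it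
    have hword : ∀ (k : ℕ) (hk : k < N + 1) (i : ℤ), posAt z i = 0 →
        (edgeAt z i).1 ⟨k, hk⟩ = (edgeAt z' i).1 ⟨k, hk⟩ := by
      intro k
      induction k with
      | zero => exact fun hk i hi => hlet i hi
      | succ k ih =>
        intro hk i hi
        obtain ⟨h1, h2⟩ := subdivide_next z i hi
        obtain ⟨h3, h4⟩ := subdivide_next z' i (by rw [← hpos, hi])
        rw [← hlet i hi] at h4
        have h5 := blockGraph_succ h2 ⟨k, by omega⟩
        have h6 := blockGraph_succ h4 ⟨k, by omega⟩
        have h7 := ih (by omega) _ h1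
        exact (h5.trans h7).trans h6.symm
    have hedge : ∀ i, posAt z i = 0 → edgeAt z i = edgeAt z' i := fun i hi =>
      Subtype.ext (funext fun k => hword k k.2 i hi)
    refine biPath_subdivide_ext (fun i => ?_) hpos
    obtain ⟨h1, h2⟩ := subdivide_sub z i (posAt z i) le_rfl
    obtain ⟨h3, h4⟩ := subdivide_sub z' i (posAt z i) (hpos i).le
    rw [← h1, ← h3, hedge _ (by rw [h2, Nat.sub_self])]

open FiniteDigraph

/-- Flow equivalent shift spaces are either both conjugate to edge shifts or both not, and in the
former case the determinants and the Bowen–Franks groups of the graphs agree. -/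
theorem FlowEquivalent.invariants {X Y : ShiftSpace} (h : FlowEquivalent X Y) :
    ((∃ E : FiniteDigraph, Conjugate E.edgeShift X) ↔
      ∃ E : FiniteDigraph, Conjugate E.edgeShift Y) ∧
    ∀ E F : FiniteDigraph, Conjugate E.edgeShift X → Conjugate F.edgeShift Y →
      E.SameInvariants F := by
  induction h with
  | refl X => exact ⟨Iff.rfl, fun E F hE hF => sameInvariants_of_conjugate (hE.trans hF.symm)⟩
  | symm X Y _ ih => exact ⟨ih.1.symm, fun E F hE hF => SameInvariants.symm (ih.2 F E hF hE)⟩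
  | trans X Y Z _ _ ih ih' =>
    refine ⟨ih.1.trans ih'.1, fun E F hE hF => ?_⟩
    obtain ⟨G, hG⟩ := ih.1.1 ⟨E, hE⟩
    exact SameInvariants.trans (ih.2 E G hE hG) (ih'.2 G F hG hF)
  | rel X Y h =>
    rcases h with h | ⟨a, rfl⟩
    · exact ⟨⟨fun ⟨E, hE⟩ => ⟨E, hE.trans h⟩, fun ⟨E, hE⟩ => ⟨E, hE.trans h.symm⟩⟩,
        fun E F hE hF => sameInvariants_of_conjugate ((hE.trans h).trans hF.symm)⟩
    · refine ⟨⟨fun ⟨E, hE⟩ => ?_, fun ⟨E, hE⟩ => ?_⟩, fun E F hE hF => ?_⟩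
      · obtain ⟨N, hN⟩ := exists_isStep_of_conjugate hE
        exact ⟨_, hN.conjugate_symbolExpansion a⟩
      · obtain ⟨N, hN⟩ := exists_isStep_of_conjugate hE
        exact ⟨_, (isStep_of_symbolExpansion hN).conjugate_blockGraph⟩
      · obtain ⟨N, hN⟩ := exists_isStep_of_conjugate hE
        exact SameInvariants.trans
          (sameInvariants_of_conjugate (hE.trans hN.conjugate_blockGraph.symm))
          (SameInvariants.trans
            (SameInvariants.symm (subdivide_sameInvariants fun e => expandLetter_ne_nil _ _))
            (sameInvariants_of_conjugate ((hN.conjugate_symbolExpansion a).trans hF.symm)))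

end ShiftSpace

/-! ### Graphs of deterministic partial automata -/

namespace FiniteDigraph

variable {Q S : Type}

/-- The graph of a partial automaton: an edge is a pair of a state `q` and a symbol `t` that can be
read in the state `q`. -/
abbrev ofStep [Fintype Q] [DecidableEq Q] [Finite S] (δ : Q → S → Option Q) : FiniteDigraph where
  Vertex := Q
  Edge := {p : Q × S // (δ p.1 p.2).isSome}
  s e := e.1.1
  r e := (δ e.1.1 e.1.2).get e.2

/-- The state reached by reading a word. -/
def runStep (δ : Q → S → Option Q) : Q → List S → Option Q
  | q, [] => some q
  | q, t :: ts => (δ q t).bind fun q' => runStep δ q' ts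

theorem runStep_append (δ : Q → S → Option Q) (q : Q) (ts ts' : List S) :
    runStep δ q (ts ++ ts') = (runStep δ q ts).bind fun q' => runStep δ q' ts' := by
  induction ts generalizing q with
  | nil => rfl
  | cons t ts ih =>
    rcases h : δ q t with - | q'
    · simp [runStep, h]
    · simp [runStep, h, ih]

theorem runStep_snoc (δ : Q → S → Option Q) (q : Q) (ts : List S) (t : S) :
    runStep δ q (ts ++ [t]) = (runStep δ q ts).bind fun q' => δ q' t := by
  rw [runStep_append]
  congr 1
  funext q'
  simp [runStep]

variable [Fintype Q] [DecidableEq Q] [Finite S] {δ : Q → S → Option Q}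

theorem ofStep_edge_ext {e f : (ofStep δ).Edge} (h : (ofStep δ).s e = (ofStep δ).s f)
    (h' : e.1.2 = f.1.2) : e = f :=
  Subtype.ext (Prod.ext h h')

theorem ofStep_r (e : (ofStep δ).Edge) : δ ((ofStep δ).s e) e.1.2 = some ((ofStep δ).r e) :=
  (Option.some_get e.2).symm

theorem exists_runStep_of_isChain (es : List (ofStep δ).Edge) (e : (ofStep δ).Edge)
    (h : List.IsChain (fun e f => (ofStep δ).r e = (ofStep δ).s f) (e :: es)) :
    ∃ q, runStep δ ((ofStep δ).s e) ((e :: es).map fun e => e.1.2) = some q := by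
  induction es generalizing e with
  | nil => exact ⟨_, (congrArg (·.bind some) (ofStep_r e)).trans rfl⟩
  | cons f es ih =>
    obtain ⟨h1, h2⟩ := List.isChain_cons_cons.1 h
    obtain ⟨q, hq⟩ := ih f h2
    refine ⟨q, ?_⟩
    rw [List.map_cons, runStep, ofStep_r (δ := δ), Option.bind_some, h1, hq]

theorem exists_isChain_of_runStep (ts : List S) (q q' : Q) (h : runStep δ q ts = some q') :
    ∃ es : List (ofStep δ).Edge,
      List.IsChain (fun e f => (ofStep δ).r e = (ofStep δ).s f) es ∧
      (es.map fun e => e.1.2) = ts ∧ ∀ e ∈ es.head?, (ofStep δ).s e = q := by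
  induction ts generalizing q with
  | nil => exact ⟨[], List.isChain_nil, rfl, by simp⟩
  | cons t ts ih =>
    rw [runStep, Option.bind_eq_some_iff] at h
    obtain ⟨q₁, h1, h2⟩ := h
    obtain ⟨es, h3, h4, h5⟩ := ih q₁ h2
    let e : (ofStep δ).Edge := ⟨(q, t), by simp [h1]⟩
    have he : (ofStep δ).r e = q₁ := by simp [e, h1]
    refine ⟨e :: es, List.isChain_cons.2 ⟨fun f hf => ?_, h3⟩, by simp [e, h4], by simp [e]⟩
    rw [he, h5 f hf]

theorem adjacency_ofStep_mulVec [Fintype S] (h : Q → ℤ) (q : Q) :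
    (ofStep δ).adjacency.mulVec h q = ∑ t, (δ q t).elim 0 h := by
  classical
  let _ : Fintype (ofStep δ).Edge := Fintype.ofFinite _
  rw [adjacency_mulVec, Fintype.sum_of_injective (fun e : (ofStep δ).Edge => e.1)
    Subtype.val_injective _ fun p : Q × S => if p.1 = q then (δ p.1 p.2).elim 0 h else 0]
  · rw [Fintype.sum_prod_type, Finset.sum_eq_single q]
    · simp
    · intro q' _ hq
      exact Finset.sum_eq_zero fun t _ => by simp [hq]
    · simp
  · intro p hp
    have : δ p.1 p.2 = none := by
      by_contra hne
      exact hp ⟨⟨p, Option.isSome_iff_ne_none.2 hne⟩, rfl⟩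
    simp [this]
  · intro e
    rw [show δ e.1.1 e.1.2 = some ((ofStep δ).r e) from ofStep_r e]
    rfl

end FiniteDigraph

/-! ### The automaton of a list in the class `H` -/

namespace HParams

/-- The syllables of the words of a list in `H`: `main j k i` stands for `α_i` (`k = 0`) or
`γ_{k+1,i}` (`k ≥ 1`) in the block `j`, `tilde j i` for `α̃_i`, `beta j l` for `β_l^N`, and
`free v` for one of the additional primitive words. -/
inductive Syllable (D : HParams) : Type
  | main (j : Fin D.m) (k : Fin (D.block j).r) (i : Fin ((D.block j).c (k + 1)))
  | tilde (j : Fin D.m) (i : Fin ((D.block j).c 1))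
  | beta (j : Fin D.m) (l : Fin (D.block j).d)
  | free (v : Fin D.a)

/-- The states of the automaton. In the state `up j k` the syllables that have been read end with
`α γ₂ ⋯ γ_{k+1}` in the block `j`, so that `β^N` may be a word of its own or end a word that has
begun before. In the state `down j k` a power `β^N` and the first `k` of the syllables
`α̃, γ₂, …, γ_r` have been read, and the rest of them has to follow. -/
inductive State (D : HParams) : Type
  | base
  | up (j : Fin D.m) (k : Fin (D.block j).r)
  | down (j : Fin D.m) (k : Fin (D.block j).r)

variable {D : HParams}

theorem r_pos (j : Fin D.m) : 0 < (D.block j).r := by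
  have := (D.block j).two_le_r
  omega

/-- The syllables as a disjoint union of finite sets. -/
def syllableEquiv (D : HParams) : Syllable D ≃
    (((Σ j : Fin D.m, Σ k : Fin (D.block j).r, Fin ((D.block j).c (k + 1))) ⊕
      (Σ j : Fin D.m, Fin ((D.block j).c 1))) ⊕
      ((Σ j : Fin D.m, Fin (D.block j).d) ⊕ Fin D.a)) where
  toFun
    | .main j k i => .inl (.inl ⟨j, k, i⟩)
    | .tilde j i => .inl (.inr ⟨j, i⟩)
    | .beta j l => .inr (.inl ⟨j, l⟩)
    | .free v => .inr (.inr v)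
  invFun
    | .inl (.inl ⟨j, k, i⟩) => .main j k i
    | .inl (.inr ⟨j, i⟩) => .tilde j i
    | .inr (.inl ⟨j, l⟩) => .beta j l
    | .inr (.inr v) => .free v
  left_inv t := by cases t <;> rfl
  right_inv t := by rcases t with (⟨j, k, i⟩ | ⟨j, i⟩) | (⟨j, l⟩ | v) <;> rfl

/-- The states as a disjoint union of finite sets. -/
def stateEquiv (D : HParams) : State D ≃
    Unit ⊕ ((Σ j : Fin D.m, Fin (D.block j).r) ⊕ (Σ j : Fin D.m, Fin (D.block j).r)) where
  toFun
    | .base => .inl ()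
    | .up j k => .inr (.inl ⟨j, k⟩)
    | .down j k => .inr (.inr ⟨j, k⟩)
  invFun
    | .inl () => .base
    | .inr (.inl ⟨j, k⟩) => .up j k
    | .inr (.inr ⟨j, k⟩) => .down j k
  left_inv q := by cases q <;> rfl
  right_inv q := by rcases q with ⟨⟩ | (⟨j, k⟩ | ⟨j, k⟩) <;> rfl

instance : Fintype (Syllable D) := Fintype.ofEquiv _ (syllableEquiv D).symm
instance : Fintype (State D) := Fintype.ofEquiv _ (stateEquiv D).symm
instance : DecidableEq (State D) := (stateEquiv D).decidableEq

/-- The state that follows `down j k`. -/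
def State.next (j : Fin D.m) (k : Fin (D.block j).r) : State D :=
  if h : (k : ℕ) + 1 < (D.block j).r then .down j ⟨k + 1, h⟩ else .base

/-- The transitions of the automaton. -/
def step : State D → Syllable D → Option (State D)
  | .base, .main j k _ => if (k : ℕ) = 0 then some (.up j k) else some .base
  | .base, .tilde _ _ => some .base
  | .base, .free _ => some .base
  | .base, .beta j _ => some (.down j ⟨0, r_pos j⟩)
  | .up j k, .main j' k' _ =>
    if (k' : ℕ) = 0 ∨ (j' = j ∧ (k' : ℕ) = k + 1) then some (.up j' k') else some .base
  | .up _ _, .tilde _ _ => some .base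
  | .up _ _, .free _ => some .base
  | .up j k, .beta j' _ =>
    if j' = j ∧ (k : ℕ) + 1 = (D.block j).r then some .base else some (.down j' ⟨0, r_pos j'⟩)
  | .down j k, .main j' k' _ =>
    if j' = j ∧ (k' : ℕ) = k ∧ (k : ℕ) ≠ 0 then some (State.next j k) else none
  | .down j k, .tilde j' _ => if j' = j ∧ (k : ℕ) = 0 then some (State.next j k) else none
  | .down _ _, .free _ => none
  | .down _ _, .beta _ _ => none

/-- The states in which a word of the list may begin. -/
def State.IsOpen : State D → Prop
  | .down _ _ => False
  | _ => True

theorem State.next_ne_up (j : Fin D.m) (k : Fin (D.block j).r) (j' k') :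
    State.next j k ≠ State.up j' k' := by
  unfold State.next; split_ifs <;> simp

theorem State.next_eq_down {j : Fin D.m} {k : Fin (D.block j).r} {j' k'}
    (h : State.next j k = State.down j' k') : ∃ k₀ : Fin (D.block j').r,
      (k' : ℕ) = k₀ + 1 ∧ State.down j k = State.down j' k₀ := by
  unfold State.next at h
  split_ifs at h with h1
  cases h
  exact ⟨k, rfl, rfl⟩

/-- A state `up j k` is entered by reading `α`, or from `up j (k - 1)`. -/
theorem step_eq_up {q : State D} {t : Syllable D} {j : Fin D.m} {k : Fin (D.block j).r}
    (h : step q t = some (.up j k)) : ∃ i, t = .main j k i ∧ q.IsOpen ∧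
      ((k : ℕ) = 0 ∨ ∃ k' : Fin (D.block j).r, (k : ℕ) = k' + 1 ∧ q = .up j k') := by
  rcases q with - | ⟨j', k'⟩ | ⟨j', k'⟩ <;> rcases t with ⟨j₁, k₁, i⟩ | ⟨j₁, i⟩ | ⟨j₁, l⟩ | v <;>
    simp only [step, Option.some.injEq, reduceCtorEq] at h
  · split_ifs at h with h1
    · cases h
      exact ⟨i, rfl, trivial, Or.inl h1⟩
    · cases h
  · split_ifs at h with h1
    · cases h
      refine ⟨i, rfl, trivial, h1.imp_right fun ⟨h2, h3⟩ => ?_⟩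
      subst h2
      exact ⟨k', h3, rfl⟩
    · cases h
  · split_ifs at h <;> cases h
  · split_ifs at h
    exact absurd (Option.some.inj h) (State.next_ne_up _ _ _ _)
  · split_ifs at h
    exact absurd (Option.some.inj h) (State.next_ne_up _ _ _ _)

/-- A state `down j k` is entered by reading a power `β^N`, or from `down j (k - 1)`. -/
theorem step_eq_down {q : State D} {t : Syllable D} {j : Fin D.m} {k : Fin (D.block j).r}
    (h : step q t = some (.down j k)) :
    ((k : ℕ) = 0 ∧ q.IsOpen ∧ ∃ l, t = .beta j l) ∨
      ∃ k' : Fin (D.block j).r, (k : ℕ) = k' + 1 ∧ q = .down j k' ∧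
        (((k' : ℕ) = 0 ∧ ∃ i, t = .tilde j i) ∨ ((k' : ℕ) ≠ 0 ∧ ∃ i, t = .main j k' i)) := by
  rcases q with - | ⟨j', k'⟩ | ⟨j', k'⟩ <;> rcases t with ⟨j₁, k₁, i⟩ | ⟨j₁, i⟩ | ⟨j₁, l⟩ | v <;>
    simp only [step, Option.some.injEq, reduceCtorEq] at h
  · split_ifs at h <;> cases h
  · cases h
    exact Or.inl ⟨rfl, trivial, l, rfl⟩
  · split_ifs at h <;> cases h
  · split_ifs at h with h1
    · cases h
    · cases h
      exact Or.inl ⟨rfl, trivial, l, rfl⟩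
  · split_ifs at h with h1
    obtain ⟨k₀, h2, h3⟩ := State.next_eq_down (Option.some.inj h)
    obtain ⟨rfl, h4, h5⟩ := h1
    cases h3
    obtain rfl : k₁ = k₀ := Fin.ext h4
    exact Or.inr ⟨_, h2, rfl, Or.inr ⟨h5, i, rfl⟩⟩
  · split_ifs at h with h1
    obtain ⟨k₀, h2, h3⟩ := State.next_eq_down (Option.some.inj h)
    obtain ⟨rfl, h4⟩ := h1
    cases h3
    exact Or.inr ⟨_, h2, rfl, Or.inl ⟨h4, i, rfl⟩⟩

end HParams

/-! ### The words that are read by the automaton -/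

namespace HParams

variable {D : HParams}

/-- The words `α γ₂ ⋯ γ_k` in the block `j`. -/
inductive UpWord (j : Fin D.m) : ℕ → List (Syllable D) → Prop
  | nil : UpWord j 0 []
  | snoc {k : ℕ} {u : List (Syllable D)} (h : k < (D.block j).r)
      (i : Fin ((D.block j).c (k + 1))) (hu : UpWord j k u) :
      UpWord j (k + 1) (u ++ [.main j ⟨k, h⟩ i])

/-- The words that consist of a power `β^N` and of the first `k` of the syllables
`α̃, γ₂, …, γ_r` in the block `j`. -/
inductive DownWord (j : Fin D.m) : ℕ → List (Syllable D) → Prop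
  | beta (l : Fin (D.block j).d) : DownWord j 0 [.beta j l]
  | tilde {u : List (Syllable D)} (i : Fin ((D.block j).c 1)) (hu : DownWord j 0 u) :
      DownWord j 1 (u ++ [.tilde j i])
  | main {k : ℕ} {u : List (Syllable D)} (h : k < (D.block j).r) (hk : k ≠ 0)
      (i : Fin ((D.block j).c (k + 1))) (hu : DownWord j k u) :
      DownWord j (k + 1) (u ++ [.main j ⟨k, h⟩ i])

/-- The words of a list in `H`, written with syllables. -/
inductive IsSyllableWord : List (Syllable D) → Prop
  | single (t : Syllable D) (ht : ∀ j l, t ≠ .beta j l) : IsSyllableWord [t]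
  | up {j : Fin D.m} {u : List (Syllable D)} (hu : UpWord j (D.block j).r u)
      (l : Fin (D.block j).d) : IsSyllableWord (u ++ [.beta j l])
  | down {j : Fin D.m} {u : List (Syllable D)} (hu : DownWord j (D.block j).r u) :
      IsSyllableWord u

/-- A list in `H`, written with syllables. -/
def syllableList (D : HParams) : Language (Syllable D) := {u | IsSyllableWord u}

open FiniteDigraph

theorem kstar_append {S : Type} {L : Language S} {u v : List S} (hu : u ∈ KStar.kstar L)
    (hv : v ∈ KStar.kstar L) : u ++ v ∈ KStar.kstar L := by
  rw [Language.mem_kstar] at *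
  obtain ⟨l, rfl, hl⟩ := hu
  obtain ⟨l', rfl, hl'⟩ := hv
  exact ⟨l ++ l', by simp, by simpa [or_imp, forall_and] using ⟨hl, hl'⟩⟩

theorem mem_kstar_of_mem {S : Type} {L : Language S} {u : List S} (hu : u ∈ L) :
    u ∈ KStar.kstar L := Language.mem_kstar.2 ⟨[u], by simp, by simpa using hu⟩

theorem single_mem (t : Syllable D) (ht : ∀ j l, t ≠ .beta j l) :
    [t] ∈ KStar.kstar D.syllableList := mem_kstar_of_mem (IsSyllableWord.single t ht)

theorem UpWord.mem_kstar {j : Fin D.m} {k : ℕ} {u : List (Syllable D)} (hu : UpWord j k u) :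
    u ∈ KStar.kstar D.syllableList := by
  induction hu with
  | nil => exact Language.nil_mem_kstar _
  | snoc h i _ ih => exact kstar_append ih (single_mem _ (by simp))

/-- What has been read when the automaton, started in the state `base`, has reached the state
`q`. -/
def State.History (ts : List (Syllable D)) : State D → Prop
  | .base => ts ∈ KStar.kstar D.syllableList
  | .up j k => ∃ s ∈ KStar.kstar D.syllableList, ∃ u, UpWord j (k + 1) u ∧ ts = s ++ u
  | .down j k => ∃ s ∈ KStar.kstar D.syllableList, ∃ u, DownWord j k u ∧ ts = s ++ u

theorem State.History.mem_kstar {ts : List (Syllable D)} {q : State D} (h : q.History ts)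
    (hq : q.IsOpen) : ts ∈ KStar.kstar D.syllableList := by
  rcases q with - | ⟨j, k⟩ | ⟨j, k⟩
  · exact h
  · obtain ⟨s, hs, u, hu, rfl⟩ := h
    exact kstar_append hs hu.mem_kstar
  · exact hq.elim

theorem history_next {j : Fin D.m} {k : Fin (D.block j).r} {s u : List (Syllable D)}
    (hs : s ∈ KStar.kstar D.syllableList) (hu : DownWord j (k + 1) u) :
    (State.next j k).History (s ++ u) := by
  unfold State.next
  split_ifs with h
  · exact ⟨s, hs, u, hu, rfl⟩
  · have h1 : (k : ℕ) + 1 = (D.block j).r := by omega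
    rw [h1] at hu
    exact kstar_append hs (mem_kstar_of_mem (IsSyllableWord.down hu))

theorem History.step {ts : List (Syllable D)} {q q' : State D} {t : Syllable D}
    (h : q.History ts) (hq : step q t = some q') : q'.History (ts ++ [t]) := by
  have hone : q.IsOpen → (∀ j l, t ≠ .beta j l) → ts ++ [t] ∈ KStar.kstar D.syllableList :=
    fun h1 h2 => kstar_append (h.mem_kstar h1) (single_mem t h2)
  rcases q with - | ⟨j', k'⟩ | ⟨j', k'⟩ <;> rcases t with ⟨j₁, k₁, i⟩ | ⟨j₁, i⟩ | ⟨j₁, l⟩ | v <;>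
    simp only [HParams.step, Option.some.injEq, reduceCtorEq] at hq
  · split_ifs at hq with h1 <;> cases hq
    · refine ⟨ts, h, _, ?_, rfl⟩
      have := UpWord.snoc k₁.2 i (h1 ▸ UpWord.nil)
      simpa using this
    · exact hone trivial (by simp)
  · subst hq; exact hone trivial (by simp)
  · subst hq; exact ⟨ts, h, _, DownWord.beta l, rfl⟩
  · subst hq; exact hone trivial (by simp)
  · split_ifs at hq with h1 <;> cases hq
    · obtain h1 | ⟨rfl, h1⟩ := h1
      · refine ⟨ts, h.mem_kstar trivial, _, ?_, rfl⟩
        have := UpWord.snoc k₁.2 i (h1 ▸ UpWord.nil)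
        simpa using this
      · obtain ⟨s, hs, u, hu, rfl⟩ := h
        exact ⟨s, hs, _, UpWord.snoc k₁.2 i (h1 ▸ hu), by simp⟩
    · exact hone trivial (by simp)
  · subst hq; exact hone trivial (by simp)
  · split_ifs at hq with h1 <;> cases hq
    · obtain ⟨rfl, h1⟩ := h1
      obtain ⟨s, hs, u, hu, rfl⟩ := h
      rw [List.append_assoc]
      exact kstar_append hs (mem_kstar_of_mem (IsSyllableWord.up (h1 ▸ hu) l))
    · exact ⟨ts, h.mem_kstar trivial, _, DownWord.beta l, rfl⟩
  · subst hq; exact hone trivial (by simp)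
  · split_ifs at hq with h1
    obtain ⟨rfl, h1, h2⟩ := h1
    obtain rfl : k₁ = k' := Fin.ext h1
    cases hq
    obtain ⟨s, hs, u, hu, rfl⟩ := h
    rw [List.append_assoc]
    exact history_next hs (DownWord.main k₁.2 h2 i hu)
  · split_ifs at hq with h1
    obtain ⟨rfl, h1⟩ := h1
    cases hq
    obtain ⟨s, hs, u, hu, rfl⟩ := h
    rw [List.append_assoc]
    refine history_next hs ?_
    rw [h1] at hu ⊢
    exact DownWord.tilde i hu

/-- The states record the histories that their names announce. Hence what is read from `base` to
`base` is a concatenation of words of the list. -/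
theorem history_of_runStep {ts : List (Syllable D)} {q : State D}
    (h : runStep step .base ts = some q) : q.History ts := by
  induction ts using List.reverseRecOn generalizing q with
  | nil =>
    cases h
    exact Language.nil_mem_kstar _
  | append_singleton ts t ih =>
    rw [runStep_snoc, Option.bind_eq_some_iff] at h
    obtain ⟨q₁, h1, h2⟩ := h
    exact History.step (ih h1) h2

theorem UpWord.runStep {j : Fin D.m} {k : ℕ} {u : List (Syllable D)} (hu : UpWord j k u)
    (hk : k ≠ 0) {q : State D} (hq : q.IsOpen) :
    ∃ k' : Fin (D.block j).r, (k' : ℕ) + 1 = k ∧ runStep step q u = some (.up j k') := by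
  induction hu with
  | nil => exact absurd rfl hk
  | @snoc k u h i hu ih =>
    refine ⟨⟨k, h⟩, rfl, ?_⟩
    rw [runStep_snoc]
    rcases Nat.eq_zero_or_pos k with rfl | hk
    · cases hu
      rcases q with - | ⟨j', k'⟩ | ⟨j', k'⟩
      · simp [FiniteDigraph.runStep, step]
      · simp [FiniteDigraph.runStep, step]
      · exact hq.elim
    · obtain ⟨k', h1, h2⟩ := ih hk.ne'
      rw [h2, Option.bind_some, step, if_pos (Or.inr ⟨rfl, h1.symm⟩)]

theorem DownWord.runStep {j : Fin D.m} {k : ℕ} {u : List (Syllable D)} (hu : DownWord j k u)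
    {q : State D} (hq : q.IsOpen) : runStep step q u = some .base ∨
      ∃ h : k < (D.block j).r, runStep step q u = some (.down j ⟨k, h⟩) := by
  have hnext : ∀ k : Fin (D.block j).r, State.next j k = .base ∨
      ∃ h : (k : ℕ) + 1 < (D.block j).r, State.next j k = .down j ⟨k + 1, h⟩ := fun k => by
    unfold State.next
    split_ifs with h
    · exact Or.inr ⟨h, rfl⟩
    · exact Or.inl rfl
  induction hu with
  | beta l =>
    rcases q with - | ⟨j', k'⟩ | ⟨j', k'⟩
    · exact Or.inr ⟨r_pos j, by simp [FiniteDigraph.runStep, step]⟩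
    · by_cases h : j = j' ∧ (k' : ℕ) + 1 = (D.block j').r
      · exact Or.inl (by simp [FiniteDigraph.runStep, step, h])
      · exact Or.inr ⟨r_pos j, by
          rw [FiniteDigraph.runStep, step, if_neg h]; rfl⟩
    · exact hq.elim
  | tilde i hu ih =>
    rw [runStep_snoc]
    rcases ih with h | ⟨h, h1⟩
    · exact Or.inl (by simp [h, step])
    · rcases hnext ⟨0, h⟩ with h2 | ⟨h2, h3⟩
      · exact Or.inl (by simp [h1, step, h2])
      · exact Or.inr ⟨h2, by simp [h1, step, h3]⟩
  | @main k u h hk i hu ih =>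
    rw [runStep_snoc]
    rcases ih with h1 | ⟨h, h1⟩
    · exact Or.inl (by simp [h1, step, hk])
    · rcases hnext ⟨k, h⟩ with h2 | ⟨h2, h3⟩
      · exact Or.inl (by simp [h1, step, h2, hk])
      · exact Or.inr ⟨h2, by simp [h1, step, h3, hk]⟩

theorem IsSyllableWord.runStep {u : List (Syllable D)} (hu : IsSyllableWord u) {q : State D}
    (hq : q.IsOpen) : ∃ q' : State D, runStep step q u = some q' ∧ q'.IsOpen := by
  rcases hu with ⟨t, ht⟩ | ⟨hu, l⟩ | hu
  · have h1 : ∃ q' : State D, step q t = some q' ∧ q'.IsOpen := by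
      rcases q with - | ⟨j', k'⟩ | ⟨j', k'⟩
      · rcases t with ⟨j₁, k₁, i⟩ | ⟨j₁, i⟩ | ⟨j₁, l⟩ | v
        · rw [step]; split_ifs <;> exact ⟨_, rfl, trivial⟩
        · exact ⟨_, rfl, trivial⟩
        · exact absurd rfl (ht _ _)
        · exact ⟨_, rfl, trivial⟩
      · rcases t with ⟨j₁, k₁, i⟩ | ⟨j₁, i⟩ | ⟨j₁, l⟩ | v
        · rw [step]; split_ifs <;> exact ⟨_, rfl, trivial⟩
        · exact ⟨_, rfl, trivial⟩
        · exact absurd rfl (ht _ _)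
        · exact ⟨_, rfl, trivial⟩
      · exact hq.elim
    obtain ⟨q', h1, h2⟩ := h1
    exact ⟨q', by simp [FiniteDigraph.runStep, h1], h2⟩
  · rename_i j _
    obtain ⟨k, h1, h2⟩ := hu.runStep (r_pos j).ne' hq
    exact ⟨.base, by rw [runStep_snoc, h2, Option.bind_some, step, if_pos ⟨rfl, h1⟩], trivial⟩
  · rcases hu.runStep hq with h | ⟨h, -⟩
    · exact ⟨.base, h, trivial⟩
    · exact absurd h (lt_irrefl _)

theorem exists_runStep_of_mem_kstar {w : List (Syllable D)}
    (hw : w ∈ KStar.kstar D.syllableList) : ∃ q' : State D, runStep step .base w = some q' := by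
  obtain ⟨ws, rfl, hws⟩ := Language.mem_kstar.1 hw
  have : ∀ q : State D, q.IsOpen → ∃ q' : State D, runStep step q ws.flatten = some q' := by
    clear hw
    induction ws with
    | nil => exact fun q _ => ⟨q, rfl⟩
    | cons u ws ih =>
      intro q hq
      obtain ⟨q₁, h2, h1⟩ := IsSyllableWord.runStep (hws u (by simp)) hq
      obtain ⟨q₂, h3⟩ := ih (fun v hv => hws v (by simp [hv])) q₁ h1
      exact ⟨q₂, by rw [List.flatten_cons, runStep_append, h2, Option.bind_some, h3]⟩
  exact this .base trivial

theorem c_pos (j : Fin D.m) {k : ℕ} (hk : k < (D.block j).r) : 0 < (D.block j).c (k + 1) :=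
  (D.block j).c_pos _ (by omega) (by omega)

theorem exists_step_down (j : Fin D.m) (k : Fin (D.block j).r) :
    ∃ t : Syllable D, step (.down j k) t = some (State.next j k) := by
  by_cases hk : (k : ℕ) = 0
  · exact ⟨.tilde j ⟨0, c_pos j (r_pos j)⟩, if_pos ⟨rfl, hk⟩⟩
  · exact ⟨.main j k ⟨0, c_pos j k.2⟩, if_pos ⟨rfl, rfl, hk⟩⟩

theorem exists_upWord (j : Fin D.m) (n : ℕ) (hn : n ≤ (D.block j).r) :
    ∃ u : List (Syllable D), UpWord j n u := by
  induction n with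
  | zero => exact ⟨_, .nil⟩
  | succ n ih =>
    obtain ⟨u, hu⟩ := ih (by omega)
    exact ⟨_, .snoc (by omega) ⟨0, c_pos j (by omega)⟩ hu⟩

theorem exists_runStep_to (q : State D) : ∃ ts, runStep step .base ts = some q := by
  rcases q with - | ⟨j, k, hk⟩ | ⟨j, k, hk⟩
  · exact ⟨[], rfl⟩
  · obtain ⟨u, hu⟩ := exists_upWord j (k + 1) hk
    obtain ⟨k', h1, h2⟩ := hu.runStep (by omega) (q := .base) trivial
    obtain rfl : k' = ⟨k, hk⟩ := Fin.ext (by simpa using h1)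
    exact ⟨u, h2⟩
  · induction k with
    | zero => exact ⟨[.beta j ⟨0, (D.block j).d_pos⟩], rfl⟩
    | succ k ih =>
      obtain ⟨u, hu⟩ := ih (by omega)
      obtain ⟨t, ht⟩ := exists_step_down j ⟨k, by omega⟩
      exact ⟨u ++ [t], by rw [runStep_snoc, hu, Option.bind_some, ht, State.next, dif_pos]⟩

theorem exists_runStep_from (q : State D) :
    ∃ ts, ∃ q' : State D, runStep step q ts = some q' ∧ q'.IsOpen := by
  rcases q with - | ⟨j, k⟩ | ⟨j, k⟩
  · exact ⟨[], _, rfl, trivial⟩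
  · exact ⟨[], _, rfl, trivial⟩
  · obtain ⟨n, hn⟩ : ∃ n, n = (D.block j).r - k := ⟨_, rfl⟩
    induction n generalizing k with
    | zero => have := k.2; omega
    | succ n ih =>
      obtain ⟨t, ht⟩ := exists_step_down j k
      unfold State.next at ht
      split_ifs at ht with h
      · obtain ⟨ts, q', h2, h1⟩ := ih ⟨k + 1, h⟩ (by simp only; omega)
        exact ⟨t :: ts, q', by rw [runStep, ht, Option.bind_some, h2], h1⟩
      · exact ⟨[t], .base, by rw [runStep, ht]; rfl, trivial⟩

/-- The words that can be read by the automaton are factors of concatenations of words of the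
list. -/
theorem exists_mem_kstar_of_runStep {q q' : State D} {ts : List (Syllable D)}
    (h : runStep step q ts = some q') : ∃ w ∈ KStar.kstar D.syllableList, ts <:+: w := by
  obtain ⟨u, hu⟩ := exists_runStep_to q
  obtain ⟨v, q₂, hv, h2⟩ := exists_runStep_from q'
  refine ⟨u ++ ts ++ v, (history_of_runStep ?_).mem_kstar h2, u, v, rfl⟩
  rw [runStep_append, runStep_append, hu, Option.bind_some, h, Option.bind_some, hv]

end HParams

/-! ### Unique decipherability of biinfinite sequences -/

namespace HParams

open FiniteDigraph

variable {D : HParams}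

/-- The graph of the automaton of the lists in `H` with parameters `D`. -/
noncomputable abbrev graph (D : HParams) : FiniteDigraph := ofStep (step (D := D))

/-- The properties of the words that are denoted by the syllables of a list in `H`: different
syllables have no letter in common, and the words that are not powers of letters cannot be
cyclically rotated to themselves. -/
structure IsCoding {A : Type} (w : Syllable D → List A) : Prop where
  ne_nil : ∀ t, w t ≠ []
  eq_of_mem : ∀ t t' x, x ∈ w t → x ∈ w t' → t = t'
  rotate_ne : ∀ t, (∀ j l, t ≠ .beta j l) → ∀ q, 0 < q → q < (w t).length →
    (w t).rotate q ≠ w t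

/-- The graph that is obtained from the graph of the automaton by spelling out the syllables. -/
noncomputable abbrev letterGraph {A : Type} (w : Syllable D → List A) : FiniteDigraph :=
  D.graph.subdivide fun e => w e.1.2

variable {A : Type} {w : Syllable D → List A}

/-- The syllable that is being read at time `i`. -/
noncomputable def symAt (z : BiPath (letterGraph w)) (i : ℤ) : Syllable D := (edgeAt z i).1.2

/-- The state in which the current syllable was begun. -/
noncomputable def stateAt (z : BiPath (letterGraph w)) (i : ℤ) : State D := (edgeAt z i).1.1

theorem edgeAt_eq {z z' : BiPath (letterGraph w)} {i j : ℤ} (h : stateAt z i = stateAt z' j)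
    (h' : symAt z i = symAt z' j) : edgeAt z i = edgeAt z' j := ofStep_edge_ext h h'

theorem posAt_lt_length (z : BiPath (letterGraph w)) (i : ℤ) :
    posAt z i < (w (symAt z i)).length := posAt_lt z i

theorem posAt_step (z : BiPath (letterGraph w)) (i : ℤ) :
    (posAt z i + 1 < (w (symAt z i)).length ∧ edgeAt z (i + 1) = edgeAt z i ∧
        posAt z (i + 1) = posAt z i + 1) ∨
      (posAt z i + 1 = (w (symAt z i)).length ∧ posAt z (i + 1) = 0 ∧
        step (stateAt z i) (symAt z i) = some (stateAt z (i + 1))) :=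
  (subdivide_step z i).imp_right fun h =>
    ⟨h.1, h.2.1, (ofStep_r (edgeAt z i)).trans (congrArg some h.2.2)⟩

/-- A syllable that begins at time `b` is preceded by a syllable that begins at some time `c`. -/
theorem exists_prev (z : BiPath (letterGraph w)) (b : ℤ) (hb : posAt z b = 0) :
    posAt z (b - 1) + 1 = (w (symAt z (b - 1))).length ∧
      step (stateAt z (b - 1)) (symAt z (b - 1)) = some (stateAt z b) ∧
      ∃ c < b, posAt z c = 0 ∧ edgeAt z c = edgeAt z (b - 1) := by
  have h := posAt_step z (b - 1)
  rw [sub_add_cancel] at h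
  rcases h with ⟨-, -, h⟩ | ⟨h1, -, h2⟩
  · omega
  · obtain ⟨h3, h4⟩ := subdivide_sub z (b - 1) (posAt z (b - 1)) le_rfl
    exact ⟨h1, h2, _, by omega, by omega, h3⟩

theorem IsCoding.symAt_eq (hw : IsCoding w) {z z' : BiPath (letterGraph w)}
    (h : ∀ i, labelSeq z i = labelSeq z' i) (i : ℤ) : symAt z i = symAt z' i := by
  refine hw.eq_of_mem _ _ _ (labelSeq_mem z i) ?_
  rw [h]
  exact labelSeq_mem z' i

/-- If the positions in a syllable `t` differed by `q > 0`, then `w t` would be its own rotation by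
`q`. -/
theorem IsCoding.posAt_le (hw : IsCoding w) {z z' : BiPath (letterGraph w)}
    (h : ∀ i, labelSeq z i = labelSeq z' i) {i : ℤ} (hi : ∀ j l, symAt z i ≠ .beta j l) :
    posAt z' i ≤ posAt z i := by
  by_contra! hlt
  obtain ⟨h1, h2⟩ := subdivide_sub z i (posAt z i) le_rfl
  obtain ⟨h3, h4⟩ := subdivide_sub z' i (posAt z i) hlt.le
  obtain ⟨a, ha⟩ : ∃ a, a = i - (posAt z i : ℤ) := ⟨_, rfl⟩
  obtain ⟨t, ht⟩ : ∃ t, t = symAt z i := ⟨_, rfl⟩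
  rw [← ha] at h1 h2 h3 h4
  have hlt' := posAt_lt_length z' i
  rw [← hw.symAt_eq h] at hlt'
  obtain ⟨q, hq⟩ : ∃ q, q = posAt z' i - posAt z i := ⟨_, rfl⟩
  have hz : ∀ k, k < (w t).length → symAt z (a + k) = t ∧ posAt z (a + k) = k := fun k hk => by
    have h5 : posAt z a + k < (w (symAt z a)).length := by
      rw [show symAt z a = t by rw [ht]; exact congrArg (fun e : D.graph.Edge => e.1.2) h1]
      omega
    obtain ⟨h6, h7⟩ := subdivide_add z a k h5
    refine ⟨?_, by omega⟩
    rw [ht]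
    exact congrArg (fun e : D.graph.Edge => e.1.2) (h6.trans h1)
  -- while `z` reads the syllable `t` once, `z'` reads it cyclically from position `q` on
  have hz' : ∀ k, k < (w t).length → posAt z' (a + k) = (q + k) % (w t).length := fun k => by
    induction k with
    | zero =>
      intro hk
      rw [Nat.mod_eq_of_lt (by rw [ht]; omega)]
      simp only [Nat.cast_zero, add_zero]
      omega
    | succ k ih =>
      intro hk
      have h5 := ih (by omega)
      have h6 := hw.symAt_eq h (a + k)
      rw [(hz k (by omega)).1] at h6
      rw [show a + ((k + 1 : ℕ) : ℤ) = a + k + 1 by push_cast; ring]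
      rw [← add_assoc, Nat.add_mod, ← h5]
      have hone : 1 % (w t).length = 1 := Nat.mod_eq_of_lt (by omega)
      rw [hone]
      rcases posAt_step z' (a + k) with ⟨h7, -, h8⟩ | ⟨h7, h8, -⟩
      · rw [h8, Nat.mod_eq_of_lt (by rw [h6]; omega)]
      · rw [h8, h7, ← h6, Nat.mod_self]
  refine hw.rotate_ne t (ht ▸ hi) q (by omega) (by rw [ht]; omega) ?_
  refine List.ext_getElem (by simp) fun k hk hk' => ?_
  have h5 := getElem?_posAt z (a + k)
  have h6 := getElem?_posAt z' (a + k)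
  change (w (symAt z (a + k)))[_]? = _ at h5
  change (w (symAt z' (a + k)))[_]? = _ at h6
  rw [← hw.symAt_eq h, (hz k hk').1, hz' k hk', ← h, ← h5, (hz k hk').1, (hz k hk').2,
    List.getElem?_eq_getElem hk', List.getElem?_eq_getElem (Nat.mod_lt _ (by omega)),
    Option.some_inj] at h6
  rw [List.getElem_rotate, ← h6]
  congr 2
  exact Nat.add_comm _ _

/-- Syllables that are not powers of letters are synchronized. -/
theorem IsCoding.posAt_eq (hw : IsCoding w) {z z' : BiPath (letterGraph w)}
    (h : ∀ i, labelSeq z i = labelSeq z' i) {i : ℤ} (hi : ∀ j l, symAt z i ≠ .beta j l) :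
    posAt z i = posAt z' i :=
  le_antisymm (hw.posAt_le (fun i => (h i).symm) (hw.symAt_eq h i ▸ hi)) (hw.posAt_le h hi)

/-- Two paths with the same labels that are different at all times up to `n`. -/
structure Separated (z z' : BiPath (letterGraph w)) (n : ℤ) : Prop where
  label_eq : ∀ i, labelSeq z i = labelSeq z' i
  ne : ∀ i ≤ n, ¬ (edgeAt z i = edgeAt z' i ∧ posAt z i = posAt z' i)

namespace Separated

variable {z z' : BiPath (letterGraph w)} {n : ℤ}

theorem symm (h : Separated z z' n) : Separated z' z n :=
  ⟨fun i => (h.label_eq i).symm, fun i hi he => h.ne i hi ⟨he.1.symm, he.2.symm⟩⟩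

theorem stateAt_ne (h : Separated z z' n) (hw : IsCoding w) {b : ℤ} (hb : b ≤ n)
    (h0 : posAt z b = posAt z' b) : stateAt z b ≠ stateAt z' b := fun hs =>
  h.ne b hb ⟨edgeAt_eq hs (hw.symAt_eq h.label_eq b), h0⟩

/-- The paths take a common step at the end of a syllable that is not a power of a letter. -/
theorem step_eq (h : Separated z z' n) (hw : IsCoding w) {b : ℤ} (h0 : posAt z b = 0)
    (hs : ∀ j l, symAt z (b - 1) ≠ .beta j l) : posAt z' b = 0 := by
  have h1 := (exists_prev z b h0).1
  have h2 := hw.symAt_eq h.label_eq (b - 1)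
  rw [hw.posAt_eq h.label_eq hs, h2] at h1
  have h3 := posAt_step z' (b - 1)
  rw [sub_add_cancel] at h3
  omega

/-- The state `up j 0` is entered by reading `α`, after which both paths are in this state; the
states `up j k` can only be reached through it. -/
theorem stateAt_ne_up (h : Separated z z' n) (hw : IsCoding w) (j : Fin D.m) (m : ℕ) :
    ∀ (k : Fin (D.block j).r), (k : ℕ) = m → ∀ b ≤ n, posAt z b = 0 →
      stateAt z b ≠ .up j k := by
  induction m with
  | zero =>
    intro k hk b hb h0 hs
    obtain ⟨-, h1, -⟩ := exists_prev z b h0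
    rw [hs] at h1
    obtain ⟨i, h2, -, -⟩ := step_eq_up h1
    have h3 := h.step_eq hw h0 (by simp [h2])
    obtain ⟨-, h4, -⟩ := exists_prev z' b h3
    rw [← hw.symAt_eq h.label_eq, h2] at h4
    -- all states in which `α` can be read lead to the same state
    have h5 : ∀ q q' : State D, step q (.main j k i) = some q' → q' = .up j k := by
      intro q q' h6
      rcases q with - | ⟨j', k'⟩ | ⟨j', k'⟩
      · rw [step, if_pos hk] at h6
        exact (Option.some.inj h6).symm
      · rw [step, if_pos (Or.inl hk)] at h6
        exact (Option.some.inj h6).symm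
      · rw [step, if_neg (fun h => h.2.2 (h.2.1 ▸ hk))] at h6
        cases h6
    exact h.stateAt_ne hw hb (h0.trans h3.symm) (hs.trans (h5 _ _ h4).symm)
  | succ m ih =>
    intro k hk b hb h0 hs
    obtain ⟨-, h1, c, hc, hc0, hce⟩ := exists_prev z b h0
    rw [hs] at h1
    obtain ⟨i, -, -, h2 | ⟨k', h2, h3⟩⟩ := step_eq_up h1
    · omega
    · refine ih k' (by omega) c (by omega) hc0 ?_
      rw [← h3]
      exact congrArg (fun e : D.graph.Edge => e.1.1) hce

/-- The path that enters `down j 0` has just read a power `β^N`, and `α̃` follows, by which the other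
path is synchronized. As it was not in a state `up j' k`, it is in `down j 0` as well. -/
theorem stateAt_ne_down (h : Separated z z' n) (hw : IsCoding w) (j : Fin D.m) (m : ℕ) :
    ∀ (k : Fin (D.block j).r), (k : ℕ) = m → ∀ b ≤ n, posAt z b = 0 →
      stateAt z b ≠ .down j k := by
  induction m with
  | zero =>
    intro k hk b hb h0 hs
    obtain ⟨-, h1, -⟩ := exists_prev z b h0
    rw [hs] at h1
    obtain ⟨-, -, l, h2⟩ | ⟨k', h2, -⟩ := step_eq_down h1
    · -- in the state `down j 0` only `α̃` can be read, hence `z'` is synchronized after `β^N`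
      have h3 : ∀ j l, symAt z b ≠ .beta j l := by
        intro j' l' h4
        have h5 := (edgeAt z b).2
        change (step (stateAt z b) (symAt z b)).isSome at h5
        rw [hs, h4] at h5
        cases h5
      have h4 : posAt z' b = 0 := by rw [← hw.posAt_eq h.label_eq h3, h0]
      obtain ⟨-, h5, c, hc, hc0, hce⟩ := exists_prev z' b h4
      rw [← hw.symAt_eq h.label_eq, h2] at h5
      have h6 : stateAt z' c = stateAt z' (b - 1) :=
        congrArg (fun e : D.graph.Edge => e.1.1) hce
      rw [← h6] at h5
      rcases hq : stateAt z' c with - | ⟨j', k'⟩ | ⟨j', k'⟩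
      · rw [hq, step, Option.some_inj] at h5
        refine h.stateAt_ne hw hb (h0.trans h4.symm) ?_
        rw [hs, ← h5]
        congr 1
        exact Fin.ext hk
      · exact h.symm.stateAt_ne_up hw j' _ k' rfl c (by omega) hc0 hq
      · rw [hq] at h5
        cases h5
    · omega
  | succ m ih =>
    intro k hk b hb h0 hs
    obtain ⟨-, h1, c, hc, hc0, hce⟩ := exists_prev z b h0
    rw [hs] at h1
    obtain ⟨h2, -⟩ | ⟨k', h2, h3, -⟩ := step_eq_down h1
    · omega
    · refine ih k' (by omega) c (by omega) hc0 ?_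
      rw [← h3]
      exact congrArg (fun e : D.graph.Edge => e.1.1) hce

theorem stateAt_eq_base (h : Separated z z' n) (hw : IsCoding w) {b : ℤ} (hb : b ≤ n)
    (h0 : posAt z b = 0) : stateAt z b = .base := by
  rcases hq : stateAt z b with - | ⟨j, k⟩ | ⟨j, k⟩
  · rfl
  · exact absurd hq (h.stateAt_ne_up hw j _ k rfl b hb h0)
  · exact absurd hq (h.stateAt_ne_down hw j _ k rfl b hb h0)

theorem false (h : Separated z z' n) (hw : IsCoding w) : False := by
  obtain ⟨h1, h2⟩ := subdivide_sub z n (posAt z n) le_rfl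
  obtain ⟨b, hb⟩ : ∃ b, b = n - (posAt z n : ℤ) := ⟨_, rfl⟩
  rw [Nat.sub_self, ← hb] at h2
  have hbn : b ≤ n := by omega
  obtain ⟨-, h3, c, hc, hc0, hce⟩ := exists_prev z b h2
  rw [h.stateAt_eq_base hw hbn h2, ← show stateAt z c = stateAt z (b - 1) from
    congrArg (fun e : D.graph.Edge => e.1.1) hce, h.stateAt_eq_base hw (by omega) hc0] at h3
  have h4 := h.step_eq hw h2 (fun j l hjl => by rw [hjl] at h3; cases h3)
  exact h.stateAt_ne hw hbn (h2.trans h4.symm)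
    ((h.stateAt_eq_base hw hbn h2).trans (h.symm.stateAt_eq_base hw hbn h4).symm)

end Separated

/-- A biinfinite path is determined by its labels. -/
theorem IsCoding.labelSeq_injective (hw : IsCoding w) {z z' : BiPath (letterGraph w)}
    (h : ∀ i, labelSeq z i = labelSeq z' i) : z = z' := by
  have hfwd : ∀ i (k : ℕ), edgeAt z i = edgeAt z' i ∧ posAt z i = posAt z' i →
      edgeAt z (i + k) = edgeAt z' (i + k) ∧ posAt z (i + k) = posAt z' (i + k) := by
    intro i k h0
    induction k with
    | zero => simpa using h0
    | succ k ih =>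
      obtain ⟨h1, h2⟩ := ih
      rw [show i + ((k + 1 : ℕ) : ℤ) = i + k + 1 by push_cast; ring]
      have h3 := hw.symAt_eq h (i + k)
      have h4 : stateAt z (i + k) = stateAt z' (i + k) :=
        congrArg (fun e : D.graph.Edge => e.1.1) h1
      rcases posAt_step z (i + k) with ⟨h5, h6, h7⟩ | ⟨h5, h6, h7⟩ <;>
        rcases posAt_step z' (i + k) with ⟨h5', h6', h7'⟩ | ⟨h5', h6', h7'⟩
      · exact ⟨h6.trans (h1.trans h6'.symm), by omega⟩
      · rw [h3, h2] at h5; omega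
      · rw [h3, h2] at h5; omega
      · rw [h3, h4, h7'] at h7
        exact ⟨edgeAt_eq (Option.some.inj h7).symm (hw.symAt_eq h _), by omega⟩
  have hall : ∀ i, edgeAt z i = edgeAt z' i ∧ posAt z i = posAt z' i := by
    intro n
    by_contra hn
    refine Separated.false (n := n) ⟨h, fun i hi h0 => hn ?_⟩ hw
    have := hfwd i (n - i).toNat h0
    rwa [show i + ((n - i).toNat : ℤ) = n by omega] at this
  exact biPath_subdivide_ext (fun i => (hall i).1) fun i => (hall i).2

theorem flatMap_flatten {S : Type} (w : S → List A) (us : List (List S)) :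
    us.flatten.flatMap w = (us.map fun u => u.flatMap w).flatten := by
  simp [List.flatMap, List.map_flatten, List.flatten_flatten, Function.comp_def]

/-- The renewal system that is generated by the words of a list in `H` is conjugate to the edge
shift of the graph that reads its letters. -/
theorem IsCoding.conjugate [Finite A] (hw : IsCoding w) :
    ShiftSpace.Conjugate (letterGraph w).edgeShift
      (renewalSystem ((fun ts : List (Syllable D) => ts.flatMap w) '' D.syllableList)) := by
  have hstar : ∀ {v : List A}, v ∈ KStar.kstar
      (show Language A from (fun ts : List (Syllable D) => ts.flatMap w) '' D.syllableList) ↔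
      ∃ ts ∈ KStar.kstar D.syllableList, v = ts.flatMap w := by
    intro v
    constructor
    · intro hv
      obtain ⟨vs, rfl, hvs⟩ := Language.mem_kstar.1 hv
      choose! f hf hf' using hvs
      refine ⟨(vs.map f).flatten, Language.mem_kstar.2 ⟨_, rfl, fun y hy => ?_⟩, ?_⟩
      · obtain ⟨v, hv, rfl⟩ := List.mem_map.1 hy
        exact hf v hv
      rw [flatMap_flatten, List.map_map]
      congr 1
      exact (List.map_id vs).symm.trans (List.map_congr_left fun v hv => (hf' v hv).symm)
    · rintro ⟨ts, hts, rfl⟩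
      obtain ⟨us, rfl, hus⟩ := Language.mem_kstar.1 hts
      refine Language.mem_kstar.2 ⟨us.map fun u => u.flatMap w, flatMap_flatten .., ?_⟩
      intro v hv
      obtain ⟨u, hu, rfl⟩ := List.mem_map.1 hv
      exact ⟨u, hus u hu, rfl⟩
  refine conjugate_subdivide (fun e => hw.ne_nil _) _ ?_ ?_ ?_ fun z z' => hw.labelSeq_injective
  · rintro v ⟨v', h1, h2⟩ v'' h3
    exact ⟨v', h1, h3.trans h2⟩
  · intro es hne hes
    rcases es with - | ⟨e, es⟩
    · exact absurd rfl hne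
    obtain ⟨q, hq⟩ := exists_runStep_of_isChain es e hes
    obtain ⟨ts, h1, h2⟩ := exists_mem_kstar_of_runStep hq
    refine ⟨ts.flatMap w, hstar.2 ⟨ts, h1, rfl⟩, ?_⟩
    obtain ⟨s, s', rfl⟩ := h2
    refine ⟨s.flatMap w, s'.flatMap w, ?_⟩
    rw [List.flatMap_append, List.flatMap_append, List.flatMap_map]
  · rintro v ⟨v', h1, h2⟩
    obtain ⟨ts, h3, rfl⟩ := hstar.1 h1
    obtain ⟨q, hq⟩ := exists_runStep_of_mem_kstar h3
    obtain ⟨es, h4, h5, -⟩ := exists_isChain_of_runStep ts _ _ hq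
    refine ⟨es, h4, ?_⟩
    rw [← h5, List.flatMap_map] at h2
    exact h2

end HParams

/-! ### The determinant of the graph of the automaton -/

namespace HParams

open FiniteDigraph

variable {D : HParams}

theorem sum_syllable (f : Syllable D → ℤ) : ∑ t, f t =
    (∑ j, ∑ k, ∑ i, f (.main j k i)) + (∑ j, ∑ i, f (.tilde j i)) +
      ((∑ j, ∑ l, f (.beta j l)) + ∑ v, f (.free v)) := by
  rw [← Equiv.sum_comp (syllableEquiv D).symm f, Fintype.sum_sum_type, Fintype.sum_sum_type,
    Fintype.sum_sum_type, Fintype.sum_sigma, Fintype.sum_sigma, Fintype.sum_sigma]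
  congr 2
  exact Finset.sum_congr rfl fun j _ => Fintype.sum_sigma _

theorem one_sub_adjacency_mulVec (x : State D → ℤ) (q : State D) :
    (1 - D.graph.adjacency).mulVec x q = x q - ∑ t, (step q t).elim 0 x := by
  have h := adjacency_ofStep_mulVec (δ := step (D := D)) x q
  rw [← h, Matrix.sub_mulVec, Matrix.one_mulVec]
  rfl

/-- The row of the state `base` of the adjacency matrix. -/
theorem sum_step_base (x : State D → ℤ) : ∑ t, (step .base t).elim 0 x =
    (∑ j, ∑ k : Fin (D.block j).r,
      ((D.block j).c (k + 1) : ℤ) * (if (k : ℕ) = 0 then x (.up j k) else x .base)) +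
    (∑ j, ((D.block j).c 1 : ℤ) * x .base) +
    ((∑ j, ((D.block j).d : ℤ) * x (.down j ⟨0, r_pos j⟩)) + D.a * x .base) := by
  rw [sum_syllable]
  simp only [step, apply_ite (Option.elim · 0 x), Option.elim_some, Finset.sum_const,
    Finset.card_univ, Fintype.card_fin, nsmul_eq_mul]

/-- The row of the state `down j k` of the adjacency matrix. -/
theorem sum_step_down (x : State D → ℤ) (j : Fin D.m) (k : Fin (D.block j).r) :
    ∑ t, (step (.down j k) t).elim 0 x = ((D.block j).c (k + 1) : ℤ) * x (State.next j k) := by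
  rw [sum_syllable]
  simp only [step, apply_ite (Option.elim · 0 x), Option.elim_some, Option.elim_none,
    Finset.sum_const, Finset.card_univ, Fintype.card_fin, nsmul_eq_mul, mul_zero, add_zero]
  by_cases hk : (k : ℕ) = 0
  · rw [Finset.sum_eq_zero, zero_add, Finset.sum_eq_single j]
    · simp [hk]
    · intro j' _ hj
      simp [hj]
    · simp
    · intro j' _
      simp [hk]
  · rw [Finset.sum_eq_single j, Finset.sum_eq_single k, Finset.sum_eq_zero (s := Finset.univ)]
    · simp [hk]
    · simp [hk]
    · intro k' _ hk'
      simp [Fin.val_inj, hk']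
    · simp
    · intro j' _ hj
      simp [hj]
    · simp

/-- The rows of the states `up j k` and `base` differ by the transitions in which the history that
is recorded by `up j k` is taken into account. -/
theorem sum_step_up_sub (x : State D → ℤ) (j : Fin D.m) (k : Fin (D.block j).r) :
    (∑ t, (step (.up j k) t).elim 0 x) - ∑ t, (step .base t).elim 0 x =
      if h : (k : ℕ) + 1 < (D.block j).r then
        ((D.block j).c (k + 2) : ℤ) * (x (.up j ⟨k + 1, h⟩) - x .base)
      else ((D.block j).d : ℤ) * (x .base - x (.down j ⟨0, r_pos j⟩)) := by
  rw [← Finset.sum_sub_distrib, sum_syllable]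
  simp only [step, apply_ite (Option.elim · 0 x), Option.elim_some,
    Finset.sum_const, Finset.card_univ, Fintype.card_fin, nsmul_eq_mul, mul_zero, add_zero,
    sub_self]
  have hmain : ∀ (j' : Fin D.m) (k' : Fin (D.block j').r),
      ((if (k' : ℕ) = 0 ∨ j' = j ∧ (k' : ℕ) = k + 1 then x (.up j' k') else x .base) -
        if (k' : ℕ) = 0 then x (.up j' k') else x .base) =
      if j' = j ∧ (k' : ℕ) = k + 1 then x (.up j' k') - x .base else 0 := by
    intro j' k'
    by_cases h1 : (k' : ℕ) = 0
    · simp [h1]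
    · by_cases h2 : j' = j ∧ (k' : ℕ) = k + 1
      · rw [if_pos (Or.inr h2), if_neg h1, if_pos h2]
      · rw [if_neg (by tauto), if_neg h1, if_neg h2, sub_self]
  have hbeta : ∀ j' : Fin D.m,
      ((if j' = j ∧ (k : ℕ) + 1 = (D.block j).r then x .base else x (.down j' ⟨0, r_pos j'⟩)) -
        x (.down j' ⟨0, r_pos j'⟩)) =
      if j' = j ∧ (k : ℕ) + 1 = (D.block j).r then
        x .base - x (.down j' ⟨0, r_pos j'⟩) else 0 := by
    intro j'
    split_ifs <;> simp
  simp only [hmain, hbeta]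
  rw [Finset.sum_eq_single j (fun j' _ hj => by simp [hj]) (by simp),
    Finset.sum_eq_single j (fun j' _ hj => by simp [hj]) (by simp)]
  by_cases h : (k : ℕ) + 1 < (D.block j).r
  · rw [dif_pos h, Finset.sum_eq_single ⟨k + 1, h⟩]
    · rw [if_pos ⟨rfl, rfl⟩, if_neg (by omega)]
      simp
    · intro k' _ hk
      rw [if_neg (fun h1 => hk (Fin.ext h1.2)), mul_zero]
    · simp
  · rw [dif_neg h, Finset.sum_eq_zero, if_pos ⟨rfl, by have := k.2; omega⟩, zero_add]
    intro k' _
    rw [if_neg (fun h1 => h (by have := k'.2; omega)), mul_zero]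

/-- The matrix `Id - A` of the graph of the automaton after the row of `base` has been subtracted
from the rows of the states `up j k`. -/
noncomputable def reducedMatrix (D : HParams) : Matrix
    (Unit ⊕ ((Σ j : Fin D.m, Fin (D.block j).r) ⊕ (Σ j : Fin D.m, Fin (D.block j).r)))
    (Unit ⊕ ((Σ j : Fin D.m, Fin (D.block j).r) ⊕ (Σ j : Fin D.m, Fin (D.block j).r))) ℤ :=
  Matrix.fromBlocks 1 0 (Matrix.of fun i _ => Sum.elim (fun _ => -1) (fun _ => 0) i) 1 *
    (1 - D.graph.adjacency).submatrix (stateEquiv D).symm (stateEquiv D).symm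

theorem sameDetCoker_reducedMatrix :
    SameDetCoker (1 - D.graph.adjacency) D.reducedMatrix :=
  (sameDetCoker_reindex _ (stateEquiv D)).trans
    (sameDetCoker_mul_left _ _ (by rw [Matrix.det_fromBlocks_zero₁₂]; simp)).symm

theorem reducedMatrix_mulVec (x : State D → ℤ) :
    D.reducedMatrix.mulVec (x ∘ (stateEquiv D).symm) =
      Sum.elim (fun _ => x .base - ∑ t, (step .base t).elim 0 x) (Sum.elim
        (fun i => x (.up i.1 i.2) - x .base -
          if h : (i.2 : ℕ) + 1 < (D.block i.1).r then
            ((D.block i.1).c (i.2 + 2) : ℤ) * (x (.up i.1 ⟨i.2 + 1, h⟩) - x .base)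
          else ((D.block i.1).d : ℤ) * (x .base - x (.down i.1 ⟨0, r_pos i.1⟩)))
        (fun i => x (.down i.1 i.2) -
          ((D.block i.1).c (i.2 + 1) : ℤ) * x (State.next i.1 i.2))) := by
  rw [reducedMatrix, ← Matrix.mulVec_mulVec, Matrix.submatrix_mulVec_equiv, Equiv.symm_symm,
    Function.comp_assoc, Equiv.symm_comp_self, Function.comp_id, Matrix.fromBlocks_mulVec]
  funext i
  rcases i with ⟨⟩ | i | i
  · simp only [Sum.elim_inl, Matrix.one_mulVec, Matrix.zero_mulVec, add_zero, Function.comp_apply]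
    exact one_sub_adjacency_mulVec x .base
  · have h1 := sum_step_up_sub x i.1 i.2
    have h2 := one_sub_adjacency_mulVec x (.up i.1 i.2)
    have h3 := one_sub_adjacency_mulVec x .base
    simp only [Sum.elim_inr, Sum.elim_inl, Matrix.one_mulVec, Pi.add_apply, Function.comp_apply]
    rw [← h1]
    simp only [Matrix.mulVec, dotProduct, Matrix.of_apply, Sum.elim_inl, Finset.univ_unique,
      Finset.sum_singleton, Function.comp_apply] at h2 h3 ⊢
    change -1 * (∑ q, (1 - D.graph.adjacency) .base q * x q) +
      (∑ q, (1 - D.graph.adjacency) (.up i.1 i.2) q * x q) = _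
    rw [h2, h3]
    ring
  · have h2 := one_sub_adjacency_mulVec x (.down i.1 i.2)
    rw [sum_step_down] at h2
    simp only [Sum.elim_inr, Matrix.one_mulVec, Pi.add_apply, Function.comp_apply]
    rw [← h2]
    simp only [Matrix.mulVec, dotProduct, Matrix.of_apply, Sum.elim_inr, Finset.univ_unique,
      Finset.sum_singleton, Function.comp_apply, zero_mul, zero_add]
    rfl

/-- A solution of the equations that are given by the rows of `reducedMatrix` other than that of
`base`. -/
def eliminationVector : State D → ℤ
  | .base => 1
  | .up j k => 1 + (∏ i ∈ Finset.Ico ((k : ℕ) + 2) ((D.block j).r + 1), ((D.block j).c i : ℤ)) *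
      (D.block j).d * (1 - ∏ i ∈ Finset.Ico 1 ((D.block j).r + 1), ((D.block j).c i : ℤ))
  | .down j k => ∏ i ∈ Finset.Ico ((k : ℕ) + 1) ((D.block j).r + 1), ((D.block j).c i : ℤ)

/-- The entry that remains in the row of `base` after the elimination of the other states. -/
theorem eliminationVector_base_sub :
    (eliminationVector (.base : State D) - ∑ t : Syllable D, (step .base t).elim 0 eliminationVector) =
      D.frag.detValue := by
  rw [sum_step_base]
  have hblock : ∀ j : Fin D.m,
      (∑ k : Fin (D.block j).r, ((D.block j).c (k + 1) : ℤ) *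
        (if (k : ℕ) = 0 then eliminationVector (.up j k) else eliminationVector (.base : State D))) +
      ((D.block j).c 1 : ℤ) * eliminationVector (.base : State D) +
      ((D.block j).d : ℤ) * eliminationVector (.down j ⟨0, r_pos j⟩) =
      (D.frag.alpha j + D.frag.alphaTilde j + ∑ k ∈ Finset.Ico 2 (D.frag.r j), D.frag.gamma j k) -
        (D.frag.gamma j (D.frag.r j) * D.frag.t j - D.frag.b j) := by
    intro j
    obtain ⟨n, hn⟩ : ∃ n, (D.block j).r = n + 2 := ⟨(D.block j).r - 2, by
      have := (D.block j).two_le_r; omega⟩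
    have h1 : ∀ X : ℤ, ∑ k : Fin (D.block j).r, ((D.block j).c (k + 1) : ℤ) *
        (if (k : ℕ) = 0 then X else 1) = (D.block j).c 1 * X +
          ∑ k ∈ Finset.Ico 2 (D.block j).r, ((D.block j).c k : ℤ) +
          (D.block j).c (D.block j).r := by
      intro X
      rw [Fin.sum_univ_eq_sum_range (fun k : ℕ => ((D.block j).c (k + 1) : ℤ) *
        (if k = 0 then X else 1)), hn, Finset.sum_range_succ', Finset.sum_range_succ,
        Finset.sum_Ico_eq_sum_range]
      simp only [add_tsub_cancel_right, Nat.add_eq_zero_iff, one_ne_zero, and_false, if_false,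
        mul_one, if_true, zero_add]
      rw [Finset.sum_congr rfl fun k _ => by rw [show k + 1 + 1 = 2 + k by ring]]
      ring
    have h2 : ∀ k : Fin (D.block j).r, (if (k : ℕ) = 0 then eliminationVector (.up j k)
        else eliminationVector (.base : State D)) = if (k : ℕ) = 0 then
          1 + (∏ i ∈ Finset.Ico 2 ((D.block j).r + 1), ((D.block j).c i : ℤ)) *
            (D.block j).d * (1 - ∏ i ∈ Finset.Ico 1 ((D.block j).r + 1), ((D.block j).c i : ℤ))
        else 1 := by
      intro k
      split_ifs with h
      · rw [eliminationVector, h]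
      · rfl
    simp only [h2, h1]
    have h3 : ∏ i ∈ Finset.Ico 1 ((D.block j).r + 1), ((D.block j).c i : ℤ) =
        (D.block j).c 1 * ∏ i ∈ Finset.Ico 2 ((D.block j).r + 1), ((D.block j).c i : ℤ) :=
      Finset.prod_eq_prod_Ico_succ_bot (by omega) _
    have h4 : ∏ i ∈ Finset.Ico 2 ((D.block j).r + 1), ((D.block j).c i : ℤ) =
        (∏ i ∈ Finset.Ico 2 (D.block j).r, ((D.block j).c i : ℤ)) *
          (D.block j).c (D.block j).r :=
      Finset.prod_Ico_succ_top (by omega) _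
    have h5 : Finset.Icc 2 (D.block j).r = Finset.Ico 2 ((D.block j).r + 1) := by
      ext; simp
    simp only [eliminationVector, FragParams.t, FragParams.b, frag, h3, h4, h5, zero_add]
    ring
  have hsum := Finset.sum_congr (rfl : (Finset.univ : Finset (Fin D.m)) = _) fun j _ => hblock j
  simp only [Finset.sum_add_distrib, Finset.sum_sub_distrib] at hsum
  rw [FragParams.detValue, FragParams.gammaSum]
  change _ = 1 - ((D.a : ℤ) + ∑ j : Fin D.m, (D.frag.alpha j + D.frag.alphaTilde j +
    ∑ k ∈ Finset.Ico 2 (D.frag.r j), D.frag.gamma j k)) +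
    ∑ j : Fin D.m, (D.frag.gamma j (D.frag.r j) * D.frag.t j - D.frag.b j)
  simp only [Finset.sum_add_distrib]
  rw [show eliminationVector (.base : State D) = 1 from rfl] at *
  linarith

/-- All states but `base` are eliminated from `reducedMatrix`: its block on these states is unipotent
with respect to the order in which the states `up j k`, `down j k` are visited. -/
theorem sameDetCoker_graph :
    SameDetCoker (1 - D.graph.adjacency) (Matrix.of fun _ _ : Unit => D.frag.detValue) := by
  refine sameDetCoker_reducedMatrix.trans (sameDetCoker_of_mulVec _
    (Matrix.of fun i _ => eliminationVector ((stateEquiv D).symm (.inr i))) _ ?_ ?_)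
  · rintro ⟨⟩
    have h1 : (Sum.elim (Pi.single () 1) fun i => (Matrix.of fun i (_ : Unit) =>
        eliminationVector ((stateEquiv D).symm (.inr i))) i ()) =
        (eliminationVector (D := D)) ∘ (stateEquiv D).symm := by
      funext i
      rcases i with ⟨⟩ | i
      · rfl
      · rfl
    rw [h1, reducedMatrix_mulVec]
    congr 1
    · funext i
      exact eliminationVector_base_sub
    · funext i
      rcases i with ⟨j, k⟩ | ⟨j, k⟩
      · simp only [Sum.elim_inl, Pi.zero_apply, eliminationVector]
        split_ifs with h
        · rw [Finset.prod_eq_prod_Ico_succ_bot (by omega)]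
          ring
        · rw [show (k : ℕ) + 2 = (D.block j).r + 1 by have := k.2; omega, Finset.Ico_self,
            Finset.prod_empty]
          ring
      · simp only [Sum.elim_inr, Pi.zero_apply, State.next]
        split_ifs with h
        · simp only [eliminationVector]
          rw [Finset.prod_eq_prod_Ico_succ_bot (by omega)]
          ring
        · simp only [eliminationVector]
          rw [Finset.prod_eq_prod_Ico_succ_bot (by omega),
            show (k : ℕ) + 1 + 1 = (D.block j).r + 1 by have := k.2; omega, Finset.Ico_self,
            Finset.prod_empty]
          ring
  · refine det_eq_one_of_grading _
      (Sum.elim (fun i => (i.2 : ℕ)) fun i => (D.block i.1).r + (i.2 : ℕ)) ?_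
    intro i i' hi
    have h1 : D.reducedMatrix.toBlocks₂₂ i i' =
        D.reducedMatrix.mulVec ((Pi.single ((stateEquiv D).symm (.inr i')) 1 : State D → ℤ) ∘
          (stateEquiv D).symm) (.inr i) := by
      have h2 : (Pi.single ((stateEquiv D).symm (.inr i')) 1 : State D → ℤ) ∘
          (stateEquiv D).symm = Pi.single (.inr i') 1 := by
        funext q
        simp [Pi.single_apply]
      rw [h2, Matrix.mulVec_single_one]
      rfl
    rw [h1, reducedMatrix_mulVec]
    have hbase : (Pi.single ((stateEquiv D).symm (.inr i')) 1 : State D → ℤ) .base = 0 := by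
      rw [Pi.single_eq_of_ne]
      rcases i' with i' | i' <;> exact fun h => by cases h
    have hdiag : (Pi.single ((stateEquiv D).symm (.inr i')) 1 : State D → ℤ)
        ((stateEquiv D).symm (.inr i)) = (1 : Matrix _ _ ℤ) i i' := by
      simp [Pi.single_apply, Matrix.one_apply]
    rw [← hdiag]
    rcases i with ⟨j, k⟩ | ⟨j, k⟩
    · simp only [Sum.elim_inr, Sum.elim_inl, hbase, sub_zero, zero_sub]
      refine sub_eq_self.2 ?_
      split_ifs with h
      · rw [Pi.single_eq_of_ne, mul_zero]
        intro he
        rcases i' with ⟨j', k'⟩ | ⟨j', k'⟩ <;> cases he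
        simp at hi
      · rw [Pi.single_eq_of_ne, neg_zero, mul_zero]
        intro he
        rcases i' with ⟨j', k'⟩ | ⟨j', k'⟩ <;> cases he
        simp only [Sum.elim_inl, Sum.elim_inr] at hi
        omega
    · simp only [Sum.elim_inr]
      refine sub_eq_self.2 ?_
      unfold State.next
      split_ifs with h
      · rw [Pi.single_eq_of_ne, mul_zero]
        intro he
        rcases i' with ⟨j', k'⟩ | ⟨j', k'⟩ <;> cases he
        simp only [Sum.elim_inr] at hi
        omega
      · rw [hbase, mul_zero]

/-- The row cokernel of a `1 × 1` matrix is cyclic. -/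
theorem isAddCyclic_rowCoker (M : Matrix Unit Unit ℤ) : IsAddCyclic (RowCoker M) := by
  refine ⟨Submodule.Quotient.mk fun _ => 1, fun x => ?_⟩
  obtain ⟨y, rfl⟩ := Submodule.Quotient.mk_surjective _ x
  refine ⟨y (), ?_⟩
  simp only [← Submodule.Quotient.mk_smul]
  congr 1
  funext i
  simp

end HParams

/-! ### Primitive words -/

/-- A word that commutes with `u` and whose length is a multiple of the length of `u` is a power of
`u`. -/
theorem eq_flatten_replicate_of_append_comm {A : Type} (u : List A) (m : ℕ) (s : List A)
    (hs : s.length = m * u.length) (h : u ++ s = s ++ u) : s = (List.replicate m u).flatten := by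
  induction m generalizing s with
  | zero => simpa using hs
  | succ m ih =>
    rw [Nat.succ_mul] at hs
    obtain ⟨s', rfl⟩ := List.prefix_of_prefix_length_le (List.prefix_append u s)
      (h ▸ List.prefix_append s u) (by omega)
    rw [List.append_assoc, List.append_cancel_left_eq] at h
    rw [List.replicate_succ, List.flatten_cons,
      ← ih s' (by rw [List.length_append] at hs; omega) h]

/-- A primitive word is not equal to any of its proper cyclic rotations. -/
theorem IsPrimitiveWord.rotate_ne {A : Type} {v : List A} (hv : IsPrimitiveWord v) {q : ℕ}
    (hq : 0 < q) (hqv : q < v.length) : v.rotate q ≠ v := by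
  intro h
  have hmul : ∀ k, v.rotate (q * k) = v := fun k => by
    induction k with
    | zero => simp
    | succ k ih => rw [Nat.mul_succ, ← List.rotate_rotate, ih, h]
  -- by Bézout, `v` is also invariant under the rotation by the greatest common divisor
  obtain ⟨k, -, hk⟩ := Nat.exists_mul_mod_eq_gcd (k := v.length) (n := q)
    (lt_of_le_of_lt (Nat.gcd_le_left _ hq) hqv)
  have hg : v.rotate (q.gcd v.length) = v := by
    rw [← hk, List.rotate_mod, hmul]
  obtain ⟨g, hgdef⟩ : ∃ g, g = q.gcd v.length := ⟨_, rfl⟩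
  have hgq : g ≤ q := hgdef ▸ Nat.gcd_le_left _ hq
  rw [← hgdef, List.rotate_eq_drop_append_take (by omega)] at hg
  obtain ⟨m, hm⟩ : g ∣ v.length := hgdef ▸ Nat.gcd_dvd_right _ _
  have hg0 : 0 < g := Nat.pos_of_ne_zero fun h0 => by rw [h0, zero_mul] at hm; omega
  have hlen : (v.take g).length = g := by simp; omega
  obtain - | m := m
  · omega
  have h1 := eq_flatten_replicate_of_append_comm (v.take g) m (v.drop g)
    (by rw [hlen, List.length_drop, hm, Nat.mul_succ, mul_comm m]; omega)
    ((List.take_append_drop g v).trans hg.symm)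
  refine hv.2 (v.take g) (m + 1) ?_ ?_
  · rcases m with - | m
    · omega
    · omega
  · rw [List.replicate_succ, List.flatten_cons, ← h1, List.take_append_drop]

/-! ### The syllables of a list in the class `H` -/

namespace HParams

variable {D : HParams}

/-- The words `γ₂ ⋯ γ_k` in the block `j`. -/
inductive GammaWord (j : Fin D.m) : ℕ → List (Syllable D) → Prop
  | nil : GammaWord j 1 []
  | snoc {k : ℕ} {u : List (Syllable D)} (h : k < (D.block j).r) (hk : k ≠ 0)
      (i : Fin ((D.block j).c (k + 1))) (hu : GammaWord j k u) :
      GammaWord j (k + 1) (u ++ [.main j ⟨k, h⟩ i])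

theorem GammaWord.upWord {j : Fin D.m} {k : ℕ} {g : List (Syllable D)} (hg : GammaWord j k g)
    (i : Fin ((D.block j).c 1)) : UpWord j k (.main j ⟨0, r_pos j⟩ i :: g) := by
  induction hg with
  | nil => exact UpWord.snoc (r_pos j) i UpWord.nil
  | snoc h hk i' _ ih => exact UpWord.snoc h i' ih

theorem GammaWord.downWord {j : Fin D.m} {k : ℕ} {g : List (Syllable D)} (hg : GammaWord j k g)
    (l : Fin (D.block j).d) (i : Fin ((D.block j).c 1)) :
    DownWord j k (.beta j l :: .tilde j i :: g) := by
  induction hg with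
  | nil => exact DownWord.tilde i (DownWord.beta l)
  | snoc h hk i' _ ih => exact DownWord.main h hk i' ih

theorem UpWord.exists_gammaWord {j : Fin D.m} {k : ℕ} {u : List (Syllable D)}
    (hu : UpWord j k u) (hk : k ≠ 0) : ∃ (i : Fin ((D.block j).c 1)) (g : List (Syllable D)),
      GammaWord j k g ∧ u = .main j ⟨0, r_pos j⟩ i :: g := by
  induction hu with
  | nil => exact absurd rfl hk
  | @snoc k u h i hu ih =>
    rcases Nat.eq_zero_or_pos k with rfl | hk
    · cases hu
      exact ⟨i, [], .nil, rfl⟩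
    · obtain ⟨i', g, hg, rfl⟩ := ih hk.ne'
      exact ⟨i', _, .snoc h hk.ne' i hg, rfl⟩

theorem DownWord.exists_gammaWord {j : Fin D.m} {k : ℕ} {u : List (Syllable D)}
    (hu : DownWord j k u) (hk : k ≠ 0) :
    ∃ (l : Fin (D.block j).d) (i : Fin ((D.block j).c 1)) (g : List (Syllable D)),
      GammaWord j k g ∧ u = .beta j l :: .tilde j i :: g := by
  induction hu with
  | beta l => exact absurd rfl hk
  | tilde i hu _ =>
    cases hu with
    | beta l => exact ⟨l, i, [], .nil, rfl⟩
  | main h hk' i hu ih =>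
    obtain ⟨l, i', g, hg, rfl⟩ := ih hk'
    exact ⟨l, i', _, .snoc h hk' i hg, rfl⟩

/-- The words that are denoted by the syllables, for given names of the letters of the blocks and
given additional words. -/
def syllableWord {B : Type} (ι : Fin D.m → BlockLetter → B) (f : Fin D.a → List B) :
    Syllable D → List B
  | .main j k i =>
    (if (k : ℕ) = 0 then (D.block j).alphaWord i else (D.block j).gammaWord (k + 1) i).map (ι j)
  | .tilde j i => ((D.block j).alphaTildeWord i).map (ι j)
  | .beta j l => ((D.block j).betaPower l).map (ι j)
  | .free v => f v

section

variable {B : Type} {ι : Fin D.m → BlockLetter → B} {f : Fin D.a → List B}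

theorem GammaWord.exists_index {j : Fin D.m} {k : ℕ} {g : List (Syllable D)}
    (hg : GammaWord j k g) : ∃ i : ℕ → ℕ, (∀ m, 2 ≤ m → m ≤ k → i m < (D.block j).c m) ∧
      g.flatMap (syllableWord ι f) = ((List.range' 2 (k - 1)).flatMap fun m =>
        (D.block j).gammaWord m (i m)).map (ι j) := by
  induction hg with
  | nil => exact ⟨fun _ => 0, fun m h1 h2 => by omega, rfl⟩
  | @snoc k u h hk i hu ih =>
    obtain ⟨i', h1, h2⟩ := ih
    refine ⟨Function.update i' (k + 1) i, fun m h3 h4 => ?_, ?_⟩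
    · rcases eq_or_ne m (k + 1) with rfl | h5
      · simp
      · rw [Function.update_of_ne h5]
        exact h1 m h3 (by omega)
    · obtain ⟨n, rfl⟩ := Nat.exists_eq_succ_of_ne_zero hk
      have h5 : ∀ m ∈ List.range' 2 n,
          (D.block j).gammaWord m (Function.update i' (n + 1 + 1) i m) =
            (D.block j).gammaWord m (i' m) := fun m hm => by
        rw [Function.update_of_ne]
        rw [List.mem_range'_1] at hm
        omega
      simp only [Nat.succ_eq_add_one, Nat.add_sub_cancel] at h2 ⊢
      rw [List.flatMap_append, h2, List.range'_1_concat, List.flatMap_append, List.map_append,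
        List.flatMap_congr h5]
      simp [syllableWord, show 2 + n = n + 1 + 1 by ring]

theorem exists_gammaWord_of_index (j : Fin D.m) {i : ℕ → ℕ} (k : ℕ) (hk : k + 1 ≤ (D.block j).r)
    (hi : (D.block j).IsIndex i) : ∃ g : List (Syllable D), GammaWord j (k + 1) g ∧
      g.flatMap (syllableWord ι f) = ((List.range' 2 k).flatMap fun m =>
        (D.block j).gammaWord m (i m)).map (ι j) := by
  induction k with
  | zero => exact ⟨[], .nil, rfl⟩
  | succ k ih =>
    obtain ⟨g, hg, h1⟩ := ih (by omega)
    refine ⟨_, .snoc (by omega) (by omega) ⟨i (k + 2), hi _ (by omega) (by omega)⟩ hg, ?_⟩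
    rw [List.flatMap_append, h1, List.range'_1_concat, List.flatMap_append, List.map_append]
    simp [syllableWord, show 2 + k = k + 1 + 1 by ring]

/-- The words of the block `j` in terms of syllables. -/
theorem mem_words_iff (j : Fin D.m) (v : List B) : v ∈ List.map (ι j) '' (D.block j).words ↔
    (∃ k i, v = syllableWord ι f (.main j k i)) ∨ (∃ i, v = syllableWord ι f (.tilde j i)) ∨
      (∃ u l, UpWord j (D.block j).r u ∧ v = (u ++ [Syllable.beta j l]).flatMap (syllableWord ι f)) ∨
      ∃ u, DownWord j (D.block j).r u ∧ v = u.flatMap (syllableWord ι f) := by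
  have hr := (D.block j).two_le_r
  constructor
  · have hex : ∀ i, (D.block j).IsIndex i → ∃ g : List (Syllable D),
        GammaWord j (D.block j).r g ∧
        g.flatMap (syllableWord ι f) = ((D.block j).gammaProduct i).map (ι j) := by
      intro i hi
      obtain ⟨g, hg, h1⟩ := exists_gammaWord_of_index (ι := ι) (f := f) j ((D.block j).r - 1)
        (by omega) hi
      rw [Nat.sub_add_cancel (by omega)] at hg
      exact ⟨g, hg, h1⟩
    rintro ⟨v', ⟨i, hi, rfl⟩ | ⟨i, hi, rfl⟩ | ⟨k, hk, hkr, i, hi, rfl⟩ | ⟨i, hi, l, hl, rfl⟩ |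
      ⟨i, hi, l, hl, rfl⟩, rfl⟩
    · exact Or.inl ⟨⟨0, r_pos j⟩, ⟨i, hi⟩, rfl⟩
    · exact Or.inr (Or.inl ⟨⟨i, hi⟩, rfl⟩)
    · obtain ⟨k, rfl⟩ : ∃ k', k = k' + 1 + 1 := ⟨k - 2, by omega⟩
      exact Or.inl ⟨⟨k + 1, by omega⟩, ⟨i, hi⟩, rfl⟩
    · obtain ⟨g, hg, h1⟩ := hex i hi
      refine Or.inr (Or.inr (Or.inl ⟨_, ⟨l, hl⟩,
        hg.upWord ⟨i 1, hi 1 le_rfl (by omega)⟩, ?_⟩))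
      rw [List.flatMap_append, List.flatMap_cons, h1]
      simp [syllableWord]
    · obtain ⟨g, hg, h1⟩ := hex i hi
      refine Or.inr (Or.inr (Or.inr ⟨_,
        hg.downWord ⟨l, hl⟩ ⟨i 1, hi 1 le_rfl (by omega)⟩, ?_⟩))
      rw [List.flatMap_cons, List.flatMap_cons, h1]
      simp [syllableWord]
  · have hindex : ∀ (i' : Fin ((D.block j).c 1)) (i : ℕ → ℕ),
        (∀ m, 2 ≤ m → m ≤ (D.block j).r → i m < (D.block j).c m) →
        ∃ i₁ : ℕ → ℕ, (D.block j).IsIndex i₁ ∧ i₁ 1 = i' ∧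
          (D.block j).gammaProduct i₁ = (D.block j).gammaProduct i := by
      intro i' i hi
      refine ⟨Function.update i 1 i', fun m h1 h2 => ?_, by simp, ?_⟩
      · rcases eq_or_ne m 1 with rfl | h3
        · simp
        · rw [Function.update_of_ne h3]
          exact hi m (by omega) h2
      · refine List.flatMap_congr fun m hm => ?_
        rw [List.mem_range'_1] at hm
        rw [Function.update_of_ne (by omega)]
    rintro (⟨k, i, rfl⟩ | ⟨i, rfl⟩ | ⟨u, l, hu, rfl⟩ | ⟨u, hu, rfl⟩)
    · rw [syllableWord]
      split_ifs with hk
      · refine ⟨_, Or.inl ⟨i, ?_, rfl⟩, rfl⟩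
        have := i.2
        simpa only [hk] using this
      · exact ⟨_, Or.inr (Or.inr (Or.inl ⟨k + 1, by omega, k.2, i, i.2, rfl⟩)), rfl⟩
    · exact ⟨_, Or.inr (Or.inl ⟨i, i.2, rfl⟩), rfl⟩
    · obtain ⟨i', g, hg, rfl⟩ := hu.exists_gammaWord (r_pos j).ne'
      obtain ⟨i, h1, h2⟩ := hg.exists_index (ι := ι) (f := f)
      obtain ⟨i₁, h3, h4, h5⟩ := hindex i' i h1
      refine ⟨_, Or.inr (Or.inr (Or.inr (Or.inl ⟨i₁, h3, l, l.2, rfl⟩))), ?_⟩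
      rw [List.flatMap_append, List.flatMap_cons, h2, h4, h5, BlockParams.gammaProduct]
      simp [syllableWord]
    · obtain ⟨l, i', g, hg, rfl⟩ := hu.exists_gammaWord (r_pos j).ne'
      obtain ⟨i, h1, h2⟩ := hg.exists_index (ι := ι) (f := f)
      obtain ⟨i₁, h3, h4, h5⟩ := hindex i' i h1
      refine ⟨_, Or.inr (Or.inr (Or.inr (Or.inr ⟨i₁, h3, l, l.2, rfl⟩))), ?_⟩
      rw [List.flatMap_cons, List.flatMap_cons, h2, h4, h5, BlockParams.gammaProduct]
      simp [syllableWord]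

end

end HParams

namespace HParams

open FiniteDigraph

variable {D : HParams} {B : Type}

/-- The letter `b` of the block `j` occurs in the syllable. -/
def IsLetterOf (j : Fin D.m) (b : BlockLetter) : Syllable D → Prop
  | .main j' k i => j' = j ∧ (((k : ℕ) = 0 ∧ ∃ s, b = .alpha i s) ∨
      ((k : ℕ) ≠ 0 ∧ ∃ s, b = .gamma (k + 1) i s))
  | .tilde j' i => j' = j ∧ ∃ s, b = .alphaTilde i s
  | .beta j' l => j' = j ∧ b = .beta l
  | .free _ => False

theorem IsLetterOf.unique {j : Fin D.m} {b : BlockLetter} {t t' : Syllable D}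
    (h : IsLetterOf j b t) (h' : IsLetterOf j b t') : t = t' := by
  rcases t with ⟨j₁, k₁, i₁⟩ | ⟨j₁, i₁⟩ | ⟨j₁, l₁⟩ | v <;>
    rcases t' with ⟨j₂, k₂, i₂⟩ | ⟨j₂, i₂⟩ | ⟨j₂, l₂⟩ | v' <;>
    simp only [IsLetterOf] at h h'
  · obtain ⟨rfl, ⟨h1, s, rfl⟩ | ⟨h1, s, rfl⟩⟩ := h <;>
      obtain ⟨rfl, ⟨h2, s', h3⟩ | ⟨h2, s', h3⟩⟩ := h' <;> cases hk : (rfl : j₂ = j₂)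
    · obtain rfl : k₁ = k₂ := Fin.ext (h1.trans h2.symm)
      rw [BlockLetter.alpha.injEq] at h3
      rw [Fin.ext h3.1]
    · cases h3
    · cases h3
    · rw [BlockLetter.gamma.injEq] at h3
      obtain rfl : k₁ = k₂ := Fin.ext (by omega)
      rw [Fin.ext h3.2.1]
  · obtain ⟨-, ⟨-, s, rfl⟩ | ⟨-, s, rfl⟩⟩ := h <;> obtain ⟨-, s', h3⟩ := h' <;> cases h3
  · obtain ⟨-, ⟨-, s, rfl⟩ | ⟨-, s, rfl⟩⟩ := h <;> obtain ⟨-, h3⟩ := h' <;> cases h3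
  · obtain ⟨-, ⟨-, s', rfl⟩ | ⟨-, s', rfl⟩⟩ := h' <;> obtain ⟨-, s, h3⟩ := h <;> cases h3
  · obtain ⟨rfl, s, rfl⟩ := h
    obtain ⟨rfl, s', h3⟩ := h'
    rw [BlockLetter.alphaTilde.injEq] at h3
    rw [Fin.ext h3.1]
  · obtain ⟨-, s, rfl⟩ := h
    obtain ⟨-, h3⟩ := h'
    cases h3
  · obtain ⟨-, ⟨-, s', rfl⟩ | ⟨-, s', rfl⟩⟩ := h' <;> obtain ⟨-, h3⟩ := h <;> cases h3
  · obtain ⟨-, s, rfl⟩ := h'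
    obtain ⟨-, h3⟩ := h
    cases h3
  · obtain ⟨rfl, rfl⟩ := h
    obtain ⟨rfl, h3⟩ := h'
    rw [BlockLetter.beta.injEq] at h3
    rw [Fin.ext h3]

section

variable {ι : Fin D.m → BlockLetter → B} {f : Fin D.a → List B}

theorem exists_isLetterOf {t : Syllable D} {x : B} (hx : x ∈ syllableWord ι f t) :
    (∃ v, t = .free v ∧ x ∈ f v) ∨
      ∃ j b, IsLetterOf j b t ∧ b ∈ lettersOf (D.block j).words ∧ x = ι j b := by
  rcases t with ⟨j, k, i⟩ | ⟨j, i⟩ | ⟨j, l⟩ | v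
  · obtain ⟨b, hb, rfl⟩ := List.mem_map.1 hx
    split_ifs at hb with hk
    · obtain ⟨s, hs, rfl⟩ := List.mem_map.1 hb
      refine Or.inr ⟨j, _, ⟨rfl, Or.inl ⟨hk, s, rfl⟩⟩, ⟨_, Or.inl ⟨i, ?_, rfl⟩, hb⟩, rfl⟩
      have := i.2
      simpa only [hk] using this
    · obtain ⟨s, hs, rfl⟩ := List.mem_map.1 hb
      exact Or.inr ⟨j, _, ⟨rfl, Or.inr ⟨hk, s, rfl⟩⟩,
        ⟨_, Or.inr (Or.inr (Or.inl ⟨k + 1, by omega, k.2, i, i.2, rfl⟩)), hb⟩, rfl⟩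
  · obtain ⟨b, hb, rfl⟩ := List.mem_map.1 hx
    obtain ⟨s, hs, rfl⟩ := List.mem_map.1 hb
    exact Or.inr ⟨j, _, ⟨rfl, s, rfl⟩, ⟨_, Or.inr (Or.inl ⟨i, i.2, rfl⟩), hb⟩, rfl⟩
  · obtain ⟨b, hb, rfl⟩ := List.mem_map.1 hx
    obtain rfl := List.eq_of_mem_replicate hb
    refine Or.inr ⟨j, _, ⟨rfl, rfl⟩, ⟨_, Or.inr (Or.inr (Or.inr (Or.inl
      ⟨fun _ => 0, fun m h1 h2 => (D.block j).c_pos m h1 h2, l, l.2, rfl⟩))), ?_⟩, rfl⟩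
    exact List.mem_append_right _ hb
  · exact Or.inl ⟨v, rfl, hx⟩

theorem exists_syllableWord_eq_map {t : Syllable D} (h : ∀ j l, t ≠ .beta j l)
    (h' : ∀ v, t ≠ .free v) : ∃ (j : Fin D.m) (u : List BlockLetter), u ∈ (D.block j).words ∧
      u.Nodup ∧ u ≠ [] ∧ syllableWord ι f t = u.map (ι j) := by
  rcases t with ⟨j, k, i⟩ | ⟨j, i⟩ | ⟨j, l⟩ | v
  · by_cases hk : (k : ℕ) = 0
    · refine ⟨j, _, Or.inl ⟨i, ?_, rfl⟩, ?_, ?_, by rw [syllableWord, if_pos hk]⟩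
      · have := i.2
        simpa only [hk] using this
      · exact List.nodup_range.map fun a b hab => by cases hab; rfl
      · have := (D.block j).n_pos 1 le_rfl (r_pos j)
        simp [BlockParams.alphaWord, this.ne']
    · refine ⟨j, _, Or.inr (Or.inr (Or.inl ⟨k + 1, by omega, k.2, i, i.2, rfl⟩)), ?_, ?_,
        by rw [syllableWord, if_neg hk]⟩
      · exact List.nodup_range.map fun a b hab => by cases hab; rfl
      · have := (D.block j).n_pos (k + 1) (by omega) k.2
        simp [BlockParams.gammaWord, this.ne']
  · refine ⟨j, _, Or.inr (Or.inl ⟨i, i.2, rfl⟩), ?_, ?_, rfl⟩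
    · exact List.nodup_range.map fun a b hab => by cases hab; rfl
    · have := (D.block j).n_pos 1 le_rfl (r_pos j)
      simp [BlockParams.alphaTildeWord, this.ne']
  · exact absurd rfl (h j l)
  · exact absurd rfl (h' v)

end

/-- The words of a list in `H̃` are spelled with syllables. -/
theorem IsListInHTilde.exists_isCoding {L : Language B} (h : D.IsListInHTilde L) :
    ∃ w : Syllable D → List B, IsCoding w ∧
      L = (fun ts : List (Syllable D) => ts.flatMap w) '' D.syllableList := by
  obtain ⟨W, V, hW, hdisj, hfin, hcard, hprim, hVdisj, hVW, hL⟩ := h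
  have hW' : ∀ j, ∃ ι : BlockLetter → B, Set.InjOn ι (lettersOf (D.block j).words) ∧
    W j = List.map ι '' (D.block j).words := hW
  choose ι hι hWι using hW'
  have := hfin.to_subtype
  let e : V ≃ Fin D.a := Finite.equivFinOfCardEq ((Nat.card_coe_set_eq V).trans hcard)
  let f : Fin D.a → List B := fun v => (e.symm v).1
  have hf : ∀ v, f v ∈ V := fun v => (e.symm v).2
  have hletter : ∀ j b, b ∈ lettersOf (D.block j).words → ι j b ∈ lettersOf (W j) := by
    rintro j b ⟨u, hu, hb⟩
    rw [hWι]
    exact ⟨_, ⟨u, hu, rfl⟩, List.mem_map_of_mem hb⟩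
  refine ⟨syllableWord ι f, ⟨?_, ?_, ?_⟩, ?_⟩
  · rintro t
    by_cases h1 : ∃ v, t = .free v
    · obtain ⟨v, rfl⟩ := h1
      exact (hprim _ (hf v)).1
    by_cases h2 : ∃ j l, t = .beta j l
    · obtain ⟨j, l, rfl⟩ := h2
      have := (D.block j).N_pos
      simp [syllableWord, BlockParams.betaPower, this.ne']
    · push Not at h1 h2
      obtain ⟨j, u, -, -, hu, h3⟩ := exists_syllableWord_eq_map (ι := ι) (f := f) h2 h1
      rw [h3]
      simpa using hu
  · intro t t' x hx hx'
    rcases exists_isLetterOf hx with ⟨v, rfl, h1⟩ | ⟨j, b, h1, h2, rfl⟩ <;>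
      rcases exists_isLetterOf hx' with ⟨v', rfl, h3⟩ | ⟨j', b', h3, h4, h5⟩
    · by_contra hne
      refine hVdisj _ (hf v) _ (hf v') (fun h => hne ?_) h1 h3
      rw [e.symm.injective (Subtype.ext h)]
    · exact absurd (h5 ▸ hletter j' b' h4) (hVW _ (hf v) j' x h1)
    · exact absurd (hletter j b h2) (hVW _ (hf v') j _ h3)
    · obtain rfl : j = j' := by
        by_contra hne
        exact (Set.disjoint_left.1 (hdisj j j' hne)) (hletter j b h2) (h5 ▸ hletter j' b' h4)
      obtain rfl := hι j h2 h4 h5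
      exact h1.unique h3
  · intro t ht q hq hqt
    by_cases h1 : ∃ v, t = .free v
    · obtain ⟨v, rfl⟩ := h1
      exact (hprim _ (hf v)).rotate_ne hq hqt
    · push Not at h1
      obtain ⟨j, u, hu, hnd, hne, h3⟩ := exists_syllableWord_eq_map (ι := ι) (f := f) ht h1
      rw [h3] at hqt ⊢
      intro hrot
      have hnd' : (u.map (ι j)).Nodup := hnd.map_on fun a ha b hb hab =>
        hι j ⟨u, hu, ha⟩ ⟨u, hu, hb⟩ hab
      have h4 := hnd'.rotate_congr (by simpa using hne) q 0 (by rw [hrot, List.rotate_zero])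
      rw [Nat.mod_eq_of_lt hqt, Nat.zero_mod] at h4
      omega
  · ext v
    rw [hL]
    have hWv := fun j => (iff_of_eq (congrArg (v ∈ ·) (hWι j))).trans (mem_words_iff (f := f) j v)
    constructor
    · rintro (⟨j, hj⟩ | hv)
      · rcases (hWv j).1 hj with ⟨k, i, rfl⟩ | ⟨i, rfl⟩ | ⟨u, l, hu, rfl⟩ | ⟨u, hu, rfl⟩
        · exact ⟨_, IsSyllableWord.single (.main j k i) (by simp), List.flatMap_singleton ..⟩
        · exact ⟨_, IsSyllableWord.single (.tilde j i) (by simp), List.flatMap_singleton ..⟩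
        · exact ⟨_, IsSyllableWord.up hu l, rfl⟩
        · exact ⟨_, IsSyllableWord.down hu, rfl⟩
      · refine ⟨_, IsSyllableWord.single (.free (e ⟨v, hv⟩)) (by simp), ?_⟩
        simp [syllableWord, f]
    · rintro ⟨ts, hts, rfl⟩
      rcases hts with ⟨t, ht⟩ | ⟨hu, l⟩ | hu
      · rcases t with ⟨j, k, i⟩ | ⟨j, i⟩ | ⟨j, l⟩ | v
        · exact Or.inl ⟨j, (hWv j).2 (Or.inl ⟨k, i, List.flatMap_singleton ..⟩)⟩
        · exact Or.inl ⟨j, (hWv j).2 (Or.inr (Or.inl ⟨i, List.flatMap_singleton ..⟩))⟩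
        · exact absurd rfl (ht j l)
        · refine Or.inr ?_
          have := hf v
          simpa [syllableWord] using this
      · exact Or.inl ⟨_, (hWv _).2 (Or.inr (Or.inr (Or.inl ⟨_, l, hu, rfl⟩)))⟩
      · exact Or.inl ⟨_, (hWv _).2 (Or.inr (Or.inr (Or.inr ⟨_, hu, rfl⟩)))⟩

/-! ### The substitution of words of constant length for letters -/

theorem getElem?_flatMap_ofFn {A : Type} {p : ℕ} (ι : B → Fin p → A) (v : List B) (k : ℕ)
    (i : Fin p) : (v.flatMap fun b => List.ofFn (ι b))[p * k + i]? = v[k]?.map fun b => ι b i := by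
  induction v generalizing k with
  | nil => simp
  | cons b v ih =>
    rw [List.flatMap_cons]
    rcases k with - | k
    · rw [List.getElem?_append_left (by simp)]
      simp
    · rw [List.getElem?_append_right (by rw [List.length_ofFn, Nat.mul_succ]; omega),
        List.length_ofFn, show p * (k + 1) + i - p = p * k + i by rw [Nat.mul_succ]; omega, ih]
      simp

theorem length_flatMap_ofFn {A : Type} {p : ℕ} (ι : B → Fin p → A) (v : List B) :
    (v.flatMap fun b => List.ofFn (ι b)).length = p * v.length := by
  induction v with
  | nil => simp
  | cons b v ih => simp [ih, Nat.mul_succ, add_comm]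

/-- The substitution of words with distinct letters for letters preserves the property of a word
not to be equal to any of its proper rotations. -/
theorem rotate_ne_of_substitution {A : Type} {p : ℕ} (ι : B → Fin p → A) (v : List B)
    (hι : ∀ b ∈ v, ∀ b' ∈ v, ∀ i i', ι b i = ι b' i' → b = b' ∧ i = i')
    (hv : ∀ q, 0 < q → q < v.length → v.rotate q ≠ v) {q : ℕ} (hq : 0 < q)
    (hqv : q < (v.flatMap fun b => List.ofFn (ι b)).length) :
    (v.flatMap fun b => List.ofFn (ι b)).rotate q ≠ v.flatMap fun b => List.ofFn (ι b) := by
  intro h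
  rw [length_flatMap_ofFn] at hqv
  have hp : 0 < p := Nat.pos_of_mul_pos_right (by omega : 0 < p * v.length)
  have hrot : ∀ k (hk : k < v.length), (v.flatMap fun b => List.ofFn (ι b))[
      (p * k + q) % (p * v.length)]? = some (ι v[k] ⟨0, hp⟩) := fun k hk => by
    have h1 := getElem?_flatMap_ofFn ι v k ⟨0, hp⟩
    have hlt : p * k < p * v.length := Nat.mul_lt_mul_of_pos_left hk hp
    rw [List.getElem?_eq_getElem hk] at h1
    rw [← h, List.getElem?_rotate (by rw [length_flatMap_ofFn]; simpa using hlt),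
      length_flatMap_ofFn] at h1
    exact h1
  -- the rotation sends first letters of substituted words to first letters
  have hs : q % p = 0 := by
    have hlt : q / p < v.length := Nat.div_lt_of_lt_mul hqv
    have h1 := hrot 0 (Nat.zero_lt_of_lt hlt)
    have h2 := getElem?_flatMap_ofFn ι v (q / p) ⟨q % p, Nat.mod_lt _ hp⟩
    simp only [Nat.div_add_mod] at h2
    rw [mul_zero, zero_add, Nat.mod_eq_of_lt hqv, h2, List.getElem?_eq_getElem hlt,
      Option.map_some, Option.some_inj] at h1
    exact congrArg Fin.val (hι _ (List.getElem_mem _) _ (List.getElem_mem _) _ _ h1).2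
  obtain ⟨q', rfl⟩ := Nat.dvd_of_mod_eq_zero hs
  have hq' : q' < v.length := Nat.lt_of_mul_lt_mul_left hqv
  refine hv q' (Nat.pos_of_mul_pos_left hq) hq' (List.ext_getElem (by simp) fun k h1 h2 => ?_)
  have h3 := hrot k h2
  have hmod : (k + q') % v.length < v.length := Nat.mod_lt _ (by omega)
  have h4 := getElem?_flatMap_ofFn ι v ((k + q') % v.length) ⟨0, hp⟩
  rw [← Nat.mul_add, Nat.mul_mod_mul_left] at h3
  rw [List.getElem?_eq_getElem hmod] at h4
  rw [List.getElem_rotate]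
  refine (hι _ (List.getElem_mem _) _ (List.getElem_mem _) ⟨0, hp⟩ ⟨0, hp⟩ ?_).1
  exact Option.some.inj (h4.symm.trans h3)

/-- All syllables occur in the words of a list. -/
theorem exists_mem_syllableList (t : Syllable D) : ∃ ts ∈ D.syllableList, t ∈ ts := by
  by_cases h : ∃ j l, t = .beta j l
  · obtain ⟨j, l, rfl⟩ := h
    obtain ⟨u, hu⟩ := exists_upWord j _ le_rfl
    exact ⟨_, IsSyllableWord.up hu l, by simp⟩
  · push Not at h
    exact ⟨_, IsSyllableWord.single t h, by simp⟩

/-- The words of a list in `H` are spelled with syllables. -/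
theorem IsListInH.exists_isCoding {A : Type} {L : Language A} (h : D.IsListInH L) :
    ∃ w : Syllable D → List A, IsCoding w ∧
      L = (fun ts : List (Syllable D) => ts.flatMap w) '' D.syllableList := by
  obtain ⟨B, -, L', ι, hL', hι, rfl⟩ := h
  obtain ⟨w, hw, rfl⟩ := hL'.exists_isCoding
  have hmem : ∀ t, ∀ b ∈ w t, b ∈ lettersOf
      ((fun ts : List (Syllable D) => ts.flatMap w) '' D.syllableList) := fun t b hb => by
    obtain ⟨ts, hts, ht⟩ := exists_mem_syllableList t
    exact ⟨_, ⟨ts, hts, rfl⟩, List.mem_flatMap.2 ⟨t, ht, hb⟩⟩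
  refine ⟨fun t => (w t).flatMap fun b => List.ofFn (ι b), ⟨fun t h => ?_, ?_, ?_⟩, ?_⟩
  · have h1 := congrArg List.length h
    rw [length_flatMap_ofFn, List.length_nil, Nat.mul_eq_zero, List.length_eq_zero_iff] at h1
    exact h1.elim D.p_pos.ne' (hw.ne_nil t)
  · intro t t' x hx hx'
    obtain ⟨b, hb, hx⟩ := List.mem_flatMap.1 hx
    obtain ⟨b', hb', hx'⟩ := List.mem_flatMap.1 hx'
    obtain ⟨i, rfl⟩ := (List.mem_ofFn' _ _).1 hx
    obtain ⟨i', h1⟩ := (List.mem_ofFn' _ _).1 hx'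
    obtain ⟨rfl, -⟩ := hι b (hmem t b hb) b' (hmem t' b' hb') i i' h1.symm
    exact hw.eq_of_mem t t' b hb hb'
  · exact fun t ht q hq hqt => rotate_ne_of_substitution ι (w t)
      (fun b hb b' hb' => hι b (hmem t b hb) b' (hmem t b' hb')) (hw.rotate_ne t ht) hq hqt
  · refine (Set.image_image (fun w : List B => w.flatMap fun b => List.ofFn (ι b))
      (fun ts => ts.flatMap w) D.syllableList).trans ?_
    congr 1
    funext ts
    exact List.flatMap_assoc

end HParams

theorem mainTheorem1 {A : Type} [Finite A] (D : HParams) (L : Language A)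
    (hL : D.IsListInH L) :
    (renewalSystem L).IsSFT ∧
    (∃ E : FiniteDigraph, ShiftSpace.Conjugate E.edgeShift (renewalSystem L)) ∧
    ∀ E : FiniteDigraph, ShiftSpace.FlowEquivalent E.edgeShift (renewalSystem L) →
      IsAddCyclic E.BowenFranks ∧ (1 - E.adjacency).det = D.frag.detValue := by
  obtain ⟨w, hw, rfl⟩ := hL.exists_isCoding
  have hconj := hw.conjugate
  refine ⟨?_, ⟨_, hconj⟩, fun E hE => ?_⟩
  · obtain ⟨N, hN⟩ := ShiftSpace.exists_isStep_of_conjugate hconj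
    exact hN.isSFT
  · have h1 : E.SameInvariants D.graph := FiniteDigraph.SameInvariants.trans
      (hE.invariants.2 E _ (ShiftSpace.Conjugate.refl _) hconj)
      (FiniteDigraph.subdivide_sameInvariants fun e => hw.ne_nil _)
    obtain ⟨h2, ⟨φ⟩⟩ := SameDetCoker.trans h1 HParams.sameDetCoker_graph
    refine ⟨?_, h2.trans (by simp)⟩
    have := HParams.isAddCyclic_rowCoker (Matrix.of fun _ _ : Unit => D.frag.detValue)
    exact isAddCyclic_of_surjective φ.symm φ.symm.surjective
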